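/- Let $k$ be an algebraically closed field of characteristic $p\ge 0$, and let $X$ be a smooth $k$-scheme of finite type, of pure dimension $n$, with cotangent bundle $\pi : T^*X\to X$. Let $C\subset T^*X$ be an irreducible closed conical (i.e. $\mathbb G_m$-invariant) subset of dimension $n$, equipped with its reduced scheme structure, and let $(x,\nu)$ be a closed point of $T^*X$ that lies in the regular locus of $C$. A function $f$ on a neighborhood $U$ of $x$ yields a section $df:U\to T^*X$, with differential $d^{(2)}f: TU\to T(T^*X)$. If $df(x)=\nu$ and $(x,\nu)$ is an isolated intersection point of $C$ and $df(U)$, let $\langle C,df\rangle_{(x,\nu)}$ be the intersection index of $C$ and $df(U)$ at $(x,\nu)$, i.e. the length of the local ring of the scheme-theoretic intersection at this point. For $\mu\in T^*_xX$ let $\mu^v\in T_{(x,\nu)}(T^*X)$ be the corresponding vertical tangent vector. If $p=2$, let $\kappa$ be the canonical quadratic form on $T_{(x,\nu)}(T^*X)$, given by $\kappa(\mu^v+d^{(2)}f(\tau))=\mu(\tau)$ for $\mu\in T^*_xX$, $\tau\in T_xX$, where $f$ is any function near $x$ with $df(x)=\nu$ (the result does not depend on $f$). A subspace of $T_{(x,\nu)}(T^*X)$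 is $\kappa$-isotropic if $\kappa$ vanishes on it. (i) There is $f\in\mathcal O_{X,x}$ with $df(x)=\nu$ and $\langle C,df\rangle_{(x,\nu)}=1$ if and only if the following condition $(*)$ is not satisfied: $(*)$ $p=2$, the tangent space $T_{(x,\nu)}C$ is $\kappa$-isotropic, and the rank of the map $d\pi : T_{(x,\nu)}C\to T_xX$ is odd. (ii) If $(*)$ holds, then there is $f\in\mathcal O_{X,x}$ with $df(x)=\nu$ and $\langle C,df\rangle_{(x,\nu)}=2$. -/

import Mathlib

open AlgebraicGeometry CategoryTheory

universe u

namespace SmoothScheme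

section VectorFields

theorem derivation_ext {k A B : Type*} [CommRing k] [CommRing A] [CommRing B] [Algebra k B]
    [Algebra A B] [Algebra.FormallyUnramified A B] {D₁ D₂ : Derivation k B B}
    (h : ∀ a : A, D₁ (algebraMap A B a) = D₂ (algebraMap A B a)) : D₁ = D₂ := by
  have h0 : ∀ a : A, (D₁ - D₂) (algebraMap A B a) = 0 := fun a => by simp [h a]
  let E : Derivation A B B :=
    { toFun := fun b => (D₁ - D₂) b
      map_add' := fun x y => map_add (D₁ - D₂) x y
      map_smul' := fun a x => by
        rw [Algebra.smul_def, Derivation.leibniz, h0, smul_zero, add_zero, algebraMap_smul]; rfl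
      map_one_eq_zero' := (D₁ - D₂).map_one_eq_zero
      leibniz' := fun x y => (D₁ - D₂).leibniz x y }
  have hE : E = 0 := by
    rw [← Derivation.liftKaehlerDifferential_comp E]
    have : E.liftKaehlerDifferential = 0 := Subsingleton.elim _ _
    rw [this]; rfl
  ext b
  have := congrArg (fun D : Derivation A B B => D b) hE
  exact sub_eq_zero.mp this

variable {k A B : Type*} [CommRing k] [CommRing A] [CommRing B] [Algebra k A] [Algebra k B]
  [Algebra A B] [IsScalarTower k A B]

variable (k A B) in
/-- The restriction of vector fields along an étale map `Spec B → Spec A`: the derivation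
`restrictField k A B θ` of `B` is the unique one that extends the derivation `θ` of `A`. -/
noncomputable def restrictField [Algebra.FormallyEtale A B] :
    Derivation k A A →ₗ[A] Derivation k B B where
  toFun θ := (((((Algebra.linearMap A B).compDer θ).liftKaehlerDifferential).liftBaseChange B ∘ₗ
    (KaehlerDifferential.tensorKaehlerEquivOfFormallyEtale k A B).symm.toLinearMap)).compDer
      (KaehlerDifferential.D k B)
  map_add' x y := derivation_ext (A := A) fun a => by
    simp [KaehlerDifferential.tensorKaehlerEquivOfFormallyEtale_symm_D_algebraMap]
  map_smul' r x := derivation_ext (A := A) fun a => by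
    simp [KaehlerDifferential.tensorKaehlerEquivOfFormallyEtale_symm_D_algebraMap,
      Algebra.smul_def]

theorem restrictField_algebraMap [Algebra.FormallyEtale A B] (θ : Derivation k A A) (a : A) :
    restrictField k A B θ (algebraMap A B a) = algebraMap A B (θ a) := by
  simp [restrictField, KaehlerDifferential.tensorKaehlerEquivOfFormallyEtale_symm_D_algebraMap]

theorem isBaseChange_restrictField [Algebra.FormallyEtale A B] (S : Submonoid A)
    [IsLocalization S B] [Module.FinitePresentation A Ω[A⁄k]] :
    IsBaseChange B (restrictField k A B) := by
  rw [← isLocalizedModule_iff_isBaseChange S]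
  let m := IsLocalizedModule.mapExtendScalars S (KaehlerDifferential.map k k A B)
    (Algebra.linearMap A B) B
  let eA := (KaehlerDifferential.linearMapEquivDerivation k A (M := A))
  let eB := (KaehlerDifferential.linearMapEquivDerivation k B (M := B)).restrictScalars A
  have h1 : IsLocalizedModule S m := inferInstance
  have h2 : IsLocalizedModule S (eB.toLinearMap ∘ₗ m) := IsLocalizedModule.of_linearEquiv S m eB
  have h3 : IsLocalizedModule S ((eB.toLinearMap ∘ₗ m) ∘ₗ eA.symm.toLinearMap) :=
    IsLocalizedModule.of_linearEquiv_right S _ eA.symm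
  convert h3 using 1
  ext θ : 1
  refine derivation_ext (A := A) fun a => ?_
  rw [restrictField_algebraMap]
  have := IsLocalizedModule.map_apply S (KaehlerDifferential.map k k A B)
    (Algebra.linearMap A B) (eA.symm θ) (KaehlerDifferential.D k A a)
  simp [KaehlerDifferential.map_D] at this
  simp [eB, m]
  rw [this]
  simp [eA]

end VectorFields
section Sym

theorem sym_ringHom_ext {A M T : Type*} [CommRing A] [AddCommGroup M] [Module A M] [CommRing T]
    {F G : SymmetricAlgebra A M →+* T}
    (h : ∀ a, F (algebraMap A _ a) = G (algebraMap A _ a))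
    (h' : ∀ m, F (SymmetricAlgebra.ι A M m) = G (SymmetricAlgebra.ι A M m)) : F = G := by
  let _ := (F.comp (algebraMap A _)).toAlgebra
  let F' : SymmetricAlgebra A M →ₐ[A] T := { F with commutes' := fun a => rfl }
  let G' : SymmetricAlgebra A M →ₐ[A] T := { G with commutes' := fun a => (h a).symm }
  have : F' = G' := SymmetricAlgebra.algHom_ext (by ext m; exact h' m)
  ext x; exact congrArg (fun f => f x) this

variable {A B M N : Type*} [CommRing A] [CommRing B] [Algebra A B]
  [AddCommGroup M] [Module A M] [AddCommGroup N] [Module A N] [Module B N] [IsScalarTower A B N]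

/-- The ring homomorphism `Sym_A M → Sym_B N` induced by an `A`-linear map `M → N`. -/
noncomputable def symMap (l : M →ₗ[A] N) : SymmetricAlgebra A M →+* SymmetricAlgebra B N :=
  (SymmetricAlgebra.lift ((SymmetricAlgebra.ι B N).restrictScalars A ∘ₗ l)).toRingHom

@[simp] theorem symMap_ι (l : M →ₗ[A] N) (m : M) :
    symMap (B := B) l (SymmetricAlgebra.ι A M m) = SymmetricAlgebra.ι B N (l m) := by
  simp [symMap]

@[simp] theorem symMap_algebraMap (l : M →ₗ[A] N) (a : A) :
    symMap (B := B) l (algebraMap A _ a) = algebraMap B _ (algebraMap A B a) := by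
  simp [symMap, IsScalarTower.algebraMap_apply A B (SymmetricAlgebra B N)]

theorem exists_sym_lift {l : M →ₗ[A] N} (hl : IsBaseChange B l) {T : Type*} [CommRing T]
    (p : B →+* T) (q : SymmetricAlgebra A M →+* T)
    (h : ∀ a, p (algebraMap A B a) = q (algebraMap A _ a)) :
    ∃ F : SymmetricAlgebra B N →+* T, (∀ b, F (algebraMap B _ b) = p b) ∧
      ∀ s, F (symMap (B := B) l s) = q s := by
  let _ := p.toAlgebra
  let _ := (p.comp (algebraMap A B)).toAlgebra
  have : IsScalarTower A B T := .of_algebraMap_eq fun _ => rfl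
  let q' : SymmetricAlgebra A M →ₐ[A] T := { q with commutes' := fun a => (h a).symm }
  let F := SymmetricAlgebra.lift (hl.lift (q'.toLinearMap ∘ₗ SymmetricAlgebra.ι A M))
  refine ⟨F.toRingHom, fun b => F.commutes b, fun s => ?_⟩
  have : F.toRingHom.comp (symMap (B := B) l) = q := by
    refine sym_ringHom_ext (fun a => ?_) fun m => ?_
    · simp [h a |>.symm]; rfl
    · simp [F, hl.lift_eq]; rfl
  exact congrArg (fun f => f s) this

theorem sym_ringHom_ext_of_isBaseChange {l : M →ₗ[A] N} (hl : IsBaseChange B l) {T : Type*}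
    [CommRing T] {F G : SymmetricAlgebra B N →+* T}
    (h : ∀ b, F (algebraMap B _ b) = G (algebraMap B _ b))
    (h' : ∀ s, F (symMap (B := B) l s) = G (symMap (B := B) l s)) : F = G := by
  refine sym_ringHom_ext h fun n => ?_
  induction n using hl.inductionOn with
  | zero => simp
  | tmul m => simpa using h' (SymmetricAlgebra.ι A M m)
  | smul b n hn => rw [map_smul, Algebra.smul_def, map_mul, map_mul, hn, h]
  | add x y hx hy => rw [map_add, map_add, map_add, hx, hy]

end Sym



section Over

open Limits Opposite

variable (k : Type u) [Field k]

theorem le_preimage_top {Y Z : Scheme.{u}} (f : Y ⟶ Z) (U : Y.Opens) : U ≤ f ⁻¹ᵁ ⊤ := le_top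

/-- Sections of the structure sheaf of a `k`-scheme form a `k`-algebra. -/
noncomputable instance algebraSections (Y : Scheme.{u}) [Y.Over (Spec (.of k))] (U : Y.Opens) :
    Algebra k Γ(Y, U) :=
  ((Scheme.ΓSpecIso (.of k)).inv ≫ (Y ↘ Spec (.of k)).appLE ⊤ U (le_preimage_top _ U)).hom.toAlgebra

theorem map_algebraSections {Y : Scheme.{u}} [Y.Over (Spec (.of k))] {U V : Y.Opens}
    (i : op U ⟶ op V) (c : k) :
    (Y.presheaf.map i).hom (algebraMap k Γ(Y, U) c) = algebraMap k Γ(Y, V) c := by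
  have h : ((Scheme.ΓSpecIso (.of k)).inv ≫ (Y ↘ Spec (.of k)).appLE ⊤ U (le_preimage_top _ U)) ≫
      Y.presheaf.map i =
      (Scheme.ΓSpecIso (.of k)).inv ≫ (Y ↘ Spec (.of k)).appLE ⊤ V (le_preimage_top _ V) := by
    rw [Category.assoc, Scheme.Hom.appLE_map]
  exact congrArg (fun f => f.hom c) h

/-- The local rings of a `k`-scheme are `k`-algebras. -/
noncomputable instance algebraStalk (Y : Scheme.{u}) [Y.Over (Spec (.of k))] (y : Y) :
    Algebra k (Y.presheaf.stalk y) :=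
  ((Y.presheaf.germ ⊤ y trivial).hom.comp (algebraMap k Γ(Y, ⊤))).toAlgebra

variable (X : Scheme.{u}) [X.Over (Spec (.of k))]

/-- Vector fields on the open `U`, which is going to be affine. -/
abbrev VectorField (U : X.Opens) : Type u := Derivation k Γ(X, U) Γ(X, U)

/-- The ring of functions on the cotangent bundle of the affine open `U`: the symmetric algebra
of the module of vector fields, a vector field `θ` being the function
`(x, ν) ↦ ν(θ_x)` on `T^* U`. -/
abbrev FunctionRing (U : X.Opens) : Type u := SymmetricAlgebra Γ(X, U) (VectorField k X U)

variable {X}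

/-- Restriction of functions from an affine open to a basic open subset of it. -/
noncomputable abbrev res {U V : X.AffineZariskiSite} (i : V ⟶ U) : Γ(X, U.1) →+* Γ(X, V.1) :=
  (((Scheme.AffineZariskiSite.toOpensFunctor X).op ⋙ X.presheaf).map i.op).hom

theorem res_id (U : X.AffineZariskiSite) (a : Γ(X, U.1)) : res (𝟙 U) a = a :=
  congrArg (fun f => f.hom a)
    (((Scheme.AffineZariskiSite.toOpensFunctor X).op ⋙ X.presheaf).map_id (op U))

theorem res_comp {U V W : X.AffineZariskiSite} (j : W ⟶ V) (i : V ⟶ U) (a : Γ(X, U.1)) :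
    res (j ≫ i) a = res j (res i a) :=
  congrArg (fun f => f.hom a)
    (((Scheme.AffineZariskiSite.toOpensFunctor X).op ⋙ X.presheaf).map_comp i.op j.op)

theorem exists_isLocalization {U V : X.AffineZariskiSite} (i : V ⟶ U) :
    ∃ r : Γ(X, U.1),
      letI : Algebra Γ(X, U.1) Γ(X, V.1) := (res i).toAlgebra
      IsLocalization.Away r Γ(X, V.1) := by
  obtain ⟨V, hV⟩ := V
  obtain ⟨r, rfl⟩ := i.le
  exact ⟨r, U.2.isLocalization_basicOpen r⟩

theorem isScalarTower_res {U V : X.AffineZariskiSite} (i : V ⟶ U) :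
    letI : Algebra Γ(X, U.1) Γ(X, V.1) := (res i).toAlgebra
    IsScalarTower k Γ(X, U.1) Γ(X, V.1) :=
  letI : Algebra Γ(X, U.1) Γ(X, V.1) := (res i).toAlgebra
  .of_algebraMap_eq fun c => (map_algebraSections k _ c).symm

theorem formallyEtale_res {U V : X.AffineZariskiSite} (i : V ⟶ U) :
    letI : Algebra Γ(X, U.1) Γ(X, V.1) := (res i).toAlgebra
    Algebra.FormallyEtale Γ(X, U.1) Γ(X, V.1) := by
  let _ : Algebra Γ(X, U.1) Γ(X, V.1) := (res i).toAlgebra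
  obtain ⟨r, hr⟩ := exists_isLocalization i
  exact .of_isLocalization (.powers r)

/-- Restriction of functions on the cotangent bundle, induced by the restriction of functions and
of vector fields on the base. -/
noncomputable def restrictFunction {U V : X.AffineZariskiSite} (i : V ⟶ U) :
    FunctionRing k X U.1 →+* FunctionRing k X V.1 :=
  letI : Algebra Γ(X, U.1) Γ(X, V.1) := (res i).toAlgebra
  haveI := isScalarTower_res k i
  haveI := formallyEtale_res i
  symMap (restrictField k Γ(X, U.1) Γ(X, V.1))

theorem restrictFunction_algebraMap {U V : X.AffineZariskiSite} (i : V ⟶ U) (a : Γ(X, U.1)) :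
    restrictFunction k i (algebraMap _ _ a) = algebraMap _ _ (res i a) := by
  let _ : Algebra Γ(X, U.1) Γ(X, V.1) := (res i).toAlgebra
  have := isScalarTower_res k i
  have := formallyEtale_res i
  exact symMap_algebraMap _ a

theorem exists_restrictFunction_ι {U V : X.AffineZariskiSite} (i : V ⟶ U)
    (θ : VectorField k X U.1) :
    ∃ θ' : VectorField k X V.1, (∀ a, θ' (res i a) = res i (θ a)) ∧
      restrictFunction k i (SymmetricAlgebra.ι _ _ θ) = SymmetricAlgebra.ι _ _ θ' := by
  let _ : Algebra Γ(X, U.1) Γ(X, V.1) := (res i).toAlgebra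
  have := isScalarTower_res k i
  have := formallyEtale_res i
  exact ⟨_, restrictField_algebraMap θ, symMap_ι _ θ⟩

theorem vectorField_ext {U V : X.AffineZariskiSite} (i : V ⟶ U) {θ₁ θ₂ : VectorField k X V.1}
    (h : ∀ a, θ₁ (res i a) = θ₂ (res i a)) : θ₁ = θ₂ := by
  let _ : Algebra Γ(X, U.1) Γ(X, V.1) := (res i).toAlgebra
  have := formallyEtale_res i
  exact derivation_ext (A := Γ(X, U.1)) h

variable (X) in
/-- The presheaf `U ↦ Sym(Der_k(𝒪(U)))` on affine opens. -/
noncomputable def functionPresheaf : X.AffineZariskiSiteᵒᵖ ⥤ CommRingCat.{u} where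
  obj U := .of (FunctionRing k X U.unop.1)
  map i := CommRingCat.ofHom (restrictFunction k i.unop)
  map_id U := by
    ext1
    refine sym_ringHom_ext (fun a => ?_) fun θ => ?_
    · exact (restrictFunction_algebraMap k _ a).trans (congrArg _ (res_id _ a))
    · obtain ⟨θ', h, e⟩ := exists_restrictFunction_ι k (𝟙 U.unop) θ
      obtain rfl : θ' = θ := vectorField_ext k (𝟙 U.unop) fun a => by rw [h, res_id, res_id]
      exact e
  map_comp {U V W} i j := by
    ext1
    refine sym_ringHom_ext (fun a => ?_) fun θ => ?_
    · change restrictFunction k (j.unop ≫ i.unop) _ =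
        restrictFunction k j.unop (restrictFunction k i.unop _)
      simp only [restrictFunction_algebraMap, res_comp]
    · obtain ⟨θ₁, h₁, e₁⟩ := exists_restrictFunction_ι k (j.unop ≫ i.unop) θ
      obtain ⟨θ₂, h₂, e₂⟩ := exists_restrictFunction_ι k i.unop θ
      obtain ⟨θ₃, h₃, e₃⟩ := exists_restrictFunction_ι k j.unop θ₂
      obtain rfl : θ₁ = θ₃ := vectorField_ext k (j.unop ≫ i.unop) fun a => by
        rw [h₁, res_comp, res_comp, h₃, h₂]
      change restrictFunction k (j.unop ≫ i.unop) _ =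
        restrictFunction k j.unop (restrictFunction k i.unop _)
      rw [e₁, e₂, e₃]

variable (X) in
/-- The structure map `𝒪(U) → Sym(Der_k(𝒪(U)))`. -/
noncomputable def functionPresheafMap :
    (Scheme.AffineZariskiSite.toOpensFunctor X).op ⋙ X.presheaf ⟶ functionPresheaf k X where
  app U := CommRingCat.ofHom (algebraMap Γ(X, U.unop.1) (FunctionRing k X U.unop.1))
  naturality U V i := by
    ext a
    exact (restrictFunction_algebraMap k i.unop a).symm

theorem isBaseChange_restrictField_res [Smooth (X ↘ Spec (.of k))] {U V : X.AffineZariskiSite}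
    (i : V ⟶ U) :
    letI : Algebra Γ(X, U.1) Γ(X, V.1) := (res i).toAlgebra
    haveI := isScalarTower_res k i
    haveI := formallyEtale_res i
    IsBaseChange Γ(X, V.1) (restrictField k Γ(X, U.1) Γ(X, V.1)) := by
  let _ : Algebra Γ(X, U.1) Γ(X, V.1) := (res i).toAlgebra
  have := isScalarTower_res k i
  have := formallyEtale_res i
  obtain ⟨r, hr⟩ := exists_isLocalization i
  have h : (algebraMap k Γ(X, U.1)).FinitePresentation := by
    have h1 : ((X ↘ Spec (.of k)).appLE ⊤ U.1 (le_preimage_top _ _)).hom.FinitePresentation :=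
      Scheme.Hom.finitePresentation_appLE _ (isAffineOpen_top _) U.2 _
    have h2 : (Scheme.ΓSpecIso (.of k)).inv.hom.FinitePresentation :=
      .of_bijective (ConcreteCategory.bijective_of_isIso (Scheme.ΓSpecIso (.of k)).inv)
    exact h1.comp h2
  have : Algebra.FinitePresentation k Γ(X, U.1) := by
    rwa [RingHom.finitePresentation_algebraMap] at h
  exact isBaseChange_restrictField (.powers r)

theorem coequifibered_functionPresheafMap [Smooth (X ↘ Spec (.of k))] :
    (functionPresheafMap k X).Coequifibered := by
  intro U V i
  let _ : Algebra Γ(X, U.unop.1) Γ(X, V.unop.1) := (res i.unop).toAlgebra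
  have := isScalarTower_res k i.unop
  have := formallyEtale_res i.unop
  have hl := isBaseChange_restrictField_res k i.unop
  have key (c : PushoutCocone
      (((Scheme.AffineZariskiSite.toOpensFunctor X).op ⋙ X.presheaf).map i)
      ((functionPresheafMap k X).app U)) :=
    exists_sym_lift hl c.inl.hom c.inr.hom fun a => congrArg (fun f => f.hom a) c.condition
  choose F hF₁ hF₂ using key
  refine ⟨⟨(functionPresheafMap k X).naturality i⟩,
    ⟨PushoutCocone.IsColimit.mk _ (fun c => CommRingCat.ofHom (F c)) ?_ ?_ ?_⟩⟩
  · intro c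
    ext b
    exact hF₁ c b
  · intro c
    ext b
    exact hF₂ c b
  · intro c m h₁ h₂
    ext1
    refine sym_ringHom_ext_of_isBaseChange hl (fun b => ?_) fun s => ?_
    · exact (congrArg (fun f => f.hom b) h₁).trans (hF₁ c b).symm
    · exact (congrArg (fun f => f.hom s) h₂).trans (hF₂ c s).symm


variable (X)

/-- The data for gluing `T^* X` from the schemes `T^* U = Spec Sym(Der_k(𝒪(U)))`, `U ⊆ X` affine. -/
noncomputable def gluingData [Smooth (X ↘ Spec (.of k))] :
    (Scheme.AffineZariskiSite.directedCover X).RelativeGluingData :=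
  Scheme.AffineZariskiSite.relativeGluingData (coequifibered_functionPresheafMap k (X := X))


variable [Smooth (X ↘ Spec (.of k))]

instance isLocallyDirected_gluingData :
    ((gluingData k X).functor ⋙ Scheme.forget).IsLocallyDirected :=
  Scheme.Cover.RelativeGluingData.instIsLocallyDirectedI₀CompFunctorForgetOfIsThin ..

/-- The cotangent bundle `T^* X` of a smooth `k`-scheme `X`. -/
noncomputable def cotangentBundle : Scheme.{u} := (gluingData k X).glued

/-- The projection `π : T^* X ⟶ X`. -/
noncomputable def proj : cotangentBundle k X ⟶ X := (gluingData k X).toBase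

noncomputable instance overCotangentBundle : (cotangentBundle k X).Over (Spec (.of k)) where
  hom := proj k X ≫ (X ↘ Spec (.of k))

variable {X}

/-- The open immersion `T^* U ⟶ T^* X` for an affine open `U`. Its image is `π⁻¹(U)`. -/
noncomputable def chart (U : X.AffineZariskiSite) :
    Spec (.of (FunctionRing k X U.1)) ⟶ cotangentBundle k X :=
  (gluingData k X).cover.f U

instance isOpenImmersion_chart (U : X.AffineZariskiSite) : IsOpenImmersion (chart k U) :=
  (gluingData k X).cover.map_prop U

theorem opensRange_chart (U : X.AffineZariskiSite) :
    (chart k U).opensRange = proj k X ⁻¹ᵁ U.1 := by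
  simpa using! ((gluingData k X).toBase_preimage_eq_opensRange_ι U).symm

theorem chart_proj (U : X.AffineZariskiSite) :
    chart k U ≫ proj k X =
      Spec.map (CommRingCat.ofHom (algebraMap Γ(X, U.1) (FunctionRing k X U.1))) ≫ U.2.fromSpec :=
  colimit.ι_desc _ _

/-- The germ at a point `e` of `T^* U ⊆ T^* X` of a function on `T^* U`. -/
noncomputable def germAt (U : X.AffineZariskiSite) {e : cotangentBundle k X}
    (he : e ∈ (chart k U) ''ᵁ ⊤) :
    FunctionRing k X U.1 →+* (cotangentBundle k X).presheaf.stalk e :=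
  ((Scheme.ΓSpecIso (.of (FunctionRing k X U.1))).inv ≫ ((chart k U).appIso ⊤).inv ≫
    (cotangentBundle k X).presheaf.germ _ e he).hom

/-- The pullback of functions on `T^* U` along the section `df : U → T^* U`, for a function `f`
on `U`: a vector field `θ`, considered as a function on `T^* U`, pulls back to `θ(f)`. -/
noncomputable def pullbackDifferential (U : X.AffineZariskiSite) (f : Γ(X, U.1)) :
    FunctionRing k X U.1 →ₐ[Γ(X, U.1)] Γ(X, U.1) :=
  SymmetricAlgebra.lift
    { toFun := fun θ => θ f
      map_add' := fun _ _ => rfl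
      map_smul' := fun _ _ => rfl }

/-- The section `df : U ⟶ T^* X` given by the differential of a function `f` on an affine
open `U`, which is identified with the spectrum of its coordinate ring. -/
noncomputable def differential (U : X.AffineZariskiSite) (f : Γ(X, U.1)) :
    Spec Γ(X, U.1) ⟶ cotangentBundle k X :=
  Spec.map (CommRingCat.ofHom (pullbackDifferential k U f).toRingHom) ≫ chart k U

theorem differential_proj (U : X.AffineZariskiSite) (f : Γ(X, U.1)) :
    differential k U f ≫ proj k X = U.2.fromSpec := by
  have h : CommRingCat.ofHom (algebraMap Γ(X, U.1) (FunctionRing k X U.1)) ≫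
      CommRingCat.ofHom (pullbackDifferential k U f).toRingHom = 𝟙 _ := by
    ext a
    exact (pullbackDifferential k U f).commutes a
  rw [differential, Category.assoc, chart_proj, ← Category.assoc, ← Spec.map_comp, h, Spec.map_id]
  exact Category.id_comp _

/-- Pullback of functions along multiplication by the scalar `t` in the fibres of `T^* U → U`. -/
noncomputable def scaling (U : X.AffineZariskiSite) (t : kˣ) :
    FunctionRing k X U.1 →ₐ[Γ(X, U.1)] FunctionRing k X U.1 :=
  SymmetricAlgebra.lift
    (algebraMap k Γ(X, U.1) t • SymmetricAlgebra.ι Γ(X, U.1) (VectorField k X U.1))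

/-- A subset of `T^* X` is conical if it is stable under the multiplication by nonzero scalars in
the fibres. For closed subsets, and `k` algebraically closed (so that the `k`-points are dense
in `𝔾_m`), this is invariance under `𝔾_m`. -/
def IsConical (C : Set (cotangentBundle k X)) : Prop :=
  ∀ (U : X.AffineZariskiSite) (t : kˣ),
    Spec.map (CommRingCat.ofHom (scaling k U t).toRingHom) ⁻¹' (chart k U ⁻¹' C) = chart k U ⁻¹' C

end Over

section Local

/-- The ideal, in the local ring of `E` at `e`, of the germs that vanish on the closed
subset `C` of `E`. -/
noncomputable def idealAt {E : Scheme.{u}} (C : Set E) (e : E) : Ideal (E.presheaf.stalk e) :=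
  PrimeSpectrum.vanishingIdeal (E.fromSpecStalk e ⁻¹' C)

/-- The closed subset `C` of `E`, with its reduced scheme structure, is regular at `e ∈ C`. -/
def IsRegularAt {E : Scheme.{u}} (C : Set E) (e : E) : Prop :=
  IsRegularLocalRing (E.presheaf.stalk e ⧸ idealAt C e)

/-- The intersection index at `σ(y)` of a closed subvariety `C` of `E` with an immersed
subvariety `σ : S ⟶ E`: the length of the local ring at `y` of the scheme-theoretic
intersection `σ⁻¹(C)`. It is `⊤` if the intersection is not isolated. At points where `C`, `S`
and `E` are regular and the dimensions of `C` and `S` are complementary, the higher `Tor`'s of the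
structure sheaves at an isolated intersection point vanish, so that this is the intersection
multiplicity. -/
noncomputable def intersectionIndex {E S : Scheme.{u}} (C : Set E) (σ : S ⟶ E) (y : S) : ℕ∞ :=
  Module.length (S.presheaf.stalk y)
    (S.presheaf.stalk y ⧸ (idealAt C (σ y)).map (σ.stalkMap y).hom)

variable (k : Type u) [Field k]

/-- The tangent space `T_y Y` of a `k`-scheme `Y` at a closed point `y`: the `k`-derivations of the
local ring with values in the residue field. -/
abbrev TangentSpaceAt (Y : Scheme.{u}) [Y.Over (Spec (.of k))] (y : Y) : Type u :=
  Derivation k (Y.presheaf.stalk y) (IsLocalRing.ResidueField (Y.presheaf.stalk y))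

/-- The tangent space of the closed subset `C` of `Y` (with its reduced scheme structure) at `y`, as
a subspace of the tangent space of `Y`. -/
def tangentSubspace {Y : Scheme.{u}} [Y.Over (Spec (.of k))] (C : Set Y) (y : Y) :
    Submodule k (TangentSpaceAt k Y y) where
  carrier := {w | ∀ g ∈ idealAt C y, w g = 0}
  add_mem' := fun hv hw g hg => by simp [hv g hg, hw g hg]
  zero_mem' := fun _ _ => rfl
  smul_mem' := fun c w hw g hg => by simp [hw g hg]

variable {X : Scheme.{u}} [X.Over (Spec (.of k))] [Smooth (X ↘ Spec (.of k))]

/-- The differential `T_e(T^* X) → T_{π(e)} X` of the projection `π`. The image of `w` is the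
derivation `g ↦ w(π^* g)` of the local ring of `X` at `π(e)`; it is considered here as a mere
function on that ring, with values in the residue field at `e` (for a closed
point `e` and `k` algebraically closed, both residue fields are `k`). -/
noncomputable def tangentProj (e : cotangentBundle k X) :
    TangentSpaceAt k (cotangentBundle k X) e →ₗ[k]
      (X.presheaf.stalk (proj k X e) →
        IsLocalRing.ResidueField ((cotangentBundle k X).presheaf.stalk e)) where
  toFun w := fun g => w (((proj k X).stalkMap e).hom g)
  map_add' _ _ := rfl
  map_smul' _ _ := rfl

/-- `κ(w) = c` for the canonical quadratic form `κ` (in characteristic 2) on the tangent space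
of `T^* X` at the closed point `e = (x, ν)`.

Let `f` be a function near `x` with `df(x) = ν`, and let `τ` be the image of the tangent
vector `w` in `T_x X`. Then `w = μ^v + d⁽²⁾f(τ)`, where `d⁽²⁾f` is the differential of the
section `df`, and `μ^v` is the vertical tangent vector that corresponds to some `μ ∈ T^*_x X`;
and `κ(w) = μ(τ)`.

Choose a function `g` near `x` with `μ = dg(x)`, so that `μ(τ) = τ(g)`. Functions on `T^* X`
near `e` are generated by functions on `X` and vector fields `θ`. The condition `df(x) = ν` means
that the functions `θ` and `π^*(θ(f))` coincide at `e` for all `θ`. Evaluated at functions on `X`,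
the formula for `w` holds by the choice of `τ`; evaluated at `θ` it reads
`w(θ) = θ(g)(x) + τ(θ(f))`. -/
def IsKappaValue {e : cotangentBundle k X} (w : TangentSpaceAt k (cotangentBundle k X) e)
    (c : IsLocalRing.ResidueField ((cotangentBundle k X).presheaf.stalk e)) : Prop :=
  ∃ (U : X.AffineZariskiSite) (he : e ∈ (chart k U) ''ᵁ ⊤) (f g : Γ(X, U.1)),
    let fibrewise (θ : VectorField k X U.1) := germAt k U he (SymmetricAlgebra.ι Γ(X, U.1) _ θ)
    let pullback (a : Γ(X, U.1)) := germAt k U he (algebraMap Γ(X, U.1) (FunctionRing k X U.1) a)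
    (∀ θ, IsLocalRing.residue _ (fibrewise θ) = IsLocalRing.residue _ (pullback (θ f))) ∧
    (∀ θ, w (fibrewise θ) = IsLocalRing.residue _ (pullback (θ g)) + w (pullback (θ f))) ∧
    c = w (pullback g)

/-- The tangent space of `C` at `e` is isotropic for the quadratic form `κ`. -/
def IsKappaIsotropic (C : Set (cotangentBundle k X)) (e : cotangentBundle k X) : Prop :=
  ∀ w ∈ tangentSubspace k C e, IsKappaValue k w 0

/-- The rank of the map `T_e C → T_{π(e)} X`. -/
noncomputable def projRank (C : Set (cotangentBundle k X)) (e : cotangentBundle k X) : ℕ :=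
  Module.finrank k ((tangentSubspace k C e).map (tangentProj k e))

/-- The exceptional condition: the characteristic is 2, the tangent space `T_e C` is `κ`-isotropic,
and the rank of `T_e C → T_{π(e)} X` is odd. -/
def IsExceptional (C : Set (cotangentBundle k X)) (e : cotangentBundle k X) : Prop :=
  ringChar k = 2 ∧ IsKappaIsotropic k C e ∧ Odd (projRank k C e)

/-- There is a function `f` on an affine neighbourhood `U` of `π(e)` with `df(π(e)) = e` such that
the intersection index of `C` and `df(U)` at `e` is `m`. The point `y` of `U` is `π(e)`, as `df` is
a section of `π`. -/
def HasFunctionOfIndex (C : Set (cotangentBundle k X)) (e : cotangentBundle k X) (m : ℕ∞) : Prop :=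
  ∃ (U : X.AffineZariskiSite) (f : Γ(X, U.1)) (y : Spec Γ(X, U.1)),
    differential k U f y = e ∧ intersectionIndex C (differential k U f) y = m

end Local

end SmoothScheme

/-!
Let `V = T_e C`. Étale coordinates `x i` of `X` near `π(e)`, together with the dual vector fields
as fibre coordinates, identify the tangent space of `T^* X` at `e` with `W × W^*`, where `W = k ^ n`.
If `df` passes through `e`, then the tangent space of `df(U)` at `e` is the graph of the Hessian
form `H` of `f` (`IsSectionAt.coords_comp`), and the tangent space of the scheme `C ∩ df(U)` is
the intersection of `V` with this graph (`IsSectionAt.exists_equiv`). So the index is one if and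
only if this intersection is trivial (`intersectionIndex_eq_one_iff`). As `C` is regular at `e`, of
local dimension `n` (`ringKrullDim_quotient_idealAt_eq`; all closed points of an irreducible variety
have the same local dimension), `V` has dimension `n`.

The Hessians of functions with `df(π(e)) = e` are the symmetrizations of bilinear forms: all
symmetric forms if `2 ≠ 0`, and all alternating forms if `2 = 0` (the squares `∂ i ^ 2` are then
derivations that vanish on the coordinates). Everything is thus reduced to linear algebra and to one
further argument.

* For a half-dimensional `V ⊆ W × W^*` there is a symmetrized form whose graph meets `V` trivially,
  unless `2 = 0` and `V` is isotropic for the quadratic form `(u, η) ↦ η(u)`; in that case the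
  intersection can still be made at most one-dimensional (`exists_graphInter_eq_bot_or`): an
  intersection of minimal dimension could otherwise be cut down by a perturbation of the form.
* In characteristic two `(u, η) ↦ η(u)` is the form `κ` in coordinates (`isKappaIsotropic_iff`), and
  for isotropic `V` the dimension of the intersection of `V` with the graph of an alternating form
  has the parity of the rank of `V → W`, because the rank of an alternating form is even
  (`even_finrank_graphInter_add`). So under the exceptional condition the intersection is never
  trivial, and for isotropic `V` it can be made trivial in all other cases.
* In the exceptional case, choose a Hessian for which the intersection is a line. The local ring of
  the intersection then has a principal nonzero maximal ideal, and if its length is not two, it admits a surjection to `k[t]/(t ^ 3)`. Adding a cube `l ^ 3` to `f` does not change the Hessian.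
  If there were such jets for two different multiples of the cube, then the difference of their
  second order terms would be a vector of `V` whose existence contradicts isotropy
  (`exists_length_eq_two`). The jets are handled as pairs of linear maps `IsJet`.

The charts of `T^* X` enter through germs (`IsGerm`): the local ring at a point of a chart is
a localization of the ring of functions on the chart, and the choice of the chart does not matter
(`tangentCoords_restrictCoordinates`, `exists_restrict_differential`).
-/

/-! ### Linear algebra of half-dimensional subspaces of `W × W^*` -/

namespace LagrangianLinearAlgebra

open Module

variable {k W : Type*} [Field k] [AddCommGroup W] [Module k W]

theorem exists_dual_of_linearIndependent {ι : Type*} {v : ι → W} (h : LinearIndependent k v)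
    (c : ι → k) : ∃ l : Dual k W, ∀ i, l (v i) = c i := by
  obtain ⟨g, hg⟩ := LinearMap.exists_extend ((Basis.span h).constr k c)
  refine ⟨g, fun i => ?_⟩
  have := LinearMap.congr_fun hg (Basis.span h i)
  rwa [Basis.constr_basis, LinearMap.comp_apply, Submodule.subtype_apply, Basis.span_apply] at this

/-- The first components of the intersection of `V` with the graph of `h`. -/
def graphInter (V : Submodule k (W × Dual k W)) (h : W →ₗ[k] Dual k W) : Submodule k W :=
  V.comap (LinearMap.id.prod h)

theorem mem_graphInter {V : Submodule k (W × Dual k W)} {h : W →ₗ[k] Dual k W} {u : W} :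
    u ∈ graphInter V h ↔ (u, h u) ∈ V := Iff.rfl

/-- The shear `(u, η) ↦ (u, η - h u)`. -/
def shear (h : W →ₗ[k] Dual k W) : (W × Dual k W) ≃ₗ[k] (W × Dual k W) where
  toFun v := (v.1, v.2 - h v.1)
  invFun v := (v.1, v.2 + h v.1)
  map_add' v w := by simp [add_sub_add_comm]
  map_smul' c v := by simp [smul_sub]
  left_inv v := by simp
  right_inv v := by simp

theorem graphInter_map_shear (V : Submodule k (W × Dual k W)) (h h' : W →ₗ[k] Dual k W) :
    graphInter (V.map (shear h).toLinearMap) h' = graphInter V (h + h') := by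
  ext u
  rw [mem_graphInter, mem_graphInter]
  constructor
  · rintro ⟨v, hv, e⟩
    have e1 : v.1 = u := congrArg Prod.fst e
    have e2 : v.2 - h v.1 = h' u := congrArg Prod.snd e
    have : v = (u, (h + h') u) :=
      Prod.ext e1 (by rw [LinearMap.add_apply, ← e2, e1]; simp)
    rwa [← this]
  · intro hv
    exact ⟨_, hv, Prod.ext rfl (by simp [shear])⟩

/-- The symmetrization of a bilinear form. In characteristic two this is an alternating form, and
all alternating forms arise in this way; otherwise all symmetric forms do. -/
abbrev symm (q : W →ₗ[k] Dual k W) : W →ₗ[k] Dual k W := q + q.flip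

/-- The rank one form `l₁ ⊗ l₂`. -/
abbrev tensor (l₁ l₂ : Dual k W) : W →ₗ[k] Dual k W := l₁.smulRight l₂

/-- First order perturbation: if the kernel and the cokernel of `snd : V → W^*` pair nontrivially
under some symmetrized form, then a generic multiple of that form cuts down the intersection. -/
theorem exists_graphInter_lt_of_linearIndependent [FiniteDimensional k W] [Infinite k]
    (V : Submodule k (W × Dual k W)) {z y : W} (hz : (z, (0 : Dual k W)) ∈ V)
    (hy : ∀ v ∈ V, v.2 y = 0) (hzy : LinearIndependent k ![z, y]) :
    ∃ q : W →ₗ[k] Dual k W, finrank k (graphInter V (symm q)) < finrank k (graphInter V 0) := by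
  obtain ⟨l₁, h1⟩ := exists_dual_of_linearIndependent hzy ![1, 0]
  obtain ⟨l₂, h2⟩ := exists_dual_of_linearIndependent hzy ![0, 1]
  have h1z : l₁ z = 1 := h1 0
  have h1y : l₁ y = 0 := h1 1
  have h2z : l₂ z = 0 := h2 0
  have h2y : l₂ y = 1 := h2 1
  have key (s : k) (hs : s ≠ 0) (u : W) (hu : u ∈ graphInter V (symm (s • tensor l₁ l₂))) :
      l₁ u = 0 ∧ (u, (s * l₂ u) • l₁) ∈ V := by
    have e (v : W) : symm (s • tensor l₁ l₂) u v = s * (l₁ u * l₂ v + l₁ v * l₂ u) := by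
      simp [symm, tensor]; ring
    have hu1 : l₁ u = 0 := by
      have : symm (s • tensor l₁ l₂) u y = 0 := hy _ hu
      rw [e, h2y, h1y] at this
      simpa [hs] using this
    refine ⟨hu1, ?_⟩
    have : symm (s • tensor l₁ l₂) u = (s * l₂ u) • l₁ := by
      ext v; rw [e, hu1]; simp; ring
    rwa [← this]
  have hlt : graphInter V 0 ⊓ LinearMap.ker l₁ < graphInter V 0 := by
    refine lt_of_le_of_ne inf_le_left fun h => ?_
    have hz' : z ∈ graphInter V 0 := mem_graphInter.2 hz
    rw [← h] at hz'
    exact one_ne_zero (h1z.symm.trans hz'.2)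
  by_cases hl : ∃ τ, (τ, l₁) ∈ V
  · obtain ⟨τ, hτ, h1τ⟩ : ∃ τ, (τ, l₁) ∈ V ∧ l₁ τ = 0 := by
      obtain ⟨τ, hτ⟩ := hl
      exact ⟨τ - l₁ τ • z, by simpa using V.sub_mem hτ (V.smul_mem (l₁ τ) hz), by simp [h1z]⟩
    -- For `s ≠ (l₂ τ)⁻¹`, the map `F` below embeds the new intersection into the hyperplane
    -- `l₁ = 0` of the old one.
    obtain ⟨s, hs⟩ := (Set.toFinite {0, (l₂ τ)⁻¹}).exists_notMem
    obtain ⟨hs0, hs1⟩ : s ≠ 0 ∧ s ≠ (l₂ τ)⁻¹ := by simpa using hs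
    have hs2 : 1 - s * l₂ τ ≠ 0 := fun h => hs1 (eq_inv_of_mul_eq_one_left (sub_eq_zero.1 h).symm)
    refine ⟨s • tensor l₁ l₂, lt_of_le_of_lt ?_ (Submodule.finrank_lt_finrank_of_lt hlt)⟩
    let F : W →ₗ[k] W := LinearMap.id - (s • l₂).smulRight τ
    have hF (u : W) : F u = u - (s * l₂ u) • τ := by simp [F]
    have hmem (u : W) (hu : u ∈ graphInter V (symm (s • tensor l₁ l₂))) :
        F u ∈ graphInter V 0 ⊓ LinearMap.ker l₁ := by
      obtain ⟨a, b⟩ := key s hs0 u hu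
      refine ⟨?_, by simp [hF, a, h1τ]⟩
      rw [SetLike.mem_coe, mem_graphInter, hF]
      simpa using V.sub_mem b (V.smul_mem (s * l₂ u) hτ)
    refine LinearMap.finrank_le_finrank_of_injective (f := F.restrict hmem) ?_
    refine (injective_iff_map_eq_zero _).2 fun u hu => ?_
    have hu0 : (u : W) - (s * l₂ u) • τ = 0 := by rw [← hF]; exact congrArg Subtype.val hu
    have hu2 : l₂ (u : W) * (1 - s * l₂ τ) = 0 := by
      have := congrArg l₂ hu0
      simp only [map_sub, map_smul, smul_eq_mul, map_zero] at this
      linear_combination this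
    have hu3 : l₂ (u : W) = 0 := (mul_eq_zero.1 hu2).resolve_right hs2
    rw [hu3, mul_zero, zero_smul, sub_zero] at hu0
    exact Subtype.ext hu0
  · refine ⟨(1 : k) • tensor l₁ l₂, lt_of_le_of_lt (Submodule.finrank_mono fun u hu => ?_)
      (Submodule.finrank_lt_finrank_of_lt hlt)⟩
    obtain ⟨a, b⟩ := key 1 one_ne_zero u hu
    have h0 : l₂ u = 0 := by
      by_contra h0
      refine hl ⟨(l₂ u)⁻¹ • u, ?_⟩
      have := V.smul_mem (l₂ u)⁻¹ b
      rwa [one_mul, Prod.smul_mk, smul_smul, inv_mul_cancel₀ h0, one_smul] at this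
    rw [h0, mul_zero, zero_smul] at b
    exact ⟨b, a⟩

theorem finrank_map_snd_add [FiniteDimensional k W] (V : Submodule k (W × Dual k W)) :
    finrank k (V.map (LinearMap.snd k W (Dual k W))) + finrank k (graphInter V 0) =
      finrank k V := by
  have h := LinearMap.finrank_range_add_finrank_ker (K := k) (V := V) (V₂ := Dual k W)
    ((LinearMap.snd k W (Dual k W)).domRestrict V)
  rw [← h, LinearMap.range_domRestrict]
  congr 1
  refine LinearEquiv.finrank_eq (LinearEquiv.symm ?_)
  exact
    { toFun := fun v => ⟨v.1.1.1, by
        have : v.1.1 = (v.1.1.1, (0 : W →ₗ[k] Dual k W) v.1.1.1) := Prod.ext rfl v.2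
        exact mem_graphInter.2 (this ▸ v.1.2)⟩
      invFun := fun u => ⟨⟨(u, 0), u.2⟩, rfl⟩
      map_add' := fun _ _ => rfl
      map_smul' := fun _ _ => rfl
      left_inv := fun v => Subtype.ext (Subtype.ext (Prod.ext rfl (v.2 : v.1.1.2 = 0).symm))
      right_inv := fun _ => rfl }

/-- One improvement step: the intersection with the zero section can be cut down unless it is
trivial, or one-dimensional with `V` isotropic in characteristic two. -/
theorem exists_graphInter_lt [FiniteDimensional k W] [Infinite k]
    (V : Submodule k (W × Dual k W)) (hV : finrank k V = finrank k W)
    (h0 : graphInter V 0 ≠ ⊥)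
    (h : ¬ ((2 : k) = 0 ∧ (∀ v ∈ V, v.2 v.1 = 0) ∧ finrank k (graphInter V 0) = 1)) :
    ∃ q : W →ₗ[k] Dual k W, finrank k (graphInter V (symm q)) < finrank k (graphInter V 0) := by
  set Y := (V.map (LinearMap.snd k W (Dual k W))).dualCoannihilator with hYdef
  have hY {y : W} : y ∈ Y ↔ ∀ v ∈ V, v.2 y = 0 := by
    rw [hYdef, Submodule.mem_dualCoannihilator]
    exact ⟨fun h v hv => h _ ⟨v, hv, rfl⟩, by rintro h _ ⟨v, hv, rfl⟩; exact h v hv⟩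
  have hdim : finrank k Y = finrank k (graphInter V 0) := by
    have h1 := Subspace.finrank_add_finrank_dualCoannihilator_eq
      (V.map (LinearMap.snd k W (Dual k W)))
    have h2 := finrank_map_snd_add V
    rw [← hYdef] at h1
    omega
  obtain ⟨z, hz, hz0⟩ := Submodule.exists_mem_ne_zero_of_ne_bot h0
  by_cases hex : ∃ y ∈ Y, LinearIndependent k ![z, y]
  · obtain ⟨y, hy, hzy⟩ := hex
    exact exists_graphInter_lt_of_linearIndependent V hz (hY.1 hy) hzy
  have hYz : Y ≤ Submodule.span k {z} := by
    intro y hy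
    by_contra hn
    refine hex ⟨y, hy, (LinearIndependent.pair_iff' hz0).2 fun a ha => hn ?_⟩
    exact Submodule.mem_span_singleton.2 ⟨a, ha⟩
  have hd1 : finrank k (graphInter V 0) = 1 := by
    have h1 : finrank k Y ≤ 1 := (Submodule.finrank_mono hYz).trans (finrank_span_singleton hz0).le
    have h2 : finrank k (graphInter V 0) ≠ 0 := fun h => h0 (Submodule.finrank_eq_zero.1 h)
    omega
  have hYeq : Y = Submodule.span k {z} :=
    Submodule.eq_of_le_of_finrank_eq hYz (by rw [hdim, hd1, finrank_span_singleton hz0])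
  have hzY : ∀ v ∈ V, v.2 z = 0 := hY.1 (hYeq ▸ Submodule.mem_span_singleton_self z)
  have hZ (u : W) (hu : (u, (0 : Dual k W)) ∈ V) : ∃ c : k, u = c • z := by
    obtain ⟨c, hc⟩ := exists_smul_eq_of_finrank_eq_one hd1 (x := (⟨z, hz⟩ : graphInter V 0))
      (fun e => hz0 (congrArg Subtype.val e)) ⟨u, hu⟩
    exact ⟨c, (congrArg Subtype.val hc).symm⟩
  obtain ⟨l, hl⟩ := exists_dual_of_linearIndependent (v := ![z]) (by simpa using hz0) ![(1 : k)]
  replace hl : l z = 1 := hl 0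
  suffices ∃ q : W →ₗ[k] Dual k W, graphInter V (symm q) = ⊥ by
    obtain ⟨q, hq⟩ := this
    exact ⟨q, by rw [hq, finrank_bot, hd1]; exact one_pos⟩
  by_cases h2 : (2 : k) = 0
  · have : ¬ ∀ v ∈ V, v.2 v.1 = 0 := fun hV => h ⟨h2, hV, hd1⟩
    push Not at this
    obtain ⟨⟨τ, η⟩, hv, hne⟩ := this
    have hηz : η z = 0 := hzY _ hv
    -- As `V` is not isotropic, it contains `(τ, η)` with `η τ ≠ 0`, and the form `l ∧ η` will do.
    refine ⟨tensor l η, (Submodule.eq_bot_iff _).2 fun u hu => ?_⟩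
    have hu1 : η u = 0 := by
      simpa [hl, hηz] using hzY _ hu
    have hu2 : symm (tensor l η) u = l u • η := by
      ext v; simp [hu1]
    rw [mem_graphInter, hu2] at hu
    obtain ⟨c, hc⟩ := hZ (u - l u • τ) (by simpa using V.sub_mem hu (V.smul_mem (l u) hv))
    have hu3 : l u = 0 := by
      have := congrArg η hc
      simp only [map_sub, map_smul, smul_eq_mul, hu1, hηz, mul_zero, zero_sub, neg_eq_zero] at this
      exact (mul_eq_zero.1 this).resolve_right hne
    rw [hu3, zero_smul, sub_zero] at hc
    have : c = 0 := by simpa [hc, hl] using hu3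
    rw [hc, this, zero_smul]
  · -- The form `l ⊗ l` is a symmetrization, as `2` is invertible.
    refine ⟨(2 : k)⁻¹ • tensor l l, (Submodule.eq_bot_iff _).2 fun u hu => ?_⟩
    have e : symm ((2 : k)⁻¹ • tensor l l) u = l u • l := by
      ext v
      simp only [symm, tensor, LinearMap.add_apply, LinearMap.smul_apply, LinearMap.flip_apply,
        LinearMap.smulRight_apply, smul_eq_mul]
      field_simp
      ring
    rw [mem_graphInter, e] at hu
    have hu1 : l u = 0 := by simpa [hl] using hzY _ hu
    rw [hu1, zero_smul] at hu
    obtain ⟨c, hc⟩ := hZ u hu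
    have : c = 0 := by simpa [hc, hl] using hu1
    rw [hc, this, zero_smul]

/-- A half-dimensional subspace `V` of `W × W^*` is transversal to the graph of some symmetrized
form, except possibly if the characteristic is two and `V` is isotropic; then the intersection can
be made one-dimensional. -/
theorem exists_graphInter_eq_bot_or [FiniteDimensional k W] [Infinite k]
    (V : Submodule k (W × Dual k W)) (hV : finrank k V = finrank k W) :
    ∃ q : W →ₗ[k] Dual k W, graphInter V (symm q) = ⊥ ∨
      ((2 : k) = 0 ∧ (∀ v ∈ V, v.2 v.1 = 0) ∧ finrank k (graphInter V (symm q)) = 1) := by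
  obtain ⟨q, hq⟩ : ∃ q : W →ₗ[k] Dual k W, ∀ q' : W →ₗ[k] Dual k W,
      finrank k (graphInter V (symm q)) ≤ finrank k (graphInter V (symm q')) := by
    obtain ⟨_, ⟨q, rfl⟩, hq⟩ := wellFounded_lt.has_min
      (Set.range fun q : W →ₗ[k] Dual k W => finrank k (graphInter V (symm q))) ⟨_, 0, rfl⟩
    exact ⟨q, fun q' => not_lt.1 (hq _ ⟨q', rfl⟩)⟩
  refine ⟨q, or_iff_not_imp_left.2 fun h0 => ?_⟩
  by_contra h
  have e0 : graphInter (V.map (shear (symm q)).toLinearMap) 0 = graphInter V (symm q) := by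
    rw [graphInter_map_shear, add_zero]
  obtain ⟨q', hq'⟩ := exists_graphInter_lt (V.map (shear (symm q)).toLinearMap)
    ((LinearEquiv.finrank_map_eq _ _).trans hV) (by rwa [e0]) (by
      rw [e0]
      rintro ⟨h2, hiso, h1⟩
      refine h ⟨h2, fun v hv => ?_, h1⟩
      have := hiso _ ⟨v, hv, rfl⟩
      -- In characteristic two, the symmetrized form is alternating, so that shearing along it
      -- does not change the quadratic form `v ↦ v.2 v.1`.
      have e : symm q v.1 v.1 = 0 := by
        rw [LinearMap.add_apply, LinearMap.add_apply, LinearMap.flip_apply, ← two_mul, h2, zero_mul]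
      simpa only [shear, LinearEquiv.coe_coe, LinearEquiv.coe_mk, LinearMap.coe_mk, AddHom.coe_mk,
        LinearMap.sub_apply, e, sub_zero] using this)
  rw [graphInter_map_shear, e0] at hq'
  have : symm q + symm q' = symm (q + q') := by
    ext u v; simp [symm]; ring
  rw [this] at hq'
  exact absurd (hq _) (not_le.2 hq')

/-- The rank of an alternating form is even, by splitting off hyperbolic planes. -/
theorem even_finrank_add_finrank_ker (n : ℕ) : ∀ {R : Type u} [AddCommGroup R] [Module k R]
    [FiniteDimensional k R] (b : R →ₗ[k] Dual k R) (_ : ∀ u, b u u = 0) (_ : finrank k R = n),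
    Even (finrank k R + finrank k (LinearMap.ker b)) := by
  induction n using Nat.strong_induction_on with
  | _ n ih =>
  intro R _ _ _ b hb hn
  by_cases h0 : b = 0
  · subst h0; rw [LinearMap.ker_zero, finrank_top]; exact ⟨_, rfl⟩
  have hskew (u v : R) : b u v = - b v u := by
    have := hb (u + v)
    simp only [map_add, LinearMap.add_apply, hb, zero_add, add_zero] at this
    linear_combination this
  obtain ⟨u, v, huv⟩ : ∃ u v, b u v = 1 := by
    obtain ⟨u, hu⟩ : ∃ u, b u ≠ 0 := by
      by_contra! h; exact h0 (LinearMap.ext h)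
    obtain ⟨v, hv⟩ : ∃ v, b u v ≠ 0 := by
      by_contra! h; exact hu (LinearMap.ext h)
    exact ⟨u, (b u v)⁻¹ • v, by simp [hv]⟩
  have hvu : b v u = -1 := by rw [hskew, huv]
  let φ : R →ₗ[k] k × k := (b u).prod (b v)
  let P := LinearMap.ker φ
  have hP {w : R} : w ∈ P ↔ b u w = 0 ∧ b v w = 0 := by
    simp [P, φ]
  have hφ : LinearMap.range φ = ⊤ := by
    refine LinearMap.range_eq_top.2 fun c => ⟨c.1 • v - c.2 • u, ?_⟩
    simp [φ, hb, huv, hvu]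
  have hPdim : 2 + finrank k P = finrank k R := by
    rw [← LinearMap.finrank_range_add_finrank_ker φ, hφ, finrank_top, finrank_prod, finrank_self]
  let b' : P →ₗ[k] Dual k P := P.dualRestrict ∘ₗ b ∘ₗ P.subtype
  have hker : finrank k (LinearMap.ker b') = finrank k (LinearMap.ker b) := by
    have hle : LinearMap.ker b ≤ P := fun w hw => by
      rw [LinearMap.mem_ker] at hw
      exact hP.2 ⟨by rw [hskew, hw]; simp, by rw [hskew, hw]; simp⟩
    have : LinearMap.ker b' = (LinearMap.ker b).submoduleOf P := by
      ext ⟨w, hw⟩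
      refine ⟨fun h => ?_, fun h => ?_⟩
      · change b w = 0
        ext t
        have ht : t - b u t • v + b v t • u ∈ P := by
          refine hP.2 ⟨?_, ?_⟩ <;> simp [huv, hvu, hb]
        have h1 : b w (t - b u t • v + b v t • u) = 0 := LinearMap.congr_fun h ⟨_, ht⟩
        obtain ⟨hw1, hw2⟩ := hP.1 hw
        simpa [hskew w u, hskew w v, hw1, hw2] using h1
      · change b w = 0 at h
        ext t
        change b w t = 0
        rw [h]; rfl
    rw [this]
    exact (Submodule.submoduleOfEquivOfLe hle).finrank_eq
  have := ih (finrank k P) (by omega) b' (fun w => hb w) rfl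
  rw [hker] at this
  rw [← hPdim, add_assoc]
  exact even_two.add this

/-- Parity of intersections for a half-dimensional isotropic `(p, s) : M → W × W^*`: the
kernel of `s - h ∘ p` is the part of `M` that lies on the graph of `h`. -/
theorem even_finrank_ker_sub_add_finrank_range {M : Type*} [AddCommGroup M] [Module k M]
    [FiniteDimensional k W] [FiniteDimensional k M]
    (p : M →ₗ[k] W) (s : M →ₗ[k] Dual k W) (hinj : ∀ v, p v = 0 → s v = 0 → v = 0)
    (hM : finrank k M = finrank k W) (hiso : ∀ v, s v (p v) = 0)
    (h : W →ₗ[k] Dual k W) (halt : ∀ u, h u u = 0) :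
    Even (finrank k (LinearMap.ker (s - h ∘ₗ p)) + finrank k (LinearMap.range p)) := by
  have hpol (v w : M) : s v (p w) + s w (p v) = 0 := by
    have := hiso (v + w)
    simpa [hiso, add_comm] using this
  -- The alternating form on `M` whose radical is spanned by the two kernels.
  let b : M →ₗ[k] Dual k M := p.dualMap ∘ₗ (s - h ∘ₗ p)
  have hb (v w : M) : b v w = s v (p w) - h (p v) (p w) := rfl
  have hbalt (v : M) : b v v = 0 := by rw [hb, hiso, halt, sub_zero]
  have heven := even_finrank_add_finrank_ker _ b hbalt rfl
  have hdim := LinearMap.finrank_range_add_finrank_ker p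
  have hK : (LinearMap.ker p).map s = (LinearMap.range p).dualAnnihilator := by
    refine Submodule.eq_of_le_of_finrank_eq ?_ ?_
    · rintro _ ⟨v, hv, rfl⟩
      rw [Submodule.mem_dualAnnihilator]
      rintro _ ⟨w, rfl⟩
      have hv' : p v = 0 := hv
      simpa [hv'] using hpol v w
    · have h1 := Subspace.finrank_add_finrank_dualAnnihilator_eq (LinearMap.range p)
      have h2 : finrank k ((LinearMap.ker p).map s) = finrank k (LinearMap.ker p) := by
        have : Function.Injective (s ∘ₗ (LinearMap.ker p).subtype) :=
          (injective_iff_map_eq_zero _).2 fun v hv => Subtype.ext (hinj v v.2 hv)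
        rw [← LinearMap.finrank_range_of_inj this, LinearMap.range_comp, Submodule.range_subtype]
      omega
  have hker : LinearMap.ker b = LinearMap.ker (s - h ∘ₗ p) ⊔ LinearMap.ker p := by
    apply le_antisymm
    · intro v hv
      have h1 : (s - h ∘ₗ p) v ∈ (LinearMap.ker p).map s := by
        rw [hK, Submodule.mem_dualAnnihilator]
        rintro _ ⟨w, rfl⟩
        exact LinearMap.congr_fun hv w
      obtain ⟨c, hc, e⟩ := h1
      refine Submodule.mem_sup.2 ⟨v - c, ?_, c, hc, sub_add_cancel v c⟩
      have hc' : p c = 0 := hc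
      rw [LinearMap.mem_ker, map_sub, ← e]
      simp [hc']
    · refine sup_le (fun v hv => ?_) fun v hv => ?_
      · rw [LinearMap.mem_ker] at hv ⊢
        rw [LinearMap.comp_apply, hv, map_zero]
      · have hv' : p v = 0 := hv
        ext w
        rw [hb, hv', map_zero]
        simpa [hv'] using hpol v w
  have hinf : LinearMap.ker (s - h ∘ₗ p) ⊓ LinearMap.ker p = ⊥ := by
    refine (Submodule.eq_bot_iff _).2 fun v hv => ?_
    obtain ⟨h1, h2⟩ := hv
    have h2' : p v = 0 := h2
    refine hinj v h2 ?_
    have h1' : s v - h (p v) = 0 := h1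
    simpa [h2'] using h1'
  have hsup := Submodule.finrank_sup_add_finrank_inf_eq (LinearMap.ker (s - h ∘ₗ p))
    (LinearMap.ker p)
  rw [hinf, finrank_bot, add_zero, ← hker] at hsup
  have : finrank k M + finrank k (LinearMap.ker b) =
      (finrank k (LinearMap.ker (s - h ∘ₗ p)) + finrank k (LinearMap.range p)) +
        2 * finrank k (LinearMap.ker p) := by omega
  rw [this] at heven
  exact (Nat.even_add.1 heven).2 (even_two_mul _)

/-- Intersections of an isotropic half-dimensional subspace `V` with graphs of alternating forms
have the parity of the rank of `V → W`. -/
theorem even_finrank_graphInter_add [FiniteDimensional k W]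
    (V : Submodule k (W × Dual k W)) (hV : finrank k V = finrank k W)
    (hiso : ∀ v ∈ V, v.2 v.1 = 0) (h : W →ₗ[k] Dual k W) (halt : ∀ u, h u u = 0) :
    Even (finrank k (graphInter V h) + finrank k (V.map (LinearMap.fst k W (Dual k W)))) := by
  let p : V →ₗ[k] W := LinearMap.fst k W (Dual k W) ∘ₗ V.subtype
  let s : V →ₗ[k] Dual k W := LinearMap.snd k W (Dual k W) ∘ₗ V.subtype
  have := even_finrank_ker_sub_add_finrank_range (k := k) (W := W) (M := V) p s
    (fun v h1 h2 => Subtype.ext (Prod.ext h1 h2)) hV (fun v => hiso v.1 v.2) h halt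
  have e : V.map (LinearMap.fst k W (Dual k W)) = LinearMap.range p := by
    rw [LinearMap.range_comp, Submodule.range_subtype]
  rw [e]
  convert this using 2
  let f : graphInter V h →ₗ[k] V :=
    { toFun := fun u => ⟨(u, h u), u.2⟩
      map_add' := fun u v => Subtype.ext (Prod.ext rfl (map_add h _ _))
      map_smul' := fun c v => Subtype.ext (Prod.ext rfl (map_smul h _ _)) }
  have hf : LinearMap.range f = LinearMap.ker (s - h ∘ₗ p) := by
    ext v
    constructor
    · rintro ⟨u, rfl⟩
      exact sub_self (h u)
    · intro hv
      have hv' : v.1.2 = h v.1.1 := sub_eq_zero.1 hv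
      have e : v.1 = (v.1.1, h v.1.1) := Prod.ext rfl hv'
      have hm : (v.1.1, h v.1.1) ∈ V := by
        rw [← e]; exact v.2
      exact ⟨⟨v.1.1, hm⟩, Subtype.ext e.symm⟩
  rw [← hf]
  refine (LinearMap.finrank_range_of_inj fun u v huv => ?_).symm
  exact Subtype.ext (congrArg (fun w : V => w.1.1) huv)

end LagrangianLinearAlgebra

/-! ### Dimension theory of algebras of finite type over a field -/

namespace FiniteTypeDimension

variable {k : Type*} [Field k]

theorem isMaximal_comap {A B : Type*} [CommRing A] [CommRing B] [Algebra k A] [Algebra k B]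
    [Algebra.FiniteType k B] (f : A →+* B) (hf : f.comp (algebraMap k A) = algebraMap k B)
    (M : Ideal B) [M.IsMaximal] : (M.comap f).IsMaximal := by
  let _ : Field (B ⧸ M) := Ideal.Quotient.field M
  have : Module.Finite k (B ⧸ M) := finite_of_finite_type_of_isJacobsonRing k (B ⧸ M)
  have hint : ((Ideal.Quotient.mk M).comp f).IsIntegral := by
    refine RingHom.IsIntegral.tower_top (algebraMap k A) _ ?_
    rw [RingHom.comp_assoc, hf]
    exact algebraMap_isIntegral_iff.2 (inferInstanceAs (Algebra.IsIntegral k (B ⧸ M)))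
  have h := Ideal.isMaximal_comap_of_isIntegral_of_isMaximal' _ hint (⊥ : Ideal (B ⧸ M))
  rwa [← Ideal.comap_comap, ← RingHom.ker_eq_comap_bot, Ideal.mk_ker] at h

theorem height_mvPolynomial (s : ℕ) (M : Ideal (MvPolynomial (Fin s) k)) [hM : M.IsMaximal] :
    M.height = s := by
  induction s with
  | zero =>
    have : ringKrullDim (MvPolynomial (Fin 0) k) = 0 := by simp
    have h := Ideal.height_le_ringKrullDim_of_ne_top hM.ne_top
    rw [this] at h
    simpa using h
  | succ s ih =>
    let e := (MvPolynomial.finSuccEquiv k s).toRingEquiv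
    let M' : Ideal (Polynomial (MvPolynomial (Fin s) k)) := M.map e
    have : M'.IsMaximal := Ideal.map_isMaximal_of_equiv e
    have hmax : (M'.comap (Polynomial.C : MvPolynomial (Fin s) k →+* _)).IsMaximal :=
      Polynomial.isMaximal_comap_C_of_isJacobsonRing M'
    have : M'.LiesOver (M'.comap (Polynomial.C : MvPolynomial (Fin s) k →+* _)) := ⟨rfl⟩
    have h := Polynomial.height_eq_height_add_one
      (M'.comap (Polynomial.C : MvPolynomial (Fin s) k →+* _)) M'
    rw [ih] at h
    rw [← e.height_map M, h]; simp

/-- All maximal ideals of a domain of finite type over a field have the same height, by Noether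
normalization and going down. -/
theorem exists_height_eq (k R : Type*) [Field k] [CommRing R] [IsDomain R] [Algebra k R]
    [Algebra.FiniteType k R] : ∃ s : ℕ, ∀ M : Ideal R, M.IsMaximal → M.height = s := by
  obtain ⟨s, g, hg, hfin⟩ := exists_finite_inj_algHom_of_fg k R
  refine ⟨s, fun M hM => ?_⟩
  let P := MvPolynomial (Fin s) k
  algebraize [g.toRingHom]
  have : IsNoetherianRing R := Algebra.FiniteType.isNoetherianRing k R
  have : FaithfulSMul P R := (faithfulSMul_iff_algebraMap_injective P R).2 hg
  have : Module.Finite P R := hfin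
  have hp : (M.comap (algebraMap P R)).IsMaximal :=
    Ideal.isMaximal_comap_of_isIntegral_of_isMaximal (R := P) M
  set p := M.comap (algebraMap P R) with hpdef
  have : M.LiesOver p := ⟨rfl⟩
  rw [Ideal.height_eq_height_add_of_liesOver_of_hasGoingDown p M, height_mvPolynomial s p]
  let _ : Field (P ⧸ p) := Ideal.Quotient.field p
  have : IsArtinianRing (R ⧸ p.map (algebraMap P R)) :=
    IsArtinianRing.of_finite (P ⧸ p) (R ⧸ p.map (algebraMap P R))
  have hle : M.map (Ideal.Quotient.mk (p.map (algebraMap P R))) ≠ ⊤ := by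
    have : (M.map (Ideal.Quotient.mk (p.map (algebraMap P R)))).IsMaximal := by
      refine .map_of_surjective_of_ker_le Ideal.Quotient.mk_surjective ?_
      rw [Ideal.mk_ker]
      exact Ideal.map_comap_le
    exact this.ne_top
  have h := Ideal.height_le_ringKrullDim_of_ne_top hle
  have h0 : ringKrullDim (R ⧸ p.map (algebraMap P R)) ≤ 0 :=
    (Ring.krullDimLE_iff (n := 0)).1 inferInstance
  have : (M.map (Ideal.Quotient.mk (p.map (algebraMap P R)))).height = 0 := by
    have := h.trans h0
    exact le_antisymm (WithBot.coe_le_coe.1 this) bot_le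
  rw [this, add_zero]

theorem height_eq_ringKrullDim (k : Type*) {R : Type*} [Field k] [CommRing R] [IsDomain R]
    [Algebra k R] [Algebra.FiniteType k R] (M : Ideal R) [hM : M.IsMaximal] :
    (M.height : WithBot ℕ∞) = ringKrullDim R := by
  obtain ⟨s, hs⟩ := exists_height_eq k R
  rw [← Ideal.sup_isMaximal_height_eq_ringKrullDim, hs M hM, WithBot.coe_inj]
  refine le_antisymm ?_ (iSup₂_le fun I hI => (hs I hI).le)
  exact le_iSup₂_of_le M hM (hs M hM).ge

end FiniteTypeDimension

/-! ### Point derivations, cotangent spaces and jets of local rings -/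

namespace PointDerivation

open IsLocalRing Module

section Basic

variable {k S : Type*} [Field k] [CommRing S] [Algebra k S]

/-- The `k`-linear derivations `S → k` over the `k`-point `ev` of `S`. -/
def pointDerivations (ev : S →ₐ[k] k) : Submodule k (S →ₗ[k] k) where
  carrier := {D | ∀ a b, D (a * b) = ev a * D b + ev b * D a}
  add_mem' := fun h h' a b => by simp only [LinearMap.add_apply, h a b, h' a b]; ring
  zero_mem' := fun a b => by simp
  smul_mem' := fun c D h a b => by simp only [LinearMap.smul_apply, h a b, smul_eq_mul]; ring

theorem apply_algebraMap {ev : S →ₐ[k] k} {D : S →ₗ[k] k} (hD : D ∈ pointDerivations ev) (c : k) :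
    D (algebraMap k S c) = 0 := by
  have h1 : D 1 = 0 := by simpa using hD 1 1
  rw [Algebra.algebraMap_eq_smul_one, map_smul, h1, smul_zero]

/-- The point derivations that vanish on the ideal `I`. -/
def killing (ev : S →ₐ[k] k) (I : Ideal S) : Submodule k (S →ₗ[k] k) where
  carrier := {D | D ∈ pointDerivations ev ∧ ∀ a ∈ I, D a = 0}
  add_mem' := fun h h' => ⟨Submodule.add_mem _ h.1 h'.1, fun a ha => by
    rw [LinearMap.add_apply, h.2 a ha, h'.2 a ha, add_zero]⟩
  zero_mem' := ⟨Submodule.zero_mem _, fun _ _ => rfl⟩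
  smul_mem' := fun c D h => ⟨Submodule.smul_mem _ c h.1, fun a ha => by
    rw [LinearMap.smul_apply, h.2 a ha, smul_zero]⟩

theorem ker_eq_maximalIdeal [IsLocalRing S] (ev : S →ₐ[k] k) :
    RingHom.ker ev = maximalIdeal S :=
  have : Function.Surjective ev := fun c => ⟨algebraMap k S c, ev.commutes c⟩
  eq_maximalIdeal (RingHom.ker_isMaximal_of_surjective ev.toRingHom this)

theorem mem_maximalIdeal_iff [IsLocalRing S] (ev : S →ₐ[k] k) {a : S} :
    a ∈ maximalIdeal S ↔ ev a = 0 := by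
  rw [← ker_eq_maximalIdeal ev, RingHom.mem_ker]

theorem sub_mem_maximalIdeal [IsLocalRing S] (ev : S →ₐ[k] k) (a : S) :
    a - algebraMap k S (ev a) ∈ maximalIdeal S := by
  rw [mem_maximalIdeal_iff ev, map_sub, AlgHom.commutes]; simp

theorem algHom_eq [IsLocalRing S] (ev ev' : S →ₐ[k] k) : ev = ev' := by
  ext a
  have := (mem_maximalIdeal_iff ev').1 (sub_mem_maximalIdeal ev a)
  rw [map_sub, AlgHom.commutes] at this
  exact (sub_eq_zero.1 this).symm

theorem isUnit_iff [IsLocalRing S] (ev : S →ₐ[k] k) {a : S} : IsUnit a ↔ ev a ≠ 0 := by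
  rw [← not_iff_not, not_not, ← mem_maximalIdeal_iff ev]; simp

theorem bijective_algebraMap_residueField [IsLocalRing S] (ev : S →ₐ[k] k) :
    Function.Bijective (algebraMap k (ResidueField S)) := by
  refine ⟨(algebraMap k (ResidueField S)).injective, fun a => ?_⟩
  obtain ⟨a, rfl⟩ := residue_surjective a
  refine ⟨ev a, ?_⟩
  have := (residue_eq_zero_iff _).2 (sub_mem_maximalIdeal ev a)
  rw [map_sub, sub_eq_zero] at this
  rw [this]; rfl

end Basic

section Cotangent

variable {k S : Type*} [Field k] [CommRing S] [Algebra k S] [IsLocalRing S]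

/-- A point derivation of a local ring amounts to a linear form on the cotangent space. -/
noncomputable def equivDual (ev : S →ₐ[k] k) :
    pointDerivations ev ≃ₗ[k] Dual k (CotangentSpace S) where
  toFun D := Ideal.Cotangent.lift (D.1.domRestrict ((maximalIdeal S).restrictScalars k))
    fun x y => by
      have := D.2 (x : S) (y : S)
      rw [(mem_maximalIdeal_iff ev).1 x.2, (mem_maximalIdeal_iff ev).1 y.2] at this
      exact this.trans (by simp)
  map_add' D D' := by
    ext x; obtain ⟨x, rfl⟩ := Ideal.toCotangent_surjective _ x; rfl
  map_smul' D D' := by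
    ext x; obtain ⟨x, rfl⟩ := Ideal.toCotangent_surjective _ x; rfl
  invFun φ := ⟨φ ∘ₗ ((maximalIdeal S).toCotangent.restrictScalars k) ∘ₗ
      LinearMap.codRestrict ((maximalIdeal S).restrictScalars k)
        (LinearMap.id - Algebra.linearMap k S ∘ₗ ev.toLinearMap)
        (fun a => sub_mem_maximalIdeal ev a), fun a b => by
    have e : (maximalIdeal S).toCotangent ⟨a * b - algebraMap k S (ev (a * b)),
          sub_mem_maximalIdeal ev _⟩ =
        ev a • (maximalIdeal S).toCotangent ⟨b - algebraMap k S (ev b),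
          sub_mem_maximalIdeal ev _⟩ +
        ev b • (maximalIdeal S).toCotangent ⟨a - algebraMap k S (ev a),
          sub_mem_maximalIdeal ev _⟩ := by
      rw [← algebraMap_smul S (ev a), ← algebraMap_smul S (ev b), ← map_smul, ← map_smul,
        ← map_add, Ideal.toCotangent_eq, pow_two]
      convert Ideal.mul_mem_mul (sub_mem_maximalIdeal ev a) (sub_mem_maximalIdeal ev b) using 1
      simp only [map_mul, Submodule.coe_add, SetLike.val_smul, smul_eq_mul]
      ring
    have := congrArg φ e
    rw [map_add, map_smul, map_smul] at this
    exact this⟩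
  left_inv D := by
    ext a
    change D.1 (a - algebraMap k S (ev a)) = D.1 a
    rw [map_sub, apply_algebraMap D.2, sub_zero]
  right_inv φ := by
    ext x
    obtain ⟨x, rfl⟩ := Ideal.toCotangent_surjective _ x
    change φ ((maximalIdeal S).toCotangent ⟨x.1 - algebraMap k S (ev x.1),
      sub_mem_maximalIdeal ev _⟩) = φ ((maximalIdeal S).toCotangent x)
    congr 2
    ext
    change x.1 - algebraMap k S (ev x.1) = x.1
    rw [(mem_maximalIdeal_iff ev).1 x.2, map_zero, sub_zero]

theorem finrank_cotangentSpace (ev : S →ₐ[k] k) :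
    finrank k (CotangentSpace S) = finrank (ResidueField S) (CotangentSpace S) := by
  have h := bijective_algebraMap_residueField ev
  have : IsScalarTower k (ResidueField S) (CotangentSpace S) :=
    .of_algebraMap_smul fun c x => by
      rw [IsScalarTower.algebraMap_apply k S (ResidueField S), algebraMap_smul, algebraMap_smul]
  have e : finrank k (ResidueField S) = 1 := by
    rw [← finrank_self k]
    exact (LinearEquiv.ofBijective (Algebra.linearMap k (ResidueField S)) h).finrank_eq.symm
  rw [← finrank_mul_finrank k (ResidueField S) (CotangentSpace S), e, one_mul]

theorem finrank_pointDerivations (ev : S →ₐ[k] k) :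
    finrank k (pointDerivations ev) = finrank (ResidueField S) (CotangentSpace S) := by
  rw [(equivDual ev).finrank_eq, Subspace.dual_finrank_eq, finrank_cotangentSpace ev]

end Cotangent

section Quotient

variable {k S : Type*} [Field k] [CommRing S] [Algebra k S]

/-- The `k`-point of a quotient. -/
def evQuotient (ev : S →ₐ[k] k) {I : Ideal S} (hI : ∀ a ∈ I, ev a = 0) : (S ⧸ I) →ₐ[k] k :=
  Ideal.Quotient.liftₐ I ev hI

/-- The pullback of point derivations to a ring from a quotient ring. -/
noncomputable def ofQuotient (ev : S →ₐ[k] k) {I : Ideal S} (hI : ∀ a ∈ I, ev a = 0) :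
    pointDerivations (evQuotient ev hI) →ₗ[k] killing ev I where
  toFun D := ⟨D.1 ∘ₗ (Ideal.Quotient.mkₐ k I).toLinearMap,
    fun a b => D.2 (Ideal.Quotient.mk I a) (Ideal.Quotient.mk I b), fun a ha => by
      change D.1 (Ideal.Quotient.mk I a) = 0
      rw [Ideal.Quotient.eq_zero_iff_mem.2 ha, map_zero]⟩
  map_add' _ _ := rfl
  map_smul' _ _ := rfl

theorem ofQuotient_bijective (ev : S →ₐ[k] k) {I : Ideal S} (hI : ∀ a ∈ I, ev a = 0) :
    Function.Bijective (ofQuotient ev hI) := by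
  constructor
  · intro D D' h
    refine Subtype.ext (LinearMap.ext fun x => ?_)
    obtain ⟨x, rfl⟩ := Ideal.Quotient.mk_surjective x
    have h' : (ofQuotient ev hI D).1 x = (ofQuotient ev hI D').1 x := by rw [h]
    exact h'
  · rintro ⟨D, hD, hDI⟩
    let F : (S ⧸ I) →+ k := QuotientAddGroup.lift I.toAddSubgroup D.toAddMonoidHom hDI
    have hF (x : S) : F (Ideal.Quotient.mk I x) = D x := rfl
    let D' : (S ⧸ I) →ₗ[k] k :=
      { toFun := F
        map_add' := map_add F
        map_smul' := fun c x => by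
          obtain ⟨x, rfl⟩ := Ideal.Quotient.mk_surjective x
          have e : c • Ideal.Quotient.mk I x = Ideal.Quotient.mk I (c • x) := rfl
          rw [e, hF, hF, map_smul, RingHom.id_apply] }
    refine ⟨⟨D', fun a b => ?_⟩, rfl⟩
    obtain ⟨a, rfl⟩ := Ideal.Quotient.mk_surjective a
    obtain ⟨b, rfl⟩ := Ideal.Quotient.mk_surjective b
    exact hD a b

/-- The point derivations of `S` that vanish on `I` are those of `S ⧸ I`. -/
noncomputable def killingEquiv (ev : S →ₐ[k] k) {I : Ideal S} (hI : ∀ a ∈ I, ev a = 0) :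
    pointDerivations (evQuotient ev hI) ≃ₗ[k] killing ev I :=
  .ofBijective (ofQuotient ev hI) (ofQuotient_bijective ev hI)

theorem finrank_killing (ev : S →ₐ[k] k) {I : Ideal S} (hI : ∀ a ∈ I, ev a = 0)
    [IsLocalRing (S ⧸ I)] :
    finrank k (killing ev I) = finrank (ResidueField (S ⧸ I)) (CotangentSpace (S ⧸ I)) := by
  rw [← (killingEquiv ev hI).finrank_eq, finrank_pointDerivations]

theorem isLocalRing_quotient [IsLocalRing S] (ev : S →ₐ[k] k) {I : Ideal S}
    (hI : ∀ a ∈ I, ev a = 0) : IsLocalRing (S ⧸ I) := by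
  have : Nontrivial (S ⧸ I) := Ideal.Quotient.nontrivial_iff.2 fun h => by
    have := hI 1 (h ▸ trivial)
    rw [map_one] at this
    exact one_ne_zero this
  exact .of_surjective' (Ideal.Quotient.mk I) Ideal.Quotient.mk_surjective

end Quotient

section Length

theorem length_quotient_eq_one_iff {A : Type*} [CommRing A] {J : Ideal A} :
    Module.length A (A ⧸ J) = 1 ↔ J.IsMaximal := by
  rw [Module.length_eq_one_iff, isSimpleModule_iff_isCoatom]
  exact ⟨fun h => ⟨h⟩, fun h => h.1⟩

variable {k A : Type*} [Field k] [CommRing A] [Algebra k A] [IsLocalRing A] [IsNoetherianRing A]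

/-- An ideal of a local ring is maximal if no point derivation vanishes on it. -/
theorem isMaximal_of_killing_eq_bot (ev : A →ₐ[k] k) {J : Ideal A} (hJ : ∀ a ∈ J, ev a = 0)
    (h : killing ev J = ⊥) : J.IsMaximal := by
  have := isLocalRing_quotient ev hJ
  have h0 := finrank_killing ev hJ
  rw [h, finrank_bot] at h0
  exact Ideal.Quotient.maximal_of_isField _ (finrank_cotangentSpace_eq_zero_iff.1 h0.symm)

theorem length_self_eq_two {R : Type*} [CommRing R] [IsLocalRing R] {t : R}
    (ht : maximalIdeal R = Ideal.span {t}) (ht0 : t ≠ 0) (ht2 : t ^ 2 = 0) :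
    Module.length R R = 2 := by
  let f₀ : R →ₗ[R] R := LinearMap.toSpanSingleton R R t
  have hker : LinearMap.ker f₀ = maximalIdeal R := by
    symm
    refine (IsLocalRing.maximalIdeal.isMaximal R).eq_of_le ?_ ?_
    · intro h
      have : (1 : R) ∈ LinearMap.ker f₀ := by rw [h]; trivial
      simp [f₀, ht0] at this
    · rw [ht, Ideal.span_singleton_le_iff_mem, LinearMap.mem_ker]
      simpa [f₀, pow_two] using ht2
  let f : (R ⧸ maximalIdeal R) →ₗ[R] R := Submodule.liftQ _ f₀ hker.ge
  have hf : Function.Injective f := by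
    rw [← LinearMap.ker_eq_bot]
    exact Submodule.ker_liftQ_eq_bot _ _ _ hker.le
  have hex : Function.Exact f (Submodule.mkQ (maximalIdeal R)) := by
    rw [LinearMap.exact_iff, Submodule.ker_mkQ, Submodule.range_liftQ,
      LinearMap.range_toSpanSingleton, ht]
  have h1 : Module.length R (R ⧸ maximalIdeal R) = 1 :=
    length_quotient_eq_one_iff.2 (IsLocalRing.maximalIdeal.isMaximal R)
  have h := Module.length_eq_add_of_exact f _ hf (Submodule.mkQ_surjective _) hex
  rw [h1] at h
  rw [h, one_add_one_eq_two]

/-- If the maximal ideal of a local `k`-algebra is generated by an element `t` with `t ^ 2 ≠ 0`,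
then the coefficients of `t` and `t ^ 2` modulo `t ^ 3` are well-defined. They form
a nonconstant jet `R → k[t]/(t ^ 3)`. -/
theorem exists_jet {R : Type*} [CommRing R] [Algebra k R] [IsLocalRing R] (ev : R →ₐ[k] k) {t : R}
    (ht : maximalIdeal R = Ideal.span {t}) (ht2 : t ^ 2 ≠ 0) :
    ∃ D₁ ∈ pointDerivations ev, ∃ D₂ : R →ₗ[k] k, D₁ t = 1 ∧
      ∀ a b, D₂ (a * b) = ev a * D₂ b + D₁ a * D₁ b + ev b * D₂ a := by
  have hevt : ev t = 0 := (mem_maximalIdeal_iff ev).1 (ht ▸ Ideal.mem_span_singleton_self t)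
  have hdiv (a : R) : ∃ b, a = algebraMap k R (ev a) + b * t := by
    have := sub_mem_maximalIdeal ev a
    rw [ht, Ideal.mem_span_singleton'] at this
    obtain ⟨b, hb⟩ := this
    exact ⟨b, by rw [hb]; ring⟩
  have hex (a : R) : ∃ c₁ c₂ : k, ∃ r : R, a = algebraMap k R (ev a) + algebraMap k R c₁ * t +
      algebraMap k R c₂ * t ^ 2 + r * t ^ 3 := by
    obtain ⟨b, hb⟩ := hdiv a
    obtain ⟨b', hb'⟩ := hdiv b
    obtain ⟨b'', hb''⟩ := hdiv b'
    exact ⟨ev b, ev b', b'', by linear_combination hb + t * hb' + t ^ 2 * hb''⟩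
  have huniq (c₀ c₁ c₂ : k) (r : R) (h : algebraMap k R c₀ + algebraMap k R c₁ * t +
      algebraMap k R c₂ * t ^ 2 + r * t ^ 3 = 0) : c₁ = 0 ∧ c₂ = 0 := by
    have h0 : c₀ = 0 := by simpa [hevt] using congrArg ev h
    rw [h0, map_zero, zero_add] at h
    have h1 : c₁ = 0 := by
      by_contra h1
      have hu : IsUnit (algebraMap k R c₁ + algebraMap k R c₂ * t + r * t ^ 2) :=
        (isUnit_iff ev).2 (by simpa [hevt] using h1)
      have : (algebraMap k R c₁ + algebraMap k R c₂ * t + r * t ^ 2) * t = 0 := by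
        linear_combination h
      rw [hu.mul_right_eq_zero] at this
      exact ht2 (by rw [this]; simp)
    refine ⟨h1, ?_⟩
    by_contra h2
    have hu : IsUnit (algebraMap k R c₂ + r * t) :=
      (isUnit_iff ev).2 (by simpa [hevt] using h2)
    have : (algebraMap k R c₂ + r * t) * t ^ 2 = 0 := by
      rw [h1, map_zero] at h
      linear_combination h
    exact ht2 (hu.mul_right_eq_zero.1 this)
  choose c₁ c₂ r hc using hex
  have hcoef {a : R} {a₀ a₁ a₂ : k} {s : R} (h : a = algebraMap k R a₀ + algebraMap k R a₁ * t +
      algebraMap k R a₂ * t ^ 2 + s * t ^ 3) : c₁ a = a₁ ∧ c₂ a = a₂ := by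
    have := huniq (ev a - a₀) (c₁ a - a₁) (c₂ a - a₂) (r a - s) (by
      simp only [map_sub]
      linear_combination h - hc a)
    exact ⟨sub_eq_zero.1 this.1, sub_eq_zero.1 this.2⟩
  have hadd (a b : R) := hcoef (a := a + b) (a₀ := ev a + ev b) (a₁ := c₁ a + c₁ b)
    (a₂ := c₂ a + c₂ b) (s := r a + r b) (by
      simp only [map_add]; linear_combination hc a + hc b)
  have hsmul (x : k) (a : R) := hcoef (a := x • a) (a₀ := x * ev a) (a₁ := x * c₁ a)
    (a₂ := x * c₂ a) (s := algebraMap k R x * r a) (by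
      rw [Algebra.smul_def]
      simp only [map_mul]; linear_combination algebraMap k R x * hc a)
  have hmul (a b : R) := hcoef (a := a * b) (a₀ := ev a * ev b)
    (a₁ := ev a * c₁ b + ev b * c₁ a) (a₂ := ev a * c₂ b + c₁ a * c₁ b + ev b * c₂ a)
    (s := algebraMap k R (ev a) * r b + algebraMap k R (ev b) * r a +
      algebraMap k R (c₁ a) * (algebraMap k R (c₂ b) + r b * t) +
      algebraMap k R (c₂ a) * (algebraMap k R (c₁ b) + algebraMap k R (c₂ b) * t + r b * t ^ 2) +
      r a * (algebraMap k R (c₁ b) * t + algebraMap k R (c₂ b) * t ^ 2 + r b * t ^ 3)) (by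
      simp only [map_mul, map_add]
      linear_combination b * hc a + (algebraMap k R (ev a) + algebraMap k R (c₁ a) * t +
        algebraMap k R (c₂ a) * t ^ 2 + r a * t ^ 3) * hc b)
  refine ⟨{ toFun := c₁, map_add' := fun a b => (hadd a b).1,
            map_smul' := fun x a => (hsmul x a).1 }, fun a b => (hmul a b).1,
          { toFun := c₂, map_add' := fun a b => (hadd a b).2,
            map_smul' := fun x a => (hsmul x a).2 }, ?_, fun a b => (hmul a b).2⟩
  exact (hcoef (a := t) (a₀ := 0) (a₁ := 1) (a₂ := 0) (s := 0) (by simp)).1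

end Length

end PointDerivation

/-! ### Étale coordinates -/

namespace SmoothScheme

open PointDerivation Module

/-- Étale coordinates of a `k`-algebra `B`: functions `x i` and dual vector fields `∂ i`, such that
derivations of `B` are determined by their values at the `x i`. The modules of values range over
the universe of `B`, which suffices to test the module of differentials. -/
structure EtaleCoordinates (k B : Type u) [CommRing k] [CommRing B] [Algebra k B] (n : ℕ) where
  x : Fin n → B
  partialDeriv : Fin n → Derivation k B B
  partialDeriv_x : ∀ i j, partialDeriv i (x j) = if i = j then 1 else 0
  eq_zero : ∀ {M : Type u} [AddCommGroup M] [Module k M] [Module B M] [IsScalarTower k B M]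
    (D : Derivation k B M), (∀ i, D (x i) = 0) → D = 0

theorem derivation_sum_apply {k B M : Type*} [CommRing k] [CommRing B] [Algebra k B]
    [AddCommGroup M] [Module k M] [Module B M] {ι : Type*} (s : Finset ι)
    (D : ι → Derivation k B M) (b : B) : (∑ i ∈ s, D i) b = ∑ i ∈ s, D i b := by
  have := congrFun (map_sum (Derivation.coeFnAddMonoidHom (R := k) (A := B) (M := M)) D s) b
  rw [Finset.sum_apply] at this
  exact this

namespace EtaleCoordinates

section General

variable {k B : Type u} [CommRing k] [CommRing B] [Algebra k B] {n : ℕ} (c : EtaleCoordinates k B n)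
include c

theorem derivation_apply {M : Type u} [AddCommGroup M] [Module k M] [Module B M]
    [IsScalarTower k B M] (D : Derivation k B M) (b : B) :
    D b = ∑ i, c.partialDeriv i b • D (c.x i) := by
  let E : Derivation k B M :=
    ∑ i, (LinearMap.toSpanSingleton B M (D (c.x i))).compDer (c.partialDeriv i)
  have hE (b : B) : E b = ∑ i, c.partialDeriv i b • D (c.x i) := derivation_sum_apply _ _ b
  have : D - E = 0 := c.eq_zero _ fun j => by
    rw [Derivation.sub_apply, hE]
    simp [c.partialDeriv_x]
  rw [← hE, ← sub_eq_zero, ← Derivation.sub_apply, this, Derivation.zero_apply]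

theorem derivation_eq_sum (θ : Derivation k B B) : θ = ∑ i, θ (c.x i) • c.partialDeriv i := by
  ext b
  rw [c.derivation_apply θ b, derivation_sum_apply]
  exact Finset.sum_congr rfl fun i _ => by simp [mul_comm]

theorem partialDeriv_comm (i j : Fin n) (b : B) :
    c.partialDeriv i (c.partialDeriv j b) = c.partialDeriv j (c.partialDeriv i b) := by
  have : ⁅c.partialDeriv i, c.partialDeriv j⁆ = 0 := c.eq_zero _ fun l => by
    rw [Derivation.commutator_apply, c.partialDeriv_x, c.partialDeriv_x]
    split_ifs <;> simp
  rw [← sub_eq_zero, ← Derivation.commutator_apply, this, Derivation.zero_apply]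

/-- In characteristic two the square of a derivation is a derivation. -/
theorem partialDeriv_partialDeriv (h2 : (2 : k) = 0) (i : Fin n) (b : B) :
    c.partialDeriv i (c.partialDeriv i b) = 0 := by
  have h2' : (2 : B) = 0 := by
    rw [← map_ofNat (algebraMap k B) 2, h2, map_zero]
  let E : Derivation k B B := Derivation.mk'
    ((c.partialDeriv i : B →ₗ[k] B) ∘ₗ (c.partialDeriv i : B →ₗ[k] B)) fun a b => by
      simp only [LinearMap.comp_apply, Derivation.coeFn_coe, Derivation.leibniz, map_add,
        smul_eq_mul]
      linear_combination (c.partialDeriv i a * c.partialDeriv i b) * h2'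
  have : E = 0 := c.eq_zero _ fun l => by
    change c.partialDeriv i (c.partialDeriv i (c.x l)) = 0
    rw [c.partialDeriv_x]; split_ifs <;> simp
  exact congrArg (fun D : Derivation k B B => D b) this

/-- The coordinate vector fields form a basis. -/
noncomputable def basis : Basis (Fin n) B (Derivation k B B) :=
  Basis.mk (v := c.partialDeriv)
    (Fintype.linearIndependent_iff.2 fun g hg j => by
      have := congrArg (fun D : Derivation k B B => D (c.x j)) hg
      rw [derivation_sum_apply] at this
      simpa [c.partialDeriv_x] using this)
    (fun θ _ => by
      rw [c.derivation_eq_sum θ]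
      exact Submodule.sum_mem _ fun i _ =>
        Submodule.smul_mem _ _ (Submodule.subset_span ⟨i, rfl⟩))

theorem finiteType_symmetricAlgebra :
    Algebra.FiniteType B (SymmetricAlgebra B (Derivation k B B)) :=
  Algebra.FiniteType.equiv inferInstance (SymmetricAlgebra.equivMvPolynomial c.basis).symm

end General

section PointDerivation

variable {k B : Type u} [Field k] [CommRing B] [Algebra k B] {n : ℕ} (c : EtaleCoordinates k B n)
include c

theorem pointDerivation_apply {ev : B →ₐ[k] k} {τ : B →ₗ[k] k} (hτ : τ ∈ pointDerivations ev)
    (b : B) : τ b = ∑ i, ev (c.partialDeriv i b) * τ (c.x i) := by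
  let _ : Module B k := Module.compHom k ev.toRingHom
  have hs (b : B) (a : k) : b • a = ev b * a := rfl
  have : IsScalarTower k B k := ⟨fun r b a => by
    rw [hs, hs, map_smul, smul_eq_mul, smul_eq_mul, mul_assoc]⟩
  let D : Derivation k B k := Derivation.mk' τ fun a b => hτ a b
  exact c.derivation_apply D b

end PointDerivation

section Restrict

variable {k A B : Type u} [CommRing k] [CommRing A] [CommRing B] [Algebra k A] [Algebra k B]
  [Algebra A B] [IsScalarTower k A B] {n : ℕ}

/-- Étale coordinates restrict along étale maps. -/
noncomputable def restrict [Algebra.FormallyEtale A B] (c : EtaleCoordinates k A n) :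
    EtaleCoordinates k B n where
  x i := algebraMap A B (c.x i)
  partialDeriv i := restrictField k A B (c.partialDeriv i)
  partialDeriv_x i j := by
    rw [restrictField_algebraMap, c.partialDeriv_x]; split_ifs <;> simp
  eq_zero {M} _ _ _ _ D hD := by
    let _ : Module A M := Module.compHom M (algebraMap A B)
    have : IsScalarTower A B M := ⟨fun a b m => by
      rw [Algebra.smul_def, mul_smul]; rfl⟩
    have : IsScalarTower k A M := ⟨fun r a m => by
      rw [← algebraMap_smul B (r • a) m, ← algebraMap_smul B a m, Algebra.smul_def, map_mul,
        ← IsScalarTower.algebraMap_apply, mul_smul, algebraMap_smul]⟩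
    have h0 : D.compAlgebraMap A = 0 := c.eq_zero _ hD
    let E : Derivation A B M :=
      { toFun := fun b => D b
        map_add' := fun x y => map_add D x y
        map_smul' := fun a x => by
          have h0a : D (algebraMap A B a) = 0 := congrArg (fun D : Derivation k A M => D a) h0
          rw [Algebra.smul_def, Derivation.leibniz, h0a, smul_zero, add_zero, algebraMap_smul]; rfl
        map_one_eq_zero' := D.map_one_eq_zero
        leibniz' := fun x y => D.leibniz x y }
    have hE : E = 0 := by
      rw [← Derivation.liftKaehlerDifferential_comp E]
      have : E.liftKaehlerDifferential = 0 := by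
        refine LinearMap.ext fun x => ?_
        rw [Subsingleton.elim x 0, map_zero, map_zero]
      rw [this]; rfl
    ext b
    exact congrArg (fun D : Derivation A B M => D b) hE

end Restrict

/-- A standard smooth algebra of relative dimension `n` has étale coordinates. -/
theorem exists_of_isStandardSmooth {k B : Type u} [CommRing k] [CommRing B] [Algebra k B] {n : ℕ}
    [h : Algebra.IsStandardSmoothOfRelativeDimension n k B] :
    Nonempty (EtaleCoordinates k B n) := by
  classical
  obtain ⟨ι, σ, _, _, P, hP⟩ := h.out
  let b := P.basisKaehler
  have hcard : Nat.card ((Set.range P.map)ᶜ : Set ι) = n := by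
    have := Fintype.ofFinite ι
    have := Fintype.ofFinite σ
    rw [← hP, Algebra.Presentation.dimension, Nat.card_eq_fintype_card, Fintype.card_compl_set,
      Set.card_range_of_injective P.map_inj, Nat.card_eq_fintype_card, Nat.card_eq_fintype_card]
  let e : ((Set.range P.map)ᶜ : Set ι) ≃ Fin n := Finite.equivFinOfCardEq hcard
  let b' := b.reindex e
  have hb' (i : Fin n) : b' i = KaehlerDifferential.D k B (P.val (e.symm i)) := by
    rw [Basis.reindex_apply, Algebra.SubmersivePresentation.basisKaehler_apply]
  refine ⟨{ x := fun i => P.val (e.symm i)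
            partialDeriv := fun i => (b'.coord i).compDer (KaehlerDifferential.D k B)
            partialDeriv_x := fun i j => ?_
            eq_zero := fun D hD => ?_ }⟩
  · change b'.coord i (KaehlerDifferential.D k B _) = _
    rw [← hb', Basis.coord_apply, Basis.repr_self, Finsupp.single_apply]
    simp only [eq_comm]
  · rw [← Derivation.liftKaehlerDifferential_comp D]
    have : D.liftKaehlerDifferential = 0 := b'.ext fun i => by
      rw [hb', Derivation.liftKaehlerDifferential_comp_D, hD, LinearMap.zero_apply]
    rw [this]; rfl

end EtaleCoordinates

end SmoothScheme

/-! ### Intersections with sections of the cotangent bundle, in étale coordinates -/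

namespace SmoothScheme

open PointDerivation LagrangianLinearAlgebra Module

section Coords

variable {k S : Type*} [Field k] [CommRing S] [Algebra k S] {n : ℕ}

/-- The coordinates `(D (X i), D (ξ i))` of a tangent vector `D` of the cotangent bundle, where
`X i` are coordinates of the base and `ξ i` are the dual fibre coordinates. -/
def coords (X ξ : Fin n → S) : (S →ₗ[k] k) →ₗ[k] (Fin n → k) × Dual k (Fin n → k) where
  toFun D := (fun i => D (X i), ∑ i, D (ξ i) • LinearMap.proj i)
  map_add' D D' := by
    refine Prod.ext rfl ?_
    simp [add_smul, Finset.sum_add_distrib]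
  map_smul' a D := by
    refine Prod.ext rfl ?_
    simp [Finset.smul_sum, mul_smul]

theorem coords_snd (X ξ : Fin n → S) (D : S →ₗ[k] k) (v : Fin n → k) :
    (coords X ξ D).2 v = ∑ i, D (ξ i) * v i := by
  simp [coords]

theorem coords_snd_single (X ξ : Fin n → S) (D : S →ₗ[k] k) (i : Fin n) :
    (coords X ξ D).2 (Pi.single i 1) = D (ξ i) := by
  rw [coords_snd, Finset.sum_eq_single i] <;> simp +contextual

/-- A tangent vector at the point `ev` is determined by its coordinates. -/
def IsTangentChart (ev : S →ₐ[k] k) (X ξ : Fin n → S) : Prop :=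
  ∀ D ∈ pointDerivations ev, coords X ξ D = 0 → D = 0

theorem IsTangentChart.eq_of_coords_eq {ev : S →ₐ[k] k} {X ξ : Fin n → S}
    (h : IsTangentChart ev X ξ) {D D' : S →ₗ[k] k} (hD : D ∈ pointDerivations ev)
    (hD' : D' ∈ pointDerivations ev) (e : coords X ξ D = coords X ξ D') : D = D' :=
  sub_eq_zero.1 (h _ (Submodule.sub_mem _ hD hD') (by rw [map_sub, e, sub_self]))

theorem coords_eq_of {X ξ : Fin n → S} {D : S →ₗ[k] k} {u : Fin n → k}
    {η : Dual k (Fin n → k)} (h1 : ∀ i, D (X i) = u i) (h2 : ∀ i, D (ξ i) = η (Pi.single i 1)) :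
    coords X ξ D = (u, η) := by
  refine Prod.ext (funext h1) (LinearMap.pi_ext' fun i => LinearMap.ext_ring ?_)
  change (coords X ξ D).2 (Pi.single i 1) = η (Pi.single i 1)
  rw [coords_snd_single, h2]

end Coords

section Hessian

variable {k B : Type u} [Field k] [CommRing B] [Algebra k B] {n : ℕ}

/-- The Hessian form of a function `f` at the point `ev`. -/
noncomputable def hessian (c : EtaleCoordinates k B n) (ev : B →ₐ[k] k) (f : B) :
    (Fin n → k) →ₗ[k] Dual k (Fin n → k) :=
  ∑ i, ∑ j, ev (c.partialDeriv i (c.partialDeriv j f)) •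
    (LinearMap.proj i : Dual k (Fin n → k)).smulRight (LinearMap.proj j : Dual k (Fin n → k))

theorem hessian_apply (c : EtaleCoordinates k B n) (ev : B →ₐ[k] k) (f : B) (u v : Fin n → k) :
    hessian c ev f u v = ∑ i, ∑ j, ev (c.partialDeriv i (c.partialDeriv j f)) * u i * v j := by
  simp [hessian, LinearMap.sum_apply, mul_assoc]

theorem hessian_single (c : EtaleCoordinates k B n) (ev : B →ₐ[k] k) (f : B) (u : Fin n → k)
    (j : Fin n) : hessian c ev f u (Pi.single j 1) =
      ∑ i, ev (c.partialDeriv i (c.partialDeriv j f)) * u i := by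
  rw [hessian_apply]
  refine Finset.sum_congr rfl fun i _ => ?_
  rw [Finset.sum_eq_single j] <;> simp +contextual

theorem sum_sum_eq_zero {R : Type*} [CommRing R] (h2 : (2 : R) = 0) {n : ℕ}
    (a : Fin n → Fin n → R) (hdiag : ∀ i, a i i = 0) (hsymm : ∀ i j, a i j = a j i) :
    ∑ i, ∑ j, a i j = 0 := by
  rw [← Finset.sum_product']
  refine Finset.sum_involution (fun p _ => (p.2, p.1)) ?_ ?_ ?_ ?_
  · rintro ⟨i, j⟩ -
    dsimp only
    rw [hsymm j i, ← two_mul, h2, zero_mul]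
  · rintro ⟨i, j⟩ - h e
    have e' : j = i := congrArg Prod.fst e
    subst e'
    exact h (hdiag _)
  · intros; simp
  · rintro ⟨i, j⟩ -; rfl

/-- In characteristic two Hessians are alternating. -/
theorem hessian_self (c : EtaleCoordinates k B n) (ev : B →ₐ[k] k) (f : B) (h2 : (2 : k) = 0)
    (u : Fin n → k) : hessian c ev f u u = 0 := by
  rw [hessian_apply]
  refine sum_sum_eq_zero h2 _ (fun i => ?_) fun i j => ?_
  · rw [c.partialDeriv_partialDeriv h2, map_zero, zero_mul, zero_mul]
  · rw [c.partialDeriv_comm]; ring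

end Hessian

section Intersection

variable {k B S A : Type u} [Field k] [CommRing B] [Algebra k B] [CommRing S] [Algebra k S]
  [CommRing A] [Algebra k A] {n : ℕ}

/-- The local data at a point `y` of the section `df` of the cotangent bundle: `A` is the local ring
of the base at `y`, `S` is the local ring of the cotangent bundle at `df(y)`, with coordinates `X`
and `ξ`, and `ρ` is the pullback of functions along `df`; `β` are the germs of functions and `s` is
the pullback along the projection. -/
structure IsSectionAt (c : EtaleCoordinates k B n) (f : B) (X ξ : Fin n → S) (evA : A →ₐ[k] k)
    (β : B →ₐ[k] A) (ρ : S →ₐ[k] A) (s : A →ₐ[k] S) : Prop where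
  map_X : ∀ i, ρ (X i) = β (c.x i)
  map_ξ : ∀ i, ρ (ξ i) = β (c.partialDeriv i f)
  map_x : ∀ i, s (β (c.x i)) = X i
  eq_zero : ∀ τ ∈ pointDerivations evA, (∀ i, τ (β (c.x i)) = 0) → τ = 0

variable {c : EtaleCoordinates k B n} {f : B} {X ξ : Fin n → S} {evA : A →ₐ[k] k}
  {β : B →ₐ[k] A} {ρ : S →ₐ[k] A} {s : A →ₐ[k] S}

theorem comp_mem_pointDerivations {R R' : Type*} [CommRing R] [Algebra k R] [CommRing R']
    [Algebra k R'] {ev : R' →ₐ[k] k} (φ : R →ₐ[k] R') {τ : R' →ₗ[k] k}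
    (hτ : τ ∈ pointDerivations ev) : τ ∘ₗ φ.toLinearMap ∈ pointDerivations (ev.comp φ) := by
  intro a b
  simp only [LinearMap.comp_apply, AlgHom.toLinearMap_apply, map_mul, AlgHom.comp_apply]
  exact hτ _ _

/-- The differential of `df` maps a tangent vector with coordinates `u` to the one with
coordinates `(u, H u)`, where `H` is the Hessian form of `f`. -/
theorem IsSectionAt.coords_comp (h : IsSectionAt c f X ξ evA β ρ s) {τ : A →ₗ[k] k}
    (hτ : τ ∈ pointDerivations evA) : coords X ξ (τ ∘ₗ ρ.toLinearMap) =
      (fun i => τ (β (c.x i)), hessian c (evA.comp β) f fun i => τ (β (c.x i))) := by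
  refine coords_eq_of (fun i => ?_) fun j => ?_
  · rw [LinearMap.comp_apply, AlgHom.toLinearMap_apply, h.map_X]
  · rw [LinearMap.comp_apply, AlgHom.toLinearMap_apply, h.map_ξ, hessian_single]
    exact c.pointDerivation_apply (comp_mem_pointDerivations β hτ) _

theorem killing_map_iff {evS : S →ₐ[k] k} (hev : ∀ a, evA (ρ a) = evS a) {I : Ideal S}
    (hI : ∀ a ∈ I, evS a = 0) {τ : A →ₗ[k] k} (hτ : τ ∈ pointDerivations evA) :
    τ ∈ killing evA (I.map ρ) ↔ ∀ a ∈ I, τ (ρ a) = 0 := by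
  refine ⟨fun h a ha => h.2 _ (Ideal.mem_map_of_mem ρ ha), fun h => ⟨hτ, fun a ha => ?_⟩⟩
  refine Submodule.span_induction (p := fun a _ => τ a = 0 ∧ evA a = 0) ?_ ⟨map_zero _, map_zero _⟩
    ?_ ?_ ha |>.1
  · rintro _ ⟨a, ha, rfl⟩
    exact ⟨h a ha, (hev a).trans (hI a ha)⟩
  · rintro x y - - ⟨hx, hx'⟩ ⟨hy, hy'⟩
    exact ⟨by rw [map_add, hx, hy, add_zero], by rw [map_add, hx', hy', add_zero]⟩
  · rintro x y - ⟨hy, hy'⟩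
    exact ⟨by rw [smul_eq_mul, hτ, hy, hy', mul_zero, zero_mul, add_zero],
      by rw [smul_eq_mul, map_mul, hy', mul_zero]⟩

theorem ev_eq_zero_of_mem_map {evS : S →ₐ[k] k} (hev : ∀ a, evA (ρ a) = evS a) {I : Ideal S}
    (hI : ∀ a ∈ I, evS a = 0) {a : A} (ha : a ∈ I.map ρ) : evA a = 0 := by
  have : I.map ρ ≤ RingHom.ker evA := by
    rw [Ideal.map_le_iff_le_comap]
    intro a ha
    exact (hev a).trans (hI a ha)
  exact this ha

/-- The tangent space of the intersection of `C` and the image of `df` is the intersection of the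
tangent space of `C` with the graph of the Hessian form. -/
theorem IsSectionAt.exists_equiv [IsLocalRing A] (h : IsSectionAt c f X ξ evA β ρ s)
    {evS : S →ₐ[k] k} (hS : IsTangentChart evS X ξ) {I : Ideal S} (hI : ∀ a ∈ I, evS a = 0)
    (hev : ∀ a, evA (ρ a) = evS a) :
    ∃ e : killing evA (I.map ρ) ≃ₗ[k]
      graphInter ((killing evS I).map (coords X ξ)) (hessian c (evA.comp β) f),
      ∀ τ, (e τ).1 = fun i => τ.1 (β (c.x i)) := by
  have hevρ : evA.comp ρ = evS := AlgHom.ext hev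
  let F : killing evA (I.map ρ) →ₗ[k]
      graphInter ((killing evS I).map (coords X ξ)) (hessian c (evA.comp β) f) :=
    { toFun := fun τ => ⟨fun i => τ.1 (β (c.x i)), by
        rw [mem_graphInter, ← h.coords_comp τ.2.1]
        refine ⟨_, ⟨hevρ ▸ comp_mem_pointDerivations ρ τ.2.1, ?_⟩, rfl⟩
        exact (killing_map_iff hev hI τ.2.1).1 τ.2⟩
      map_add' := fun _ _ => rfl
      map_smul' := fun _ _ => rfl }
  refine ⟨LinearEquiv.ofBijective F ⟨?_, ?_⟩, fun τ => rfl⟩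
  · intro τ τ' e
    refine Subtype.ext (sub_eq_zero.1 (h.eq_zero _ (Submodule.sub_mem _ τ.2.1 τ'.2.1) fun i => ?_))
    exact sub_eq_zero.2 (congrFun (congrArg Subtype.val e) i)
  · rintro ⟨u, hu⟩
    obtain ⟨w, hw, hwu⟩ := hu
    have hwu1 (i : Fin n) : w (X i) = u i := congrFun (congrArg Prod.fst hwu) i
    let τ := w ∘ₗ s.toLinearMap
    have hevs : evS.comp s = evA := algHom_eq _ _
    have hτ : τ ∈ pointDerivations evA := hevs ▸ comp_mem_pointDerivations s hw.1
    have hτx (i : Fin n) : τ (β (c.x i)) = u i := by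
      change w (s (β (c.x i))) = u i
      rw [h.map_x, hwu1]
    have hτρ : τ ∘ₗ ρ.toLinearMap = w := by
      refine hS.eq_of_coords_eq (hevρ ▸ comp_mem_pointDerivations ρ hτ) hw.1 ?_
      rw [h.coords_comp hτ, hwu]
      simp only [hτx]
      rfl
    refine ⟨⟨τ, (killing_map_iff hev hI hτ).2 fun a ha => ?_⟩, Subtype.ext (funext hτx)⟩
    change (τ ∘ₗ ρ.toLinearMap) a = 0
    rw [hτρ, hw.2 a ha]

/-- The intersection number is one if and only if the tangent spaces meet trivially. -/
theorem IsSectionAt.length_eq_one_iff [IsLocalRing A] [IsNoetherianRing A]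
    (h : IsSectionAt c f X ξ evA β ρ s)
    {evS : S →ₐ[k] k} (hS : IsTangentChart evS X ξ) {I : Ideal S} (hI : ∀ a ∈ I, evS a = 0)
    (hev : ∀ a, evA (ρ a) = evS a) :
    Module.length A (A ⧸ I.map ρ) = 1 ↔
      graphInter ((killing evS I).map (coords X ξ)) (hessian c (evA.comp β) f) = ⊥ := by
  obtain ⟨e, -⟩ := h.exists_equiv hS hI hev
  have hJ : ∀ a ∈ I.map ρ, evA a = 0 := fun a ha => ev_eq_zero_of_mem_map hev hI ha
  have hiff : killing evA (I.map ρ) = ⊥ ↔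
      graphInter ((killing evS I).map (coords X ξ)) (hessian c (evA.comp β) f) = ⊥ := by
    rw [← Submodule.subsingleton_iff_eq_bot, ← Submodule.subsingleton_iff_eq_bot]
    exact e.toEquiv.subsingleton_congr
  rw [length_quotient_eq_one_iff, ← hiff]
  refine ⟨fun hmax => ?_, isMaximal_of_killing_eq_bot evA hJ⟩
  refine (Submodule.eq_bot_iff _).2 fun τ hτ => LinearMap.ext fun a => ?_
  have ha := sub_mem_maximalIdeal evA a
  rw [← IsLocalRing.eq_maximalIdeal hmax] at ha
  have := hτ.2 _ ha
  rwa [map_sub, apply_algebraMap hτ.1, sub_zero] at this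

end Intersection

section Jets

variable {k A : Type*} [Field k] [CommRing A] [Algebra k A]

/-- `(D₁, D₂)` are the coefficients of `t` and `t ^ 2` of a homomorphism `A → k[t]/(t ^ 3)`. -/
structure IsJet (ev : A →ₐ[k] k) (D₁ D₂ : A →ₗ[k] k) : Prop where
  mem : D₁ ∈ pointDerivations ev
  map_mul : ∀ a b, D₂ (a * b) = ev a * D₂ b + D₁ a * D₁ b + ev b * D₂ a

theorem IsJet.map_algebraMap {ev : A →ₐ[k] k} {D₁ D₂ : A →ₗ[k] k} (h : IsJet ev D₁ D₂) (a : k) :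
    D₂ (algebraMap k A a) = 0 := by
  have h1 : D₁ 1 = 0 := by simpa using apply_algebraMap h.mem 1
  have h2 : D₂ 1 = 0 := by simpa [h1] using h.map_mul 1 1
  rw [Algebra.algebraMap_eq_smul_one, map_smul, h2, smul_zero]

/-- Reparametrization `t ↦ a t`. -/
theorem IsJet.smul {ev : A →ₐ[k] k} {D₁ D₂ : A →ₗ[k] k} (h : IsJet ev D₁ D₂) (a : k) :
    IsJet ev (a • D₁) (a ^ 2 • D₂) where
  mem := Submodule.smul_mem _ a h.mem
  map_mul x y := by
    simp only [LinearMap.smul_apply, h.map_mul, smul_eq_mul]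
    ring

theorem IsJet.comp {R : Type*} [CommRing R] [Algebra k R] {ev : A →ₐ[k] k} {D₁ D₂ : A →ₗ[k] k}
    (h : IsJet ev D₁ D₂) (φ : R →ₐ[k] A) :
    IsJet (ev.comp φ) (D₁ ∘ₗ φ.toLinearMap) (D₂ ∘ₗ φ.toLinearMap) where
  mem := comp_mem_pointDerivations φ h.mem
  map_mul x y := by
    simp only [LinearMap.comp_apply, AlgHom.toLinearMap_apply, _root_.map_mul, AlgHom.comp_apply]
    exact h.map_mul _ _

/-- The second coefficients of two jets with the same first coefficient differ by a tangent
vector. -/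
theorem IsJet.sub_mem {ev : A →ₐ[k] k} {D₁ D₂ D₂' : A →ₗ[k] k} (h : IsJet ev D₁ D₂)
    (h' : IsJet ev D₁ D₂') : D₂ - D₂' ∈ pointDerivations ev := by
  intro a b
  rw [LinearMap.sub_apply, LinearMap.sub_apply, LinearMap.sub_apply, h.map_mul, h'.map_mul]
  ring

end Jets

section TestFunction

variable {k B : Type u} [Field k] [CommRing B] [Algebra k B] {n : ℕ}

/-- The function `∑ νᵢ Xᵢ + q(X, X) + γ l(X) ^ 3`, where `Xᵢ` are the coordinates centered at the
point `ev`. -/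
noncomputable def testFunction (c : EtaleCoordinates k B n) (ev : B →ₐ[k] k) (ν : Fin n → k)
    (q : (Fin n → k) →ₗ[k] Dual k (Fin n → k)) (l : Dual k (Fin n → k)) (γ : k) : B :=
  let X (i : Fin n) : B := c.x i - algebraMap k B (ev (c.x i))
  ∑ i, ν i • X i + ∑ i, ∑ j, q (Pi.single i 1) (Pi.single j 1) • (X i * X j) +
    γ • (∑ i, l (Pi.single i 1) • X i) ^ 3

variable (c : EtaleCoordinates k B n) (ev : B →ₐ[k] k) (ν : Fin n → k)
  (q : (Fin n → k) →ₗ[k] Dual k (Fin n → k)) (l : Dual k (Fin n → k)) (γ : k)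

theorem partialDeriv_testFunction (m : Fin n) :
    c.partialDeriv m (testFunction c ev ν q l γ) = algebraMap k B (ν m) +
      ∑ i, symm q (Pi.single i 1) (Pi.single m 1) • (c.x i - algebraMap k B (ev (c.x i))) +
      (3 * γ * l (Pi.single m 1)) •
        (∑ i, l (Pi.single i 1) • (c.x i - algebraMap k B (ev (c.x i)))) ^ 2 := by
  have hX (i : Fin n) : c.partialDeriv m (c.x i - algebraMap k B (ev (c.x i))) =
      if m = i then 1 else 0 := by
    rw [map_sub, c.partialDeriv_x, Derivation.map_algebraMap, sub_zero]
  have hL : c.partialDeriv m (∑ i, l (Pi.single i 1) • (c.x i - algebraMap k B (ev (c.x i)))) =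
      algebraMap k B (l (Pi.single m 1)) := by
    simp only [map_sum, Derivation.map_smul, hX]
    simp [Algebra.algebraMap_eq_smul_one]
  simp only [testFunction, map_add, Derivation.map_smul, Derivation.leibniz_pow, hL]
  congr 1
  · congr 1
    · simp only [map_sum, Derivation.map_smul, hX]
      simp [Algebra.algebraMap_eq_smul_one]
    · simp only [map_sum, Derivation.map_smul, Derivation.leibniz, hX, smul_add,
        Finset.sum_add_distrib, LinearMap.add_apply, LinearMap.flip_apply, add_smul]
      congr 1
      · simp
      · rw [Finset.sum_comm]
        simp
  · simp only [Algebra.smul_def, map_mul, map_ofNat]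
    norm_num
    ring

theorem ev_partialDeriv_testFunction (m : Fin n) :
    ev (c.partialDeriv m (testFunction c ev ν q l γ)) = ν m := by
  rw [partialDeriv_testFunction]
  simp

theorem hessian_testFunction : hessian c ev (testFunction c ev ν q l γ) = symm q := by
  refine LinearMap.pi_ext' fun i => LinearMap.ext_ring
    (LinearMap.pi_ext' fun m => LinearMap.ext_ring ?_)
  change hessian c ev (testFunction c ev ν q l γ) (Pi.single i 1) (Pi.single m 1) =
    symm q (Pi.single i 1) (Pi.single m 1)
  rw [hessian_single, Finset.sum_eq_single i (by simp +contextual) (by simp), Pi.single_eq_same,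
    mul_one, partialDeriv_testFunction]
  have hX (j : Fin n) : c.partialDeriv i (c.x j - algebraMap k B (ev (c.x j))) =
      if i = j then 1 else 0 := by
    rw [map_sub, c.partialDeriv_x, Derivation.map_algebraMap, sub_zero]
  simp only [map_add, map_sum, Derivation.map_smul, hX, Derivation.map_algebraMap,
    Derivation.leibniz_pow]
  simp [apply_ite]

theorem IsJet.map_partialDeriv_testFunction {A : Type*} [CommRing A] [Algebra k A]
    {evA : A →ₐ[k] k} {D₁ D₂ : A →ₗ[k] k} (h : IsJet evA D₁ D₂) (β : B →ₐ[k] A) (m : Fin n) :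
    D₂ (β (c.partialDeriv m (testFunction c (evA.comp β) ν q l γ))) =
      symm q (fun i => D₂ (β (c.x i))) (Pi.single m 1) +
        3 * γ * l (Pi.single m 1) * l (fun i => D₁ (β (c.x i))) ^ 2 := by
  have hpi (φ : Dual k (Fin n → k)) (u : Fin n → k) : φ u = ∑ i, u i * φ (Pi.single i 1) := by
    conv_lhs => rw [pi_eq_sum_univ' u]
    simp [map_sum]
  have hβ (a : k) : β (algebraMap k B a) = algebraMap k A a := β.commutes a
  have h1 (i : Fin n) : D₁ (β (c.x i - algebraMap k B ((evA.comp β) (c.x i)))) =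
      D₁ (β (c.x i)) := by
    rw [map_sub, map_sub, hβ, apply_algebraMap h.mem, sub_zero]
  have h2 (i : Fin n) : D₂ (β (c.x i - algebraMap k B ((evA.comp β) (c.x i)))) =
      D₂ (β (c.x i)) := by
    rw [map_sub, map_sub, hβ, h.map_algebraMap, sub_zero]
  have h0 (i : Fin n) : evA (β (c.x i - algebraMap k B ((evA.comp β) (c.x i)))) = 0 := by
    rw [map_sub, map_sub, hβ, AlgHom.commutes]
    simp
  have h3 : evA (β (∑ i, l (Pi.single i 1) •
      (c.x i - algebraMap k B ((evA.comp β) (c.x i))))) = 0 := by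
    simp only [map_sum, map_smul, h0, smul_zero, Finset.sum_const_zero]
  have h4 : D₁ (β (∑ i, l (Pi.single i 1) •
      (c.x i - algebraMap k B ((evA.comp β) (c.x i))))) = l fun i => D₁ (β (c.x i)) := by
    simp only [map_sum, map_smul, h1, hpi l fun i => D₁ (β (c.x i)), smul_eq_mul, mul_comm]
  rw [partialDeriv_testFunction, map_add, map_add, map_add, map_add, hβ, h.map_algebraMap,
    zero_add, map_smul, map_smul, pow_two, _root_.map_mul, h.map_mul, h3, h4, zero_mul, zero_add,
    add_zero, ← pow_two, smul_eq_mul]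
  congr 1
  have : symm q (fun i => D₂ (β (c.x i))) (Pi.single m 1) =
      (symm q).flip (Pi.single m 1) fun i => D₂ (β (c.x i)) := rfl
  rw [this, hpi]
  simp only [map_sum, map_smul, h2]
  exact Finset.sum_congr rfl fun i _ => by rw [smul_eq_mul, mul_comm]; rfl

end TestFunction

section LengthTwo

open IsLocalRing

variable {k A : Type u} [Field k] [CommRing A] [Algebra k A] [IsLocalRing A] [IsNoetherianRing A]

/-- A local algebra with one-dimensional tangent space has length two, or it admits a nonconstant
jet `k[t]/(t ^ 3)`. -/
theorem length_eq_two_or_exists_isJet (ev : A →ₐ[k] k) {J : Ideal A} (hJ : ∀ a ∈ J, ev a = 0)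
    (h1 : finrank k (killing ev J) = 1) : Module.length A (A ⧸ J) = 2 ∨
      ∃ D₁ D₂ : A →ₗ[k] k, IsJet ev D₁ D₂ ∧ D₁ ≠ 0 ∧ D₁ ∈ killing ev J ∧ ∀ a ∈ J, D₂ a = 0 := by
  have := isLocalRing_quotient ev hJ
  rw [finrank_killing ev hJ] at h1
  have hp : (maximalIdeal (A ⧸ J)).IsPrincipal := by
    rw [← finrank_cotangentSpace_le_one_iff, h1]
  obtain ⟨t, ht⟩ := hp
  change maximalIdeal (A ⧸ J) = Ideal.span {t} at ht
  have ht0 : t ≠ 0 := by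
    rintro rfl
    have : IsField (A ⧸ J) := by
      rw [IsLocalRing.isField_iff_maximalIdeal_eq, ht, Ideal.span_singleton_eq_bot]
    rw [finrank_cotangentSpace_eq_zero_iff.2 this] at h1
    exact zero_ne_one h1
  by_cases ht2 : t ^ 2 = 0
  · left
    rw [← length_self_eq_two ht ht0 ht2]
    exact Module.length_eq_of_surjective (R := A ⧸ J) (S := A) (M := A ⧸ J)
      Ideal.Quotient.mk_surjective
  · right
    obtain ⟨D₁, hD₁, D₂, h1, h2⟩ := exists_jet (evQuotient ev hJ) ht ht2
    have hjet : IsJet (evQuotient ev hJ) D₁ D₂ := ⟨hD₁, h2⟩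
    have hmk {a : A} (ha : a ∈ J) : (Ideal.Quotient.mkₐ k J) a = 0 :=
      Ideal.Quotient.eq_zero_iff_mem.2 ha
    refine ⟨_, _, hjet.comp (Ideal.Quotient.mkₐ k J), fun h0 => ?_, ⟨?_, fun a ha => ?_⟩,
      fun a ha => ?_⟩
    · obtain ⟨a, rfl⟩ := Ideal.Quotient.mk_surjective t
      have : D₁ (Ideal.Quotient.mk J a) = 0 := congrArg (fun D => D a) h0
      exact zero_ne_one (this.symm.trans h1)
    · exact (hjet.comp (Ideal.Quotient.mkₐ k J)).mem
    · simp only [LinearMap.comp_apply, AlgHom.toLinearMap_apply, hmk ha, map_zero]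
    · simp only [LinearMap.comp_apply, AlgHom.toLinearMap_apply, hmk ha, map_zero]

variable {B S : Type u} [CommRing B] [Algebra k B] [CommRing S] [Algebra k S] [IsLocalRing S]
  {n : ℕ} {c : EtaleCoordinates k B n} {X ξ : Fin n → S} {evA : A →ₐ[k] k} {β : B →ₐ[k] A}
  {s : A →ₐ[k] S}

/-- In characteristic two, if the tangent space of `C` is isotropic and meets the graph of the
Hessian of `f` in a line, then the cubic term of `f` can be chosen so that the intersection number
is two: if it is not, then there is an intersection jet of order two. For two different cubic
terms, the difference of the second coefficients of these jets is a tangent vector of `C`, and it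
is not orthogonal to the common tangent line. -/
theorem exists_length_eq_two (h2 : (2 : k) = 0) {evS : S →ₐ[k] k} (hS : IsTangentChart evS X ξ)
    {I : Ideal S} (hI : ∀ a ∈ I, evS a = 0)
    (hiso : ∀ v ∈ (killing evS I).map (coords X ξ), v.2 v.1 = 0) {ν : Fin n → k}
    {q : (Fin n → k) →ₗ[k] Dual k (Fin n → k)}
    (hq : finrank k (graphInter ((killing evS I).map (coords X ξ)) (symm q)) = 1)
    (ρ : Dual k (Fin n → k) → k → S →ₐ[k] A)
    (hρ : ∀ l γ, IsSectionAt c (testFunction c (evA.comp β) ν q l γ) X ξ evA β (ρ l γ) s) :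
    ∃ l γ, Module.length A (A ⧸ I.map (ρ l γ)) = 2 := by
  by_contra! hne
  obtain ⟨⟨u₀, hu₀⟩, hu0, huniq⟩ := finrank_eq_one_iff'.1 hq
  obtain ⟨i₀, hi₀⟩ : ∃ i, u₀ i ≠ 0 := by
    by_contra! h
    exact hu0 (Subtype.ext (funext h))
  let l : Dual k (Fin n → k) := (u₀ i₀)⁻¹ • LinearMap.proj i₀
  have hl : l u₀ = 1 := by simp [l, hi₀]
  have hev (γ : k) : evA.comp (ρ l γ) = evS := algHom_eq _ _
  -- The jets are reparametrized so that they all have the same velocity `u₀`.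
  have key (γ : k) : ∃ D₁ D₂ : A →ₗ[k] k, IsJet evA D₁ D₂ ∧ (fun i => D₁ (β (c.x i))) = u₀ ∧
      ∀ a ∈ I.map (ρ l γ), D₂ a = 0 := by
    obtain ⟨e, he⟩ := (hρ l γ).exists_equiv hS hI fun a => congrArg (fun φ => φ a) (hev γ)
    have hJ : ∀ a ∈ I.map (ρ l γ), evA a = 0 := fun a ha =>
      ev_eq_zero_of_mem_map (fun a => congrArg (fun φ => φ a) (hev γ)) hI ha
    have h1 : finrank k (killing evA (I.map (ρ l γ))) = 1 := by
      rw [e.finrank_eq, hessian_testFunction, hq]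
    obtain ⟨D₁, D₂, hjet, hD0, hD₁, hD₂⟩ :=
      (length_eq_two_or_exists_isJet evA hJ h1).resolve_left (hne l γ)
    have hmem : (fun i => D₁ (β (c.x i))) ∈
        graphInter ((killing evS I).map (coords X ξ)) (symm q) := by
      rw [← hessian_testFunction c (evA.comp β) ν q l γ, ← he ⟨D₁, hD₁⟩]
      exact (e ⟨D₁, hD₁⟩).2
    obtain ⟨a, ha⟩ := huniq ⟨_, hmem⟩
    have ha' : a • u₀ = fun i => D₁ (β (c.x i)) := congrArg Subtype.val ha
    have ha0 : a ≠ 0 := by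
      rintro rfl
      refine hD0 ((hρ l γ).eq_zero _ hjet.mem fun i => ?_)
      rw [zero_smul] at ha'
      exact (congrFun ha' i).symm
    refine ⟨_, _, hjet.smul a⁻¹, ?_, fun a ha => ?_⟩
    · change a⁻¹ • (fun i => D₁ (β (c.x i))) = u₀
      rw [← ha', inv_smul_smul₀ ha0]
    · rw [LinearMap.smul_apply, hD₂ a ha, smul_zero]
  obtain ⟨D₁, D₂, hD, hDu, hDI⟩ := key 0
  obtain ⟨D₁', D₂', hD', hDu', hDI'⟩ := key 1
  have hjet := hev 0 ▸ hD.comp (ρ l 0)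
  have hjet' := hev 1 ▸ hD'.comp (ρ l 1)
  have hc1 : coords X ξ (D₁ ∘ₗ (ρ l 0).toLinearMap) = (u₀, symm q u₀) := by
    rw [(hρ l 0).coords_comp hD.mem, hessian_testFunction, hDu]
  have hc1' : coords X ξ (D₁' ∘ₗ (ρ l 1).toLinearMap) = (u₀, symm q u₀) := by
    rw [(hρ l 1).coords_comp hD'.mem, hessian_testFunction, hDu']
  have hDD := hS.eq_of_coords_eq hjet.mem hjet'.mem (hc1.trans hc1'.symm)
  have hE := hjet.sub_mem (hDD ▸ hjet')
  set E := D₂ ∘ₗ (ρ l 0).toLinearMap - D₂' ∘ₗ (ρ l 1).toLinearMap with hEdef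
  have hEV : coords X ξ E ∈ (killing evS I).map (coords X ξ) := by
    refine ⟨E, ⟨hE, fun a ha => ?_⟩, rfl⟩
    simp only [hEdef, LinearMap.sub_apply, LinearMap.comp_apply, AlgHom.toLinearMap_apply,
      hDI _ (Ideal.mem_map_of_mem _ ha), hDI' _ (Ideal.mem_map_of_mem _ ha), sub_zero]
  have hEc : coords X ξ E = ((fun i => D₂ (β (c.x i))) - fun i => D₂' (β (c.x i)),
      symm q ((fun i => D₂ (β (c.x i))) - fun i => D₂' (β (c.x i))) - (3 : k) • l) := by
    refine coords_eq_of (fun i => ?_) fun i => ?_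
    · simp only [hEdef, LinearMap.sub_apply, LinearMap.comp_apply, AlgHom.toLinearMap_apply,
        (hρ l _).map_X, Pi.sub_apply]
    · simp only [hEdef, LinearMap.sub_apply, LinearMap.comp_apply, AlgHom.toLinearMap_apply,
        (hρ l _).map_ξ]
      rw [hD.map_partialDeriv_testFunction, hD'.map_partialDeriv_testFunction, hDu, hDu', hl]
      simp only [map_sub, LinearMap.sub_apply, LinearMap.smul_apply, smul_eq_mul]
      ring
  set δ := (fun i => D₂ (β (c.x i))) - fun i => D₂' (β (c.x i))
  rw [hEc] at hEV
  have hsum := hiso _ (Submodule.add_mem _ (mem_graphInter.1 hu₀) hEV)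
  have hs1 := hiso _ (mem_graphInter.1 hu₀)
  have hs2 := hiso _ hEV
  have hsw : symm q δ u₀ = symm q u₀ δ := by
    simp only [LinearMap.add_apply, LinearMap.flip_apply, add_comm]
  have h3 : (3 : k) = 0 := by
    change (symm q u₀ + (symm q δ - (3 : k) • l)) (u₀ + δ) = 0 at hsum
    change symm q u₀ u₀ = 0 at hs1
    change (symm q δ - (3 : k) • l) δ = 0 at hs2
    rw [LinearMap.add_apply, map_add, map_add, hs1, hs2, LinearMap.sub_apply, hsw,
      LinearMap.smul_apply, hl, smul_eq_mul] at hsum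
    linear_combination -hsum + symm q u₀ δ * h2
  exact one_ne_zero (α := k) (by linear_combination h3 - h2)

end LengthTwo

end SmoothScheme

/-! ### Germs of functions on affine charts -/

namespace SmoothScheme

section Germs

open IsLocalRing

/-- The ring homomorphism `γ` assigns to a function on the affine chart `g` its germ at `e`. -/
def IsGerm {E : Scheme.{u}} {R : CommRingCat.{u}} (g : Spec R ⟶ E) {e : E}
    (γ : R ⟶ E.presheaf.stalk e) : Prop :=
  Spec.map γ ≫ g = E.fromSpecStalk e

variable {E : Scheme.{u}} {R : CommRingCat.{u}} {g : Spec R ⟶ E}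

/-- The germs of functions are compatible with pullbacks. -/
theorem IsGerm.comp_stalkMap {E' : Scheme.{u}} {T : CommRingCat.{u}} [Mono g] {g' : Spec T ⟶ E'}
    {h : E' ⟶ E} {φ : R ⟶ T} (hh : g' ≫ h = Spec.map φ ≫ g) {e' : E'}
    {γ : R ⟶ E.presheaf.stalk (h e')} (hγ : IsGerm g γ) {γ' : T ⟶ E'.presheaf.stalk e'}
    (hγ' : IsGerm g' γ') : γ ≫ h.stalkMap e' = φ ≫ γ' := by
  have h1 := Scheme.SpecMap_stalkMap_fromSpecStalk h (x := e')
  rw [← hγ, ← hγ', Category.assoc, hh, ← Category.assoc, ← Category.assoc, cancel_mono] at h1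
  apply Spec.map_injective
  rw [Spec.map_comp, Spec.map_comp]
  exact h1

theorem IsGerm.comp_stalkMap_apply {E' : Scheme.{u}} {T : CommRingCat.{u}} [Mono g]
    {g' : Spec T ⟶ E'} {h : E' ⟶ E} {φ : R ⟶ T} (hh : g' ≫ h = Spec.map φ ≫ g) {e' : E'}
    {γ : R ⟶ E.presheaf.stalk (h e')} (hγ : IsGerm g γ) {γ' : T ⟶ E'.presheaf.stalk e'}
    (hγ' : IsGerm g' γ') (a : R) : (h.stalkMap e').hom (γ.hom a) = γ'.hom (φ.hom a) :=
  congrArg (fun f => f.hom a) (hγ.comp_stalkMap hh hγ')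

theorem IsGerm.comp_eq {T : CommRingCat.{u}} [Mono g]
    {g' : Spec T ⟶ E} {φ : R ⟶ T} (hh : g' = Spec.map φ ≫ g) {e : E}
    {γ : R ⟶ E.presheaf.stalk e} (hγ : IsGerm g γ) {γ' : T ⟶ E.presheaf.stalk e}
    (hγ' : IsGerm g' γ') (a : R) : γ'.hom (φ.hom a) = γ.hom a := by
  have h1 : Spec.map γ' ≫ g' = Spec.map γ ≫ g := Eq.trans hγ' (Eq.symm hγ)
  rw [hh, ← Category.assoc, cancel_mono, ← Spec.map_comp] at h1
  exact congrArg (fun f => f.hom a) (Spec.map_injective h1)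

/-- The germ at `y` of a function on `Spec R`. -/
noncomputable def specGerm (R : CommRingCat.{u}) (y : Spec R) : R ⟶ (Spec R).presheaf.stalk y :=
  (Scheme.ΓSpecIso R).inv ≫ (Spec R).presheaf.germ ⊤ y trivial

theorem isGerm_specGerm (R : CommRingCat.{u}) (y : Spec R) : IsGerm (𝟙 _) (specGerm R y) :=
  Eq.trans (Category.comp_id _) (Spec.fromSpecStalk_eq R y).symm

theorem isLocalization_specGerm (R : CommRingCat.{u}) (y : Spec R) :
    letI := (specGerm R y).hom.toAlgebra
    haveI : y.asIdeal.IsPrime := y.2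
    IsLocalization y.asIdeal.primeCompl ((Spec R).presheaf.stalk y) :=
  StructureSheaf.IsLocalization.to_stalk R y

theorem IsGerm.exists_point {e : E} {γ : R ⟶ E.presheaf.stalk e} (hγ : IsGerm g γ) :
    ∃ p : Spec R, g p = e ∧ p.asIdeal = (maximalIdeal (E.presheaf.stalk e)).comap γ.hom := by
  let c : Spec (E.presheaf.stalk e) := closedPoint (E.presheaf.stalk e)
  refine ⟨Spec.map γ c, ?_, rfl⟩
  have h1 : (Spec.map γ ≫ g) c = e := by
    rw [hγ]
    exact Scheme.fromSpecStalk_closedPoint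
  exact h1

theorem IsGerm.isLocalization [IsOpenImmersion g] {e : E} {γ : R ⟶ E.presheaf.stalk e}
    (hγ : IsGerm g γ) :
    letI := γ.hom.toAlgebra
    IsLocalization ((maximalIdeal (E.presheaf.stalk e)).comap γ.hom).primeCompl
      (E.presheaf.stalk e) := by
  obtain ⟨p, rfl, hp⟩ := hγ.exists_point
  let _ := γ.hom.toAlgebra
  let _ := (specGerm R p).hom.toAlgebra
  have : p.asIdeal.IsPrime := p.2
  have h0 := isLocalization_specGerm R p
  have h1 : γ ≫ g.stalkMap p = specGerm R p := by
    have := hγ.comp_stalkMap (g' := 𝟙 _) (φ := 𝟙 R) (h := g) (by simp) (isGerm_specGerm R p)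
    rwa [Category.id_comp] at this
  let i : E.presheaf.stalk (g p) ≅ (Spec R).presheaf.stalk p := asIso (g.stalkMap p)
  let e' : (Spec R).presheaf.stalk p ≃ₐ[R] E.presheaf.stalk (g p) := AlgEquiv.ofRingEquiv
    (f := i.symm.commRingCatIsoToRingEquiv) fun a => by
      change i.inv.hom ((specGerm R p).hom a) = γ.hom a
      rw [← h1]
      exact congrArg (fun f => f.hom (γ.hom a)) i.hom_inv_id
  have := IsLocalization.isLocalization_of_algEquiv p.asIdeal.primeCompl e'
  simp only [← hp]
  exact this

end Germs

section Cotangent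

open Opposite

theorem isGerm_germ {X : Scheme.{u}} {U : X.Opens} (hU : IsAffineOpen U) {x : X} (hx : x ∈ U) :
    IsGerm hU.fromSpec (X.presheaf.germ U x hx) :=
  hU.fromSpecStalk_eq_fromSpecStalk hx

theorem germ_appLE {Y Z : Scheme.{u}} (f : Y ⟶ Z) {U : Z.Opens} {V : Y.Opens} (i : V ≤ f ⁻¹ᵁ U)
    {y : Y} (hy : y ∈ V) (a : Γ(Z, U)) :
    (Y.presheaf.germ V y hy).hom ((f.appLE U V i).hom a) =
      (f.stalkMap y).hom ((Z.presheaf.germ U (f y) (i hy)).hom a) := by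
  have h1 : f.appLE U V i ≫ Y.presheaf.germ V y hy =
      Z.presheaf.germ U (f y) (i hy) ≫ f.stalkMap y := by
    refine Eq.trans ?_ (Scheme.Hom.germ_stalkMap f U y (i hy)).symm
    rw [Scheme.Hom.appLE, Category.assoc, TopCat.Presheaf.germ_res]
  exact congrArg (fun f => f.hom a) h1

variable (k : Type u) [Field k] {X : Scheme.{u}} [X.Over (Spec (.of k))]
  [Smooth (X ↘ Spec (.of k))]

theorem isGerm_germAt (U : X.AffineZariskiSite) {e : cotangentBundle k X}
    (he : e ∈ (chart k U) ''ᵁ ⊤) : IsGerm (chart k U) (CommRingCat.ofHom (germAt k U he)) := by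
  have hU : IsAffineOpen ((chart k U) ''ᵁ ⊤) := (isAffineOpen_top _).image_of_isOpenImmersion _
  have h1 := hU.fromSpecStalk_eq_fromSpecStalk he
  have h2 := IsAffineOpen.SpecMap_appLE_fromSpec (chart k U) hU (isAffineOpen_top _)
    (by rw [Scheme.Hom.preimage_image_eq])
  rw [IsAffineOpen.fromSpec_top, Scheme.isoSpec_Spec_inv, ← Scheme.Hom.appIso_hom'] at h2
  have h3 : Spec.map ((Scheme.ΓSpecIso (.of (FunctionRing k X U.1))).inv ≫
      ((chart k U).appIso ⊤).inv) ≫ chart k U = hU.fromSpec := by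
    rw [Spec.map_comp, Category.assoc, ← h2, ← Category.assoc, ← Spec.map_comp, Iso.hom_inv_id,
      Spec.map_id]
    exact Category.id_comp _
  have h4 : CommRingCat.ofHom (germAt k U he) =
      ((Scheme.ΓSpecIso (.of (FunctionRing k X U.1))).inv ≫ ((chart k U).appIso ⊤).inv) ≫
        (cotangentBundle k X).presheaf.germ _ e he := by
    rw [germAt, CommRingCat.ofHom_hom, Category.assoc]
  refine Eq.trans (congrArg (fun γ => Spec.map γ ≫ chart k U) h4) ?_
  rw [Spec.map_comp, Category.assoc, h3]
  exact h1

theorem chart_comp {U V : X.AffineZariskiSite} (i : V ⟶ U) :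
    chart k V = Spec.map (CommRingCat.ofHom (restrictFunction k i)) ≫ chart k U :=
  (Limits.colimit.w (gluingData k X).functor i).symm

theorem germAt_restrictFunction {U V : X.AffineZariskiSite} (i : V ⟶ U)
    {e : cotangentBundle k X} (he : e ∈ (chart k U) ''ᵁ ⊤) (he' : e ∈ (chart k V) ''ᵁ ⊤)
    (s : FunctionRing k X U.1) :
    germAt k V he' (restrictFunction k i s) = germAt k U he s :=
  (isGerm_germAt k U he).comp_eq (chart_comp k i) (isGerm_germAt k V he') s

theorem mem_image_chart_iff {U : X.AffineZariskiSite} {e : cotangentBundle k X} :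
    e ∈ (chart k U) ''ᵁ ⊤ ↔ proj k X e ∈ U.1 := by
  rw [Scheme.Hom.image_top_eq_opensRange, opensRange_chart]
  rfl

theorem stalkMap_proj_germ {U : X.AffineZariskiSite} {e : cotangentBundle k X}
    (he : e ∈ (chart k U) ''ᵁ ⊤) (a : Γ(X, U.1)) :
    ((proj k X).stalkMap e).hom
      ((X.presheaf.germ U.1 (proj k X e) ((mem_image_chart_iff k).1 he)).hom a) =
      germAt k U he (algebraMap _ _ a) :=
  (isGerm_germ U.2 ((mem_image_chart_iff k).1 he)).comp_stalkMap_apply (chart_proj k U)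
    (isGerm_germAt k U he) a

theorem germAt_algebraMap_algebraMap {U : X.AffineZariskiSite} {e : cotangentBundle k X}
    (he : e ∈ (chart k U) ''ᵁ ⊤) (r : k) :
    germAt k U he (algebraMap _ _ (algebraMap k Γ(X, U.1) r)) = algebraMap k _ r := by
  let a : Γ(Spec (.of k), ⊤) := (Scheme.ΓSpecIso (.of k)).inv.hom r
  have h1 : ((proj k X).stalkMap e).hom
      ((X.presheaf.germ U.1 (proj k X e) ((mem_image_chart_iff k).1 he)).hom
        (((X ↘ Spec (.of k)).appLE ⊤ U.1 (le_preimage_top _ _)).hom a)) =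
      ((cotangentBundle k X).presheaf.germ ⊤ e trivial).hom
        (((proj k X ≫ (X ↘ Spec (.of k))).appLE ⊤ ⊤ (le_preimage_top _ _)).hom a) := by
    refine Eq.trans ?_ (germ_appLE (proj k X ≫ (X ↘ Spec (.of k))) (U := ⊤) (V := ⊤)
      (le_preimage_top _ _) (y := e) trivial a).symm
    rw [germ_appLE, Scheme.Hom.stalkMap_comp]
    rfl
  exact Eq.trans (stalkMap_proj_germ k he _).symm h1

theorem differential_comp (U : X.AffineZariskiSite) (f : Γ(X, U.1)) (y : Spec Γ(X, U.1))
    (he : differential k U f y ∈ (chart k U) ''ᵁ ⊤) (s : FunctionRing k X U.1) :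
    ((differential k U f).stalkMap y).hom (germAt k U he s) =
      (specGerm _ y).hom (pullbackDifferential k U f s) :=
  (isGerm_germAt k U he).comp_stalkMap_apply (φ := CommRingCat.ofHom
    (pullbackDifferential k U f).toRingHom) (Category.id_comp _)
    (isGerm_specGerm _ y) s

end Cotangent

end SmoothScheme

/-! ### Closed points of the cotangent bundle -/

namespace SmoothScheme

open PointDerivation IsLocalRing

section Localization

theorem IsGerm.exists_mul_eq {E : Scheme.{u}} {R : CommRingCat.{u}} {g : Spec R ⟶ E}
    [IsOpenImmersion g] {e : E} {γ : R ⟶ E.presheaf.stalk e} (hγ : IsGerm g γ)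
    (s : E.presheaf.stalk e) : ∃ a b : R, IsUnit (γ.hom b) ∧ s * γ.hom b = γ.hom a := by
  let _ := γ.hom.toAlgebra
  have := hγ.isLocalization
  obtain ⟨⟨a, b⟩, h⟩ := IsLocalization.surj
    ((maximalIdeal (E.presheaf.stalk e)).comap γ.hom).primeCompl s
  exact ⟨a, b, IsLocalization.map_units _ b, h⟩

theorem IsGerm.isNoetherianRing {E : Scheme.{u}} {R : CommRingCat.{u}} {g : Spec R ⟶ E}
    [IsOpenImmersion g] {e : E} {γ : R ⟶ E.presheaf.stalk e} (hγ : IsGerm g γ)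
    [IsNoetherianRing R] : IsNoetherianRing (E.presheaf.stalk e) := by
  let _ := γ.hom.toAlgebra
  have := hγ.isLocalization
  exact IsLocalization.isNoetherianRing
    ((maximalIdeal (E.presheaf.stalk e)).comap γ.hom).primeCompl _ inferInstance

theorem IsGerm.exists_lift {E : Scheme.{u}} {R : CommRingCat.{u}} {g : Spec R ⟶ E}
    [IsOpenImmersion g] {e : E} {γ : R ⟶ E.presheaf.stalk e} (hγ : IsGerm g γ)
    {T : Type*} [CommRing T] (φ : R →+* T) (h : ∀ b, IsUnit (γ.hom b) → IsUnit (φ b)) :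
    ∃ ψ : E.presheaf.stalk e →+* T, ∀ a, ψ (γ.hom a) = φ a := by
  let _ := γ.hom.toAlgebra
  have := hγ.isLocalization
  refine ⟨IsLocalization.lift (M := ((maximalIdeal (E.presheaf.stalk e)).comap γ.hom).primeCompl)
    (g := φ) fun b => h _ (IsLocalization.map_units (E.presheaf.stalk e) b), fun a => ?_⟩
  exact IsLocalization.lift_eq _ a

/-- A point derivation that vanishes on a ring vanishes on its localizations. -/
theorem eq_zero_of_mem_pointDerivations {k S R : Type*} [Field k] [CommRing S] [Algebra k S]
    {ev : S →ₐ[k] k} {D : S →ₗ[k] k} (hD : D ∈ pointDerivations ev) (γ : R → S)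
    (hγ : ∀ s, ∃ a b, IsUnit (γ b) ∧ s * γ b = γ a) (h : ∀ a, D (γ a) = 0) : D = 0 := by
  ext s
  obtain ⟨a, b, hb, hs⟩ := hγ s
  have h1 := hD s (γ b)
  rw [hs, h, h, mul_zero, zero_add] at h1
  exact (mul_eq_zero.1 h1.symm).resolve_left (hb.map ev).ne_zero

end Localization

variable {k : Type u} [Field k] {X : Scheme.{u}} [X.Over (Spec (.of k))]

theorem finiteType_sections [Smooth (X ↘ Spec (.of k))] {U : X.Opens} (hU : IsAffineOpen U) :
    Algebra.FiniteType k Γ(X, U) := by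
  have h1 : ((X ↘ Spec (.of k)).appLE ⊤ U (le_preimage_top _ _)).hom.FinitePresentation :=
    Scheme.Hom.finitePresentation_appLE _ (isAffineOpen_top _) hU _
  have h2 : (Scheme.ΓSpecIso (.of k)).inv.hom.FinitePresentation :=
    .of_bijective (ConcreteCategory.bijective_of_isIso (Scheme.ΓSpecIso (.of k)).inv)
  have h : (algebraMap k Γ(X, U)).FiniteType := RingHom.FiniteType.of_finitePresentation (h1.comp h2)
  rwa [RingHom.finiteType_algebraMap] at h

/-- The ring of functions on the cotangent bundle of `U` as a `k`-algebra. -/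
noncomputable abbrev algebraFunctionRing (k : Type u) [Field k] {X : Scheme.{u}}
    [X.Over (Spec (.of k))] (U : X.Opens) : Algebra k (FunctionRing k X U) :=
  ((algebraMap Γ(X, U) (FunctionRing k X U)).comp (algebraMap k Γ(X, U))).toAlgebra

attribute [local instance] algebraFunctionRing

theorem finiteType_functionRing [Smooth (X ↘ Spec (.of k))] {U : X.Opens} (hU : IsAffineOpen U)
    {n : ℕ} (c : EtaleCoordinates k Γ(X, U) n) : Algebra.FiniteType k (FunctionRing k X U) := by
  have := finiteType_sections (k := k) hU
  have := c.finiteType_symmetricAlgebra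
  have h : (algebraMap Γ(X, U) (FunctionRing k X U)).FiniteType := by
    rwa [RingHom.finiteType_algebraMap]
  have h' : (algebraMap k Γ(X, U)).FiniteType := by
    rwa [RingHom.finiteType_algebraMap]
  exact h.comp h'

variable [Smooth (X ↘ Spec (.of k))] {U : X.AffineZariskiSite} {n : ℕ}
  {e : cotangentBundle k X}

/-- The germ at `e` of the pullback of a function on `U`. -/
noncomputable def baseGerm (he : e ∈ (chart k U) ''ᵁ ⊤) :
    Γ(X, U.1) →ₐ[k] (cotangentBundle k X).presheaf.stalk e :=
  { (germAt k U he).comp (algebraMap _ _) with commutes' := germAt_algebraMap_algebraMap k he }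

/-- The germ at `e` of a vector field, considered as a function on the cotangent bundle. -/
noncomputable def fieldGerm (he : e ∈ (chart k U) ''ᵁ ⊤) (θ : VectorField k X U.1) :
    (cotangentBundle k X).presheaf.stalk e :=
  germAt k U he (SymmetricAlgebra.ι Γ(X, U.1) _ θ)

theorem fieldGerm_eq_sum (c : EtaleCoordinates k Γ(X, U.1) n) (he : e ∈ (chart k U) ''ᵁ ⊤)
    (θ : VectorField k X U.1) : fieldGerm he θ =
      ∑ i, baseGerm he (θ (c.x i)) * fieldGerm he (c.partialDeriv i) := by
  have h (a : Γ(X, U.1)) (θ : VectorField k X U.1) :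
      fieldGerm he (a • θ) = baseGerm he a * fieldGerm he θ := by
    rw [fieldGerm, map_smul, Algebra.smul_def, map_mul]
    rfl
  conv_lhs => rw [c.derivation_eq_sum θ]
  simp only [← h]
  simp only [fieldGerm, map_sum]

theorem exists_mul_germAt_eq (he : e ∈ (chart k U) ''ᵁ ⊤)
    (s : (cotangentBundle k X).presheaf.stalk e) :
    ∃ a b, IsUnit (germAt k U he b) ∧ s * germAt k U he b = germAt k U he a :=
  (isGerm_germAt k U he).exists_mul_eq s

theorem exists_closedPoint (he : e ∈ (chart k U) ''ᵁ ⊤) : ∃ p : Spec (.of (FunctionRing k X U.1)),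
    chart k U p = e ∧ ∀ a, a ∈ p.asIdeal ↔ ¬ IsUnit (germAt k U he a) := by
  obtain ⟨p, hp, h⟩ := (isGerm_germAt k U he).exists_point
  refine ⟨p, hp, fun a => ?_⟩
  rw [h]
  exact Iff.rfl

theorem isMaximal_of_isClosed (hc : IsClosed {e}) {p : Spec (.of (FunctionRing k X U.1))}
    (hp : chart k U p = e) : p.asIdeal.IsMaximal := by
  refine (PrimeSpectrum.isClosed_singleton_iff_isMaximal p).1 ?_
  have h1 : chart k U ⁻¹' {e} = {p} := by
    ext q
    rw [Set.mem_preimage, Set.mem_singleton_iff, Set.mem_singleton_iff, ← hp]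
    exact (chart k U).injective.eq_iff
  exact h1 ▸ hc.preimage (chart k U).continuous

/-- The Nullstellensatz: closed points of the cotangent bundle are rational. -/
theorem exists_evaluation [IsAlgClosed k] (c : EtaleCoordinates k Γ(X, U.1) n)
    (he : e ∈ (chart k U) ''ᵁ ⊤) (hc : IsClosed {e}) :
    Nonempty ((cotangentBundle k X).presheaf.stalk e →ₐ[k] k) := by
  obtain ⟨p, hp, hmem⟩ := exists_closedPoint he
  have := isMaximal_of_isClosed hc hp
  have := finiteType_functionRing U.2 c
  let Q := FunctionRing k X U.1 ⧸ p.asIdeal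
  let _ : Field Q := Ideal.Quotient.field p.asIdeal
  have : Algebra.FiniteType k Q := .of_surjective (Ideal.Quotient.mkₐ k p.asIdeal)
    Ideal.Quotient.mk_surjective
  have : Module.Finite k Q := finite_of_finite_type_of_isJacobsonRing k Q
  have hbij : Function.Bijective (algebraMap k Q) :=
    IsAlgClosed.algebraMap_bijective_of_isIntegral
  have hsub (a : FunctionRing k X U.1) : ∃ r : k,
      germAt k U he a - algebraMap k _ r ∈ maximalIdeal ((cotangentBundle k X).presheaf.stalk e) := by
    obtain ⟨r, hr⟩ := hbij.2 (Ideal.Quotient.mk _ a)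
    refine ⟨r, ?_⟩
    have h1 : a - algebraMap k _ r ∈ p.asIdeal := by
      rw [← Ideal.Quotient.eq_zero_iff_mem, map_sub, ← hr]
      exact sub_self _
    rw [mem_maximalIdeal, mem_nonunits_iff, ← germAt_algebraMap_algebraMap k he, ← map_sub]
    exact (hmem _).1 h1
  let κ := ResidueField ((cotangentBundle k X).presheaf.stalk e)
  have hres : Function.Surjective (algebraMap k κ) := by
    intro x
    obtain ⟨s, rfl⟩ := residue_surjective x
    obtain ⟨a, b, hb, hs⟩ := exists_mul_germAt_eq he s
    obtain ⟨r, hr⟩ := hsub a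
    obtain ⟨r', hr'⟩ := hsub b
    have h1 := congrArg (residue _) hs
    rw [← residue_eq_zero_iff, map_sub, sub_eq_zero] at hr hr'
    rw [map_mul, hr, hr'] at h1
    have h2 : residue _ (algebraMap k ((cotangentBundle k X).presheaf.stalk e) r') ≠ 0 := by
      rw [← hr']
      exact (hb.map _).ne_zero
    refine ⟨r * r'⁻¹, ?_⟩
    have h3 : r' ≠ 0 := by rintro rfl; simp at h2
    change residue _ (algebraMap k _ _) = _
    apply mul_right_cancel₀ h2
    rw [h1, ← map_mul, ← map_mul, inv_mul_cancel_right₀ h3]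
  let i : k ≃ₐ[k] κ := AlgEquiv.ofBijective (Algebra.ofId k κ) ⟨(algebraMap k κ).injective, hres⟩
  exact ⟨i.symm.toAlgHom.comp (IsScalarTower.toAlgHom k _ κ)⟩

/-- Étale coordinates `x i` of the base and the dual fibre coordinates are coordinates of the tangent
space of the cotangent bundle. -/
theorem isTangentChart (c : EtaleCoordinates k Γ(X, U.1) n) (he : e ∈ (chart k U) ''ᵁ ⊤)
    (ev : (cotangentBundle k X).presheaf.stalk e →ₐ[k] k) :
    IsTangentChart ev (fun i => baseGerm he (c.x i)) fun i => fieldGerm he (c.partialDeriv i) := by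
  intro D hD h0
  have h1 (i : Fin n) : D (baseGerm he (c.x i)) = 0 := congrFun (congrArg Prod.fst h0) i
  have h2 (i : Fin n) : D (fieldGerm he (c.partialDeriv i)) = 0 := by
    refine Eq.trans ?_ (congrArg (fun v => v.2 (Pi.single i 1)) h0)
    exact (coords_snd_single (fun i => baseGerm he (c.x i))
      (fun i => fieldGerm he (c.partialDeriv i)) D i).symm
  have h3 (a : Γ(X, U.1)) : D (baseGerm he a) = 0 := by
    have := c.pointDerivation_apply (comp_mem_pointDerivations (baseGerm he) hD) a
    refine this.trans (Finset.sum_eq_zero fun i _ => ?_)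
    rw [LinearMap.comp_apply, AlgHom.toLinearMap_apply, h1, mul_zero]
  have h4 (θ : VectorField k X U.1) : D (fieldGerm he θ) = 0 := by
    rw [fieldGerm_eq_sum c, map_sum]
    exact Finset.sum_eq_zero fun i _ => by rw [hD, h2, h3, mul_zero, mul_zero, add_zero]
  refine eq_zero_of_mem_pointDerivations hD (germAt k U he) (exists_mul_germAt_eq he) fun a => ?_
  induction a using SymmetricAlgebra.induction with
  | algebraMap a => exact h3 a
  | ι θ => exact h4 θ
  | mul a b ha hb => rw [map_mul, hD, ha, hb, mul_zero, mul_zero, add_zero]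
  | add a b ha hb => rw [map_add, map_add, ha, hb, add_zero]

end SmoothScheme

/-! ### Sections of the cotangent bundle -/

namespace SmoothScheme

open PointDerivation IsLocalRing

variable {k : Type u} [Field k] {X : Scheme.{u}} [X.Over (Spec (.of k))]
  [Smooth (X ↘ Spec (.of k))] {U : X.AffineZariskiSite} {n : ℕ} {e : cotangentBundle k X}

omit [Smooth (X ↘ Spec (.of k))] in
theorem pullbackDifferential_algebraMap (f a : Γ(X, U.1)) :
    pullbackDifferential k U f (algebraMap _ _ a) = a :=
  (pullbackDifferential k U f).commutes a

omit [Smooth (X ↘ Spec (.of k))] in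
theorem pullbackDifferential_ι (f : Γ(X, U.1)) (θ : VectorField k X U.1) :
    pullbackDifferential k U f (SymmetricAlgebra.ι _ _ θ) = θ f :=
  SymmetricAlgebra.lift_ι_apply _ _

/-- The pullback of germs along a section `df` through `e`. -/
theorem exists_pullback (he : e ∈ (chart k U) ''ᵁ ⊤) {f : Γ(X, U.1)} {y : Spec Γ(X, U.1)}
    (h : differential k U f y = e) :
    ∃ ρ : (cotangentBundle k X).presheaf.stalk e →+* (Spec Γ(X, U.1)).presheaf.stalk y,
      IsLocalHom ρ ∧
      (∀ a, ρ (germAt k U he a) = (specGerm _ y).hom (pullbackDifferential k U f a)) ∧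
      ∀ C, intersectionIndex C (differential k U f) y =
        Module.length ((Spec Γ(X, U.1)).presheaf.stalk y)
          ((Spec Γ(X, U.1)).presheaf.stalk y ⧸ (idealAt C e).map ρ) := by
  subst h
  exact ⟨((differential k U f).stalkMap y).hom, inferInstance, differential_comp k U f y he,
    fun C => rfl⟩

theorem isUnit_baseGerm (he : e ∈ (chart k U) ''ᵁ ⊤) {f : Γ(X, U.1)} {y : Spec Γ(X, U.1)}
    (h : differential k U f y = e) {b : Γ(X, U.1)} (hb : IsUnit ((specGerm _ y).hom b)) :
    IsUnit (baseGerm he b) := by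
  obtain ⟨ρ, _, hρ, -⟩ := exists_pullback he h
  apply IsUnit.of_map ρ
  have h1 : ρ (baseGerm he b) = (specGerm _ y).hom b :=
    (hρ (algebraMap _ _ b)).trans (congrArg _ (pullbackDifferential_algebraMap f b))
  exact h1 ▸ hb

/-- The local data at the point `e` of all sections `df` through `e`. -/
theorem exists_isSectionAt (c : EtaleCoordinates k Γ(X, U.1) n) (he : e ∈ (chart k U) ''ᵁ ⊤)
    (ev : (cotangentBundle k X).presheaf.stalk e →ₐ[k] k) {f₀ : Γ(X, U.1)} {y : Spec Γ(X, U.1)}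
    (h₀ : differential k U f₀ y = e) :
    ∃ (A : Type u) (_ : CommRing A) (_ : Algebra k A) (_ : IsLocalRing A) (_ : IsNoetherianRing A)
      (β : Γ(X, U.1) →ₐ[k] A) (s : A →ₐ[k] (cotangentBundle k X).presheaf.stalk e),
      (∀ a, s (β a) = baseGerm he a) ∧ ∀ f, differential k U f y = e →
        ∃ ρ : (cotangentBundle k X).presheaf.stalk e →ₐ[k] A,
          IsSectionAt c f (fun i => baseGerm he (c.x i)) (fun i => fieldGerm he (c.partialDeriv i))
            (ev.comp s) β ρ s ∧
          ∀ C, intersectionIndex C (differential k U f) y =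
            Module.length A (A ⧸ (idealAt C e).map ρ) := by
  let A := (Spec Γ(X, U.1)).presheaf.stalk y
  let _ : Algebra k A := ((specGerm _ y).hom.comp (algebraMap k Γ(X, U.1))).toAlgebra
  have := finiteType_sections (k := k) U.2
  have : IsNoetherianRing Γ(X, U.1) := Algebra.FiniteType.isNoetherianRing k _
  have : IsNoetherianRing A := (isGerm_specGerm _ y).isNoetherianRing
  let β : Γ(X, U.1) →ₐ[k] A := { (specGerm _ y).hom with commutes' := fun _ => rfl }
  obtain ⟨s₀, hs₀⟩ := (isGerm_specGerm _ y).exists_lift (baseGerm he).toRingHom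
    fun b hb => isUnit_baseGerm he h₀ hb
  let s : A →ₐ[k] (cotangentBundle k X).presheaf.stalk e :=
    { s₀ with commutes' := fun r => (hs₀ _).trans ((baseGerm he).commutes r) }
  refine ⟨A, inferInstance, inferInstance, inferInstance, inferInstance, β, s, hs₀, fun f hf => ?_⟩
  obtain ⟨ρ₀, -, hρ₀, hC⟩ := exists_pullback he hf
  have hbase (a : Γ(X, U.1)) : ρ₀ (baseGerm he a) = β a :=
    (hρ₀ (algebraMap _ _ a)).trans (congrArg _ (pullbackDifferential_algebraMap f a))
  have hcomm (r : k) : ρ₀ (algebraMap k _ r) = algebraMap k A r := by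
    rw [← (baseGerm he).commutes, hbase, β.commutes]
  let ρ : (cotangentBundle k X).presheaf.stalk e →ₐ[k] A :=
    { ρ₀ with commutes' := hcomm }
  refine ⟨ρ, ⟨fun i => hbase _,
    fun i => (hρ₀ _).trans (congrArg _ (pullbackDifferential_ι f (c.partialDeriv i))),
    fun i => hs₀ _, fun τ hτ h0 => ?_⟩, hC⟩
  · refine eq_zero_of_mem_pointDerivations hτ β (isGerm_specGerm _ y).exists_mul_eq fun a => ?_
    refine (c.pointDerivation_apply (comp_mem_pointDerivations β hτ) a).trans
      (Finset.sum_eq_zero fun i _ => ?_)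
    rw [LinearMap.comp_apply, AlgHom.toLinearMap_apply, h0, mul_zero]

/-- The section `df` passes through `e` if the derivatives of `f` agree with the fibre coordinates
of `e`. -/
theorem exists_point_differential (c : EtaleCoordinates k Γ(X, U.1) n)
    (he : e ∈ (chart k U) ''ᵁ ⊤) (ev : (cotangentBundle k X).presheaf.stalk e →ₐ[k] k) :
    ∃ y : Spec Γ(X, U.1), ∀ f : Γ(X, U.1),
      (∀ i, ev (baseGerm he (c.partialDeriv i f)) = ev (fieldGerm he (c.partialDeriv i))) →
      differential k U f y = e := by
  obtain ⟨p, rfl, hmem⟩ := exists_closedPoint he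
  refine ⟨Spec.map (CommRingCat.ofHom (algebraMap Γ(X, U.1) (FunctionRing k X U.1))) p,
    fun f hf => ?_⟩
  have hmem' (a : FunctionRing k X U.1) : a ∈ p.asIdeal ↔ ev (germAt k U he a) = 0 := by
    rw [hmem, isUnit_iff ev, not_not]
  have h1 : (ev.toRingHom.comp (germAt k U he)).comp ((algebraMap _ _).comp
      (pullbackDifferential k U f).toRingHom) = ev.toRingHom.comp (germAt k U he) := by
    refine sym_ringHom_ext (fun a => ?_) fun θ => ?_
    · exact congrArg (fun b => ev (baseGerm he b)) (pullbackDifferential_algebraMap f a)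
    · refine Eq.trans (congrArg (fun b => ev (baseGerm he b)) (pullbackDifferential_ι f θ)) ?_
      change ev (baseGerm he (θ f)) = ev (fieldGerm he θ)
      rw [c.derivation_apply θ f, fieldGerm_eq_sum c]
      simp only [map_sum]
      exact Finset.sum_congr rfl fun i _ => by
        rw [smul_eq_mul, mul_comm, map_mul, map_mul, hf i, map_mul]
  have h2 : Spec.map (CommRingCat.ofHom (pullbackDifferential k U f).toRingHom)
      (Spec.map (CommRingCat.ofHom (algebraMap Γ(X, U.1) (FunctionRing k X U.1))) p) = p := by
    refine PrimeSpectrum.ext (Ideal.ext fun a => ?_)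
    change algebraMap _ _ ((pullbackDifferential k U f).toRingHom a) ∈ p.asIdeal ↔ _
    rw [hmem', hmem']
    have := congrArg (fun φ => φ a) h1
    exact Eq.congr_left this
  exact congrArg (chart k U) h2

end SmoothScheme

/-! ### Tangent spaces of the cotangent bundle, and the canonical quadratic form -/

namespace SmoothScheme

open PointDerivation IsLocalRing Module

section ResidueField

variable {k S : Type*} [Field k] [CommRing S] [Algebra k S] [IsLocalRing S]

/-- The evaluation at a rational point identifies the residue field with the base field. -/
noncomputable def residueEquiv (ev : S →ₐ[k] k) : k ≃ₐ[k] ResidueField S :=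
  AlgEquiv.ofBijective (Algebra.ofId k (ResidueField S)) (bijective_algebraMap_residueField ev)

theorem residueEquiv_ev (ev : S →ₐ[k] k) (a : S) : residueEquiv ev (ev a) = residue S a := by
  have := (residue_eq_zero_iff _).2 (sub_mem_maximalIdeal ev a)
  rw [map_sub, sub_eq_zero] at this
  exact this.symm

/-- Derivations with values in the residue field as point derivations. -/
noncomputable def toPoint (ev : S →ₐ[k] k) :
    Derivation k S (ResidueField S) →ₗ[k] (S →ₗ[k] k) where
  toFun w :=
    { toFun := fun a => (residueEquiv ev).symm (w a)
      map_add' := fun a b => by rw [map_add, map_add]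
      map_smul' := fun r a => by
        rw [Derivation.map_smul, map_smul, RingHom.id_apply] }
  map_add' v w := LinearMap.ext fun a => map_add (residueEquiv ev).symm (v a) (w a)
  map_smul' r w := LinearMap.ext fun a => map_smul (residueEquiv ev).symm r (w a)

theorem residueEquiv_toPoint (ev : S →ₐ[k] k) (w : Derivation k S (ResidueField S)) (a : S) :
    residueEquiv ev (toPoint ev w a) = w a :=
  (residueEquiv ev).apply_symm_apply (w a)

theorem toPoint_eq_iff (ev : S →ₐ[k] k) (w : Derivation k S (ResidueField S)) (a : S) (r : k) :
    toPoint ev w a = r ↔ w a = residueEquiv ev r := by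
  rw [← residueEquiv_toPoint ev w, (residueEquiv ev).injective.eq_iff]

theorem toPoint_mem (ev : S →ₐ[k] k) (w : Derivation k S (ResidueField S)) :
    toPoint ev w ∈ pointDerivations ev := by
  intro a b
  apply (residueEquiv ev).injective
  simp only [map_add, map_mul, residueEquiv_toPoint, residueEquiv_ev, Derivation.leibniz]
  rfl

theorem exists_toPoint_eq (ev : S →ₐ[k] k) {D : S →ₗ[k] k} (hD : D ∈ pointDerivations ev) :
    ∃ w, toPoint ev w = D := by
  refine ⟨Derivation.mk' ((residueEquiv ev).toLinearMap ∘ₗ D) fun a b => ?_,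
    LinearMap.ext fun a => (residueEquiv ev).symm_apply_apply (D a)⟩
  simp only [LinearMap.comp_apply, AlgEquiv.toLinearMap_apply, hD a b, map_add, map_mul,
    residueEquiv_ev]
  rfl

end ResidueField

theorem finrank_map_eq_of_ker_eq {k M M₁ M₂ : Type*} [Field k] [AddCommGroup M] [Module k M]
    [AddCommGroup M₁] [Module k M₁] [AddCommGroup M₂] [Module k M₂] (V : Submodule k M)
    (f : M →ₗ[k] M₁) (g : M →ₗ[k] M₂) (h : ∀ v ∈ V, f v = 0 ↔ g v = 0) :
    finrank k (V.map f) = finrank k (V.map g) := by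
  have hker : LinearMap.ker (f ∘ₗ V.subtype) = LinearMap.ker (g ∘ₗ V.subtype) := by
    ext v
    exact h v v.2
  have hf : V.map f = LinearMap.range (f ∘ₗ V.subtype) := by
    rw [LinearMap.range_comp, Submodule.range_subtype]
  have hg : V.map g = LinearMap.range (g ∘ₗ V.subtype) := by
    rw [LinearMap.range_comp, Submodule.range_subtype]
  rw [hf, hg, ← (f ∘ₗ V.subtype).quotKerEquivRange.finrank_eq,
    ← (g ∘ₗ V.subtype).quotKerEquivRange.finrank_eq, hker]

section Tangent

variable {k : Type u} [Field k] {X : Scheme.{u}} [X.Over (Spec (.of k))]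
  [Smooth (X ↘ Spec (.of k))] {U : X.AffineZariskiSite} {n : ℕ} {e : cotangentBundle k X}
  (c : EtaleCoordinates k Γ(X, U.1) n) (he : e ∈ (chart k U) ''ᵁ ⊤)
  (ev : (cotangentBundle k X).presheaf.stalk e →ₐ[k] k)

/-- The coordinates of the tangent vectors of `C` at `e`. -/
noncomputable def tangentCoords (C : Set (cotangentBundle k X)) :
    Submodule k ((Fin n → k) × Dual k (Fin n → k)) :=
  (killing ev (idealAt C e)).map
    (coords (fun i => baseGerm he (c.x i)) fun i => fieldGerm he (c.partialDeriv i))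

theorem map_toPoint_tangentSubspace (C : Set (cotangentBundle k X)) :
    (tangentSubspace k C e).map (toPoint ev) = killing ev (idealAt C e) := by
  ext D
  constructor
  · rintro ⟨w, hw, rfl⟩
    exact ⟨toPoint_mem ev w, fun a ha => (toPoint_eq_iff ev w a 0).2 (by rw [map_zero, hw a ha])⟩
  · rintro ⟨hD, h0⟩
    obtain ⟨w, rfl⟩ := exists_toPoint_eq ev hD
    exact ⟨w, fun a ha => by
      rw [(toPoint_eq_iff ev w a 0).1 (h0 a ha), map_zero], rfl⟩

theorem tangentProj_eq_zero_iff (w : TangentSpaceAt k (cotangentBundle k X) e) :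
    tangentProj k e w = 0 ↔ ∀ i, toPoint ev w (baseGerm he (c.x i)) = 0 := by
  have hgerm (a : Γ(X, U.1)) := stalkMap_proj_germ k he a
  constructor
  · intro h i
    rw [toPoint_eq_iff, map_zero]
    exact (congrArg w (hgerm (c.x i))).symm.trans (congrFun h _)
  · intro h
    have hD := toPoint_mem ev w
    have h0 (a : Γ(X, U.1)) : toPoint ev w (baseGerm he a) = 0 := by
      refine (c.pointDerivation_apply (comp_mem_pointDerivations (baseGerm he) hD) a).trans
        (Finset.sum_eq_zero fun i _ => ?_)
      rw [LinearMap.comp_apply, AlgHom.toLinearMap_apply, h, mul_zero]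
    funext g
    obtain ⟨a, b, hb, hg⟩ := (isGerm_germ U.2 ((mem_image_chart_iff k).1 he)).exists_mul_eq g
    have h1 := congrArg ((proj k X).stalkMap e).hom hg
    rw [map_mul] at h1
    have h2 : ((proj k X).stalkMap e).hom g * baseGerm he b = baseGerm he a :=
      (congrArg (_ * ·) (hgerm b)).symm.trans (h1.trans (hgerm a))
    have h3 : IsUnit (baseGerm he b) := (hgerm b) ▸ hb.map ((proj k X).stalkMap e).hom
    have h4 := hD (((proj k X).stalkMap e).hom g) (baseGerm he b)
    rw [h2, h0, h0, mul_zero, zero_add] at h4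
    have h5 := (mul_eq_zero.1 h4.symm).resolve_left (h3.map ev).ne_zero
    rw [toPoint_eq_iff, map_zero] at h5
    exact h5

theorem projRank_eq (C : Set (cotangentBundle k X)) : projRank k C e =
    finrank k ((tangentCoords c he ev C).map (LinearMap.fst k (Fin n → k) _)) := by
  rw [tangentCoords, ← map_toPoint_tangentSubspace, ← Submodule.map_comp, ← Submodule.map_comp]
  refine finrank_map_eq_of_ker_eq _ _ _ fun w _ => ?_
  rw [tangentProj_eq_zero_iff c he ev]
  exact funext_iff.symm

theorem finrank_tangentCoords (C : Set (cotangentBundle k X)) :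
    finrank k (tangentCoords c he ev C) = finrank k (killing ev (idealAt C e)) := by
  let f := (coords (fun i => baseGerm he (c.x i)) fun i => fieldGerm he (c.partialDeriv i)) ∘ₗ
    (killing ev (idealAt C e)).subtype
  have hf : Function.Injective f := fun D D' h =>
    Subtype.ext ((isTangentChart c he ev).eq_of_coords_eq D.2.1 D'.2.1 h)
  have h : tangentCoords c he ev C = LinearMap.range f := by
    rw [LinearMap.range_comp, Submodule.range_subtype]; rfl
  rw [h]
  exact (LinearEquiv.ofInjective f hf).finrank_eq.symm

theorem isKappaValue_iff (w : TangentSpaceAt k (cotangentBundle k X) e) (r : k) :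
    IsKappaValue k w (residueEquiv ev r) ↔
      ∃ (U : X.AffineZariskiSite) (he : e ∈ (chart k U) ''ᵁ ⊤) (f g : Γ(X, U.1)),
        (∀ θ : VectorField k X U.1, ev (fieldGerm he θ) = ev (baseGerm he (θ f))) ∧
        (∀ θ : VectorField k X U.1, toPoint ev w (fieldGerm he θ) =
          ev (baseGerm he (θ g)) + toPoint ev w (baseGerm he (θ f))) ∧
        r = toPoint ev w (baseGerm he g) := by
  refine exists_congr fun U => exists_congr fun he => exists_congr fun f => exists_congr fun g =>
    and_congr (forall_congr' fun θ => ?_) (and_congr (forall_congr' fun θ => ?_) ?_)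
  · rw [← (residueEquiv ev).injective.eq_iff, residueEquiv_ev, residueEquiv_ev]
    rfl
  · rw [← (residueEquiv ev).injective.eq_iff, map_add, residueEquiv_toPoint, residueEquiv_toPoint,
      residueEquiv_ev]
    rfl
  · rw [← (residueEquiv ev).injective.eq_iff, residueEquiv_toPoint]
    rfl

end Tangent

end SmoothScheme

/-! ### Change of charts -/

namespace SmoothScheme

open PointDerivation IsLocalRing Module

section Restrict

variable {k : Type u} [Field k] {X : Scheme.{u}} [X.Over (Spec (.of k))]

/-- Two affine open neighbourhoods of a point contain a common basic open neighbourhood. -/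
theorem exists_hom_hom (U V : X.AffineZariskiSite) {x : X} (hU : x ∈ U.1) (hV : x ∈ V.1) :
    ∃ (W : X.AffineZariskiSite) (_ : W ⟶ U) (_ : W ⟶ V), x ∈ W.1 := by
  obtain ⟨f, g, e, hx⟩ := exists_basicOpen_le_affine_inter U.2 V.2 x ⟨hU, hV⟩
  exact ⟨U.basicOpen f, homOfLE (U.basicOpen_le f),
    eqToHom (Subtype.ext (by exact e)) ≫ homOfLE (V.basicOpen_le g), hx⟩

/-- The restriction of étale coordinates to a smaller affine open. -/
noncomputable def restrictCoordinates {U V : X.AffineZariskiSite} (i : V ⟶ U) {n : ℕ}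
    (c : EtaleCoordinates k Γ(X, U.1) n) : EtaleCoordinates k Γ(X, V.1) n :=
  letI : Algebra Γ(X, U.1) Γ(X, V.1) := (res i).toAlgebra
  haveI := isScalarTower_res k i
  haveI := formallyEtale_res i
  c.restrict

variable [Smooth (X ↘ Spec (.of k))] {U V : X.AffineZariskiSite} (i : V ⟶ U)
  {e : cotangentBundle k X} (he : e ∈ (chart k U) ''ᵁ ⊤) (he' : e ∈ (chart k V) ''ᵁ ⊤)

theorem baseGerm_res (a : Γ(X, U.1)) : baseGerm he' (res i a) = baseGerm he a :=
  (congrArg (germAt k V he') (restrictFunction_algebraMap k i a).symm).trans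
    (germAt_restrictFunction k i he he' _)

theorem baseGerm_restrictCoordinates_x {n : ℕ} (c : EtaleCoordinates k Γ(X, U.1) n) (j : Fin n) :
    baseGerm he' ((restrictCoordinates i c).x j) = baseGerm he (c.x j) :=
  baseGerm_res i he he' _

theorem fieldGerm_restrictField (θ : VectorField k X U.1) :
    letI : Algebra Γ(X, U.1) Γ(X, V.1) := (res i).toAlgebra
    haveI := isScalarTower_res k i
    haveI := formallyEtale_res i
    fieldGerm he' (restrictField k Γ(X, U.1) Γ(X, V.1) θ) = fieldGerm he θ := by
  let _ : Algebra Γ(X, U.1) Γ(X, V.1) := (res i).toAlgebra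
  have := isScalarTower_res k i
  have := formallyEtale_res i
  rw [fieldGerm, fieldGerm, ← germAt_restrictFunction k i he he']
  exact congrArg _ (symMap_ι _ θ).symm

theorem fieldGerm_restrictCoordinates {n : ℕ} (c : EtaleCoordinates k Γ(X, U.1) n) (j : Fin n) :
    fieldGerm he' ((restrictCoordinates i c).partialDeriv j) = fieldGerm he (c.partialDeriv j) :=
  fieldGerm_restrictField i he he' _

theorem tangentCoords_restrictCoordinates {n : ℕ} (c : EtaleCoordinates k Γ(X, U.1) n)
    (ev : (cotangentBundle k X).presheaf.stalk e →ₐ[k] k) (C : Set (cotangentBundle k X)) :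
    tangentCoords (restrictCoordinates i c) he' ev C = tangentCoords c he ev C := by
  simp only [tangentCoords, baseGerm_restrictCoordinates_x i he he',
    fieldGerm_restrictCoordinates i he he']

theorem fieldGerm_smul (a : Γ(X, U.1)) (θ : VectorField k X U.1) :
    fieldGerm he (a • θ) = baseGerm he a * fieldGerm he θ := by
  rw [fieldGerm, map_smul, Algebra.smul_def, map_mul]
  rfl

theorem fieldGerm_add (θ θ' : VectorField k X U.1) :
    fieldGerm he (θ + θ') = fieldGerm he θ + fieldGerm he θ' := by
  rw [fieldGerm, map_add, map_add]
  rfl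

/-- The conditions in the definition of `κ` are compatible with the restriction to a smaller
affine open, since the vector fields of the latter are generated by restrictions. -/
theorem kappa_conditions_res (ev : (cotangentBundle k X).presheaf.stalk e →ₐ[k] k)
    {D : (cotangentBundle k X).presheaf.stalk e →ₗ[k] k} (hD : D ∈ pointDerivations ev)
    {f g : Γ(X, U.1)} (h1 : ∀ θ : VectorField k X U.1, ev (fieldGerm he θ) = ev (baseGerm he (θ f)))
    (h2 : ∀ θ : VectorField k X U.1, D (fieldGerm he θ) =
      ev (baseGerm he (θ g)) + D (baseGerm he (θ f))) (θ : VectorField k X V.1) :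
    ev (fieldGerm he' θ) = ev (baseGerm he' (θ (res i f))) ∧
      D (fieldGerm he' θ) = ev (baseGerm he' (θ (res i g))) + D (baseGerm he' (θ (res i f))) := by
  let _ : Algebra Γ(X, U.1) Γ(X, V.1) := (res i).toAlgebra
  have := isScalarTower_res k i
  have := formallyEtale_res i
  induction θ using (isBaseChange_restrictField_res k i).inductionOn with
  | zero =>
    have h0 : fieldGerm he' (0 : VectorField k X V.1) = 0 := by rw [fieldGerm, map_zero, map_zero]
    simp only [h0, Derivation.zero_apply, map_zero, add_zero, and_self]
  | tmul θ =>
    have hr (a : Γ(X, U.1)) : restrictField k Γ(X, U.1) Γ(X, V.1) θ (res i a) = res i (θ a) :=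
      restrictField_algebraMap θ a
    rw [fieldGerm_restrictField i he he', hr, hr, baseGerm_res i he he', baseGerm_res i he he']
    exact ⟨h1 θ, h2 θ⟩
  | smul b θ hθ =>
    have hm (a b : (cotangentBundle k X).presheaf.stalk e) :
        D (a * b) = ev a * D b + ev b * D a := hD a b
    simp only [fieldGerm_smul, Derivation.smul_apply, smul_eq_mul, map_mul, hm, hθ.1, hθ.2,
      true_and]
    ring
  | add θ θ' hθ hθ' =>
    simp only [fieldGerm_add, Derivation.add_apply, map_add, hθ.1, hθ.2, hθ'.1, hθ'.2, true_and]
    ring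

end Restrict

section Kappa

variable {k : Type u} [Field k] {X : Scheme.{u}} [X.Over (Spec (.of k))]
  [Smooth (X ↘ Spec (.of k))] {U : X.AffineZariskiSite} {n : ℕ} {e : cotangentBundle k X}
  (c : EtaleCoordinates k Γ(X, U.1) n) (he : e ∈ (chart k U) ''ᵁ ⊤)
  (ev : (cotangentBundle k X).presheaf.stalk e →ₐ[k] k)

theorem apply_baseGerm {D : (cotangentBundle k X).presheaf.stalk e →ₗ[k] k}
    (hD : D ∈ pointDerivations ev) (a : Γ(X, U.1)) : D (baseGerm he a) =
      ∑ i, ev (baseGerm he (c.partialDeriv i a)) * D (baseGerm he (c.x i)) :=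
  c.pointDerivation_apply (comp_mem_pointDerivations (baseGerm he) hD) a

/-- The function `f` contributes the term `H(u, u)` to `κ`, where `H` is its Hessian; this
vanishes in characteristic two. -/
theorem kappa_eq_sum_of_conditions (h2 : (2 : k) = 0)
    {D : (cotangentBundle k X).presheaf.stalk e →ₗ[k] k} (hD : D ∈ pointDerivations ev)
    {f g : Γ(X, U.1)} (h : ∀ θ : VectorField k X U.1, D (fieldGerm he θ) =
      ev (baseGerm he (θ g)) + D (baseGerm he (θ f))) :
    D (baseGerm he g) = ∑ i, D (fieldGerm he (c.partialDeriv i)) * D (baseGerm he (c.x i)) := by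
  have h0 := hessian_self c (ev.comp (baseGerm he)) f h2 fun i => D (baseGerm he (c.x i))
  rw [hessian_apply, Finset.sum_comm] at h0
  simp only [h, add_mul, Finset.sum_add_distrib, apply_baseGerm c he ev hD (c.partialDeriv _ f),
    Finset.sum_mul]
  rw [apply_baseGerm c he ev hD g]
  exact (add_zero _).symm.trans (congrArg (_ + ·) h0.symm)

/-- In characteristic two, `κ(w) = ∑ w(ξ i) w(x i)`. -/
theorem eq_sum_of_isKappaValue (h2 : (2 : k) = 0) {w : TangentSpaceAt k (cotangentBundle k X) e}
    {r : k} (h : IsKappaValue k w (residueEquiv ev r)) : r =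
      ∑ i, toPoint ev w (fieldGerm he (c.partialDeriv i)) * toPoint ev w (baseGerm he (c.x i)) := by
  obtain ⟨U', he', f, g, hf, hg, rfl⟩ := (isKappaValue_iff ev w r).1 h
  obtain ⟨V, i, j, hV⟩ := exists_hom_hom U U' ((mem_image_chart_iff k).1 he)
    ((mem_image_chart_iff k).1 he')
  replace hV := (mem_image_chart_iff k).2 hV
  have hD := toPoint_mem ev w
  have := kappa_eq_sum_of_conditions (restrictCoordinates i c) hV ev h2 hD
    fun θ => (kappa_conditions_res j he' hV ev hD hf hg θ).2
  simpa only [baseGerm_restrictCoordinates_x i he hV, fieldGerm_restrictCoordinates i he hV,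
    baseGerm_res j he' hV] using this

theorem isKappaValue_sum (w : TangentSpaceAt k (cotangentBundle k X) e) :
    IsKappaValue k w (residueEquiv ev (∑ i, toPoint ev w (fieldGerm he (c.partialDeriv i)) *
      toPoint ev w (baseGerm he (c.x i)))) := by
  rw [isKappaValue_iff]
  have hD := toPoint_mem ev w
  generalize toPoint ev w = D at hD ⊢
  have hm (a b : (cotangentBundle k X).presheaf.stalk e) :
      D (a * b) = ev a * D b + ev b * D a := hD a b
  let evB := ev.comp (baseGerm he)
  let f := testFunction c evB (fun i => ev (fieldGerm he (c.partialDeriv i))) 0 0 0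
  let g := testFunction c evB (fun i => D (fieldGerm he (c.partialDeriv i))) 0 0 0
  have hf (i : Fin n) : ev (baseGerm he (c.partialDeriv i f)) =
      ev (fieldGerm he (c.partialDeriv i)) := ev_partialDeriv_testFunction c evB _ _ _ _ i
  have hg (i : Fin n) : ev (baseGerm he (c.partialDeriv i g)) =
      D (fieldGerm he (c.partialDeriv i)) := ev_partialDeriv_testFunction c evB _ _ _ _ i
  have hff (i : Fin n) : c.partialDeriv i f =
      algebraMap k _ (ev (fieldGerm he (c.partialDeriv i))) := by
    simp [f, partialDeriv_testFunction]
  have hDf (i : Fin n) : D (baseGerm he (c.partialDeriv i f)) = 0 := by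
    rw [hff, AlgHom.commutes, apply_algebraMap hD]
  refine ⟨U, he, f, g, fun θ => ?_, fun θ => ?_, ?_⟩
  · rw [fieldGerm_eq_sum c, c.derivation_apply θ f]
    simp only [map_sum]
    exact Finset.sum_congr rfl fun i _ => by
      rw [smul_eq_mul, map_mul, map_mul, map_mul, hf, mul_comm]
  · rw [fieldGerm_eq_sum c, c.derivation_apply θ f, c.derivation_apply θ g]
    simp only [map_sum, ← Finset.sum_add_distrib]
    refine Finset.sum_congr rfl fun i _ => ?_
    simp only [smul_eq_mul, map_mul, hm, hg, hf, hDf]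
    ring
  · rw [apply_baseGerm c he ev hD g]
    simp only [hg]

/-- In characteristic two, the tangent space of `C` is isotropic for `κ` if and only if the
quadratic form `(u, η) ↦ η(u)` vanishes on the coordinates of its vectors. -/
theorem isKappaIsotropic_iff (h2 : (2 : k) = 0) (C : Set (cotangentBundle k X)) :
    IsKappaIsotropic k C e ↔ ∀ v ∈ tangentCoords c he ev C, v.2 v.1 = 0 := by
  have h0 : residueEquiv ev 0 = 0 := map_zero _
  have hsum (D : (cotangentBundle k X).presheaf.stalk e →ₗ[k] k) :
      (coords (fun i => baseGerm he (c.x i)) (fun i => fieldGerm he (c.partialDeriv i)) D).2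
        (coords (fun i => baseGerm he (c.x i)) (fun i => fieldGerm he (c.partialDeriv i)) D).1 =
      ∑ i, D (fieldGerm he (c.partialDeriv i)) * D (baseGerm he (c.x i)) := coords_snd _ _ _ _
  rw [tangentCoords, ← map_toPoint_tangentSubspace]
  constructor
  · rintro h _ ⟨_, ⟨w, hw, rfl⟩, rfl⟩
    rw [hsum]
    have := h w hw
    rw [← h0] at this
    exact (eq_sum_of_isKappaValue c he ev h2 this).symm
  · intro h w hw
    have := isKappaValue_sum c he ev w
    rwa [← hsum, h _ ⟨_, ⟨w, hw, rfl⟩, rfl⟩, h0] at this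

end Kappa

end SmoothScheme

/-! ### Restriction of sections to smaller open subsets -/

namespace SmoothScheme

open IsLocalRing

theorem length_quotient_map_ringEquiv {A B : Type*} [CommRing A] [CommRing B] (φ : A ≃+* B)
    (I : Ideal A) : Module.length B (B ⧸ I.map (φ : A →+* B)) = Module.length A (A ⧸ I) := by
  let _ := (φ : A →+* B).toAlgebra
  rw [← Module.length_eq_of_surjective (R := B) (S := A) (M := B ⧸ I.map (φ : A →+* B)) φ.surjective]
  let e : (A ⧸ I) ≃+* (B ⧸ I.map (φ : A →+* B)) := Ideal.quotientEquiv I _ φ rfl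
  let e' : (A ⧸ I) ≃ₗ[A] (B ⧸ I.map (φ : A →+* B)) :=
    { e with
      map_smul' := fun a x => by
        obtain ⟨x, rfl⟩ := Ideal.Quotient.mk_surjective x
        change e (Ideal.Quotient.mk I (a * x)) = Ideal.Quotient.mk _ (φ a * φ x)
        simp [e] }
  exact e'.length_eq.symm

/-- Intersection numbers are local on the section. -/
theorem intersectionIndex_comp {E S T : Scheme.{u}} (C : Set E) (r : T ⟶ S) [IsOpenImmersion r]
    (σ : S ⟶ E) (y : T) : intersectionIndex C (r ≫ σ) y = intersectionIndex C σ (r y) := by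
  let φ : S.presheaf.stalk (r y) ≃+* T.presheaf.stalk y :=
    (asIso (r.stalkMap y)).commRingCatIsoToRingEquiv
  have h1 : ((r ≫ σ).stalkMap y).hom =
      (φ : S.presheaf.stalk (r y) →+* T.presheaf.stalk y).comp (σ.stalkMap (r y)).hom := by
    rw [Scheme.Hom.stalkMap_comp]; rfl
  have h2 := length_quotient_map_ringEquiv φ
    ((idealAt C (σ (r y))).map (σ.stalkMap (r y)).hom)
  rw [Ideal.map_map, ← h1] at h2
  exact h2

variable {k : Type u} [Field k] {X : Scheme.{u}} [X.Over (Spec (.of k))]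

instance isOpenImmersion_res {U V : X.AffineZariskiSite} (i : V ⟶ U) :
    IsOpenImmersion (Spec.map (CommRingCat.ofHom (res i))) := by
  obtain ⟨r, hr⟩ := exists_isLocalization i
  let _ : Algebra Γ(X, U.1) Γ(X, V.1) := (res i).toAlgebra
  exact IsOpenImmersion.of_isLocalization r

theorem pullbackDifferential_restrictFunction {U V : X.AffineZariskiSite} (i : V ⟶ U)
    (f : Γ(X, U.1)) (a : FunctionRing k X U.1) :
    pullbackDifferential k V (res i f) (restrictFunction k i a) =
      res i (pullbackDifferential k U f a) := by
  have : ((pullbackDifferential k V (res i f)).toRingHom).comp (restrictFunction k i) =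
      (res i).comp (pullbackDifferential k U f).toRingHom := by
    refine sym_ringHom_ext (fun a => ?_) fun θ => ?_
    · refine (congrArg (pullbackDifferential k V (res i f)) (restrictFunction_algebraMap k i a)).trans
        ((pullbackDifferential_algebraMap _ _).trans ?_)
      exact congrArg (res i) (pullbackDifferential_algebraMap f a).symm
    · obtain ⟨θ', h, e⟩ := exists_restrictFunction_ι k i θ
      refine (congrArg (pullbackDifferential k V (res i f)) e).trans
        ((pullbackDifferential_ι _ _).trans ((h f).trans ?_))
      exact congrArg (res i) (pullbackDifferential_ι f θ).symm
  exact congrArg (fun φ => φ a) this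

theorem res_comp_fromSpec {U V : X.AffineZariskiSite} (i : V ⟶ U) :
    Spec.map (CommRingCat.ofHom (res i)) ≫ U.2.fromSpec = V.2.fromSpec :=
  U.2.map_fromSpec V.2 _

variable [Smooth (X ↘ Spec (.of k))] {e : cotangentBundle k X}

theorem res_comp_differential {U V : X.AffineZariskiSite} (i : V ⟶ U) (f : Γ(X, U.1)) :
    Spec.map (CommRingCat.ofHom (res i)) ≫ differential k U f = differential k V (res i f) := by
  rw [differential, differential, chart_comp k i, ← Spec.map_comp_assoc, ← Spec.map_comp_assoc]
  congr 2
  exact CommRingCat.hom_ext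
    (RingHom.ext fun a => (pullbackDifferential_restrictFunction i f a).symm)

theorem exists_restrict_differential {U V : X.AffineZariskiSite} (i : V ⟶ U)
    (he : e ∈ (chart k V) ''ᵁ ⊤) {f : Γ(X, U.1)} {y : Spec Γ(X, U.1)}
    (h : differential k U f y = e) : ∃ y' : Spec Γ(X, V.1), differential k V (res i f) y' = e ∧
      ∀ C, intersectionIndex C (differential k V (res i f)) y' =
        intersectionIndex C (differential k U f) y := by
  have h1 : U.2.fromSpec y = proj k X e := by
    rw [← differential_proj k U f, ← h]
    rfl
  obtain ⟨y', hy'⟩ : proj k X e ∈ Set.range V.2.fromSpec := by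
    rw [V.2.range_fromSpec]
    exact (mem_image_chart_iff k).1 he
  have h2 : Spec.map (CommRingCat.ofHom (res i)) y' = y := by
    apply U.2.fromSpec.injective
    rw [h1, ← hy', ← res_comp_fromSpec i]
    rfl
  subst h2
  refine ⟨y', ?_, fun C => ?_⟩
  · rw [← h, ← res_comp_differential]
    rfl
  · rw [← res_comp_differential, intersectionIndex_comp]

end SmoothScheme

/-! ### The dimension of a closed subset in affine charts -/

namespace SmoothScheme

open IsLocalRing PrimeSpectrum TopologicalSpace

section Topology

/-- In a space of finite dimension `n` there is a point all of whose open neighbourhoods have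
dimension at least `n`: any point of the smallest member of a maximal chain. -/
theorem exists_forall_le_topologicalKrullDim {α : Type*} [TopologicalSpace α] {n : ℕ}
    (h : topologicalKrullDim α = n) : ∃ z : α, ∀ {β : Type u} [TopologicalSpace β] (j : β → α),
      Topology.IsOpenEmbedding j → z ∈ Set.range j → (n : WithBot ℕ∞) ≤ topologicalKrullDim β := by
  obtain ⟨l, hl⟩ := Order.le_krullDim_iff.1 (le_of_eq h.symm)
  obtain ⟨z, hz⟩ := l.head.isIrreducible.nonempty
  refine ⟨z, fun j hj hzj => ?_⟩
  obtain ⟨x, rfl⟩ := hzj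
  let Z := (IrreducibleCloseds.orderIsoOfIsOpenEmbedding j hj).symm ⟨l.head, ⟨x, hz⟩⟩
  have hZ : IrreducibleCloseds.map j hj.continuous Z = l.head :=
    congrArg Subtype.val
      ((IrreducibleCloseds.orderIsoOfIsOpenEmbedding j hj).apply_symm_apply ⟨l.head, ⟨x, hz⟩⟩)
  have h1 : (n : ℕ∞) ≤ Order.coheight Z := by
    rw [← hj.coheight_map, hZ, ← hl]
    exact Order.length_le_coheight_head
  exact le_trans (WithBot.coe_le_coe.2 h1) (Order.coheight_le_krullDim Z)

end Topology

section Chart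

variable {E : Scheme.{u}} {R : CommRingCat.{u}} (g : Spec R ⟶ E) (C : Set E)

/-- The ideal of functions on an affine chart that vanish on `C`. -/
noncomputable def chartIdeal : Ideal R := vanishingIdeal (g ⁻¹' C)

variable {g C}

theorem zeroLocus_chartIdeal (hC : IsClosed C) : zeroLocus (chartIdeal g C : Set R) = g ⁻¹' C := by
  rw [chartIdeal, zeroLocus_vanishingIdeal_eq_closure]
  exact (hC.preimage g.continuous).closure_eq

theorem mem_iff_chartIdeal_le (hC : IsClosed C) (p : Spec R) :
    g p ∈ C ↔ chartIdeal g C ≤ p.asIdeal := by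
  change p ∈ g ⁻¹' C ↔ _
  rw [← zeroLocus_chartIdeal hC]
  rfl

theorem isPrime_chartIdeal [IsOpenImmersion g] (hirr : IsIrreducible C) {p : Spec R}
    (hp : g p ∈ C) : (chartIdeal g C).IsPrime := by
  refine isIrreducible_iff_vanishingIdeal_isPrime.1 ⟨⟨p, hp⟩, ?_⟩
  exact hirr.isPreirreducible.preimage g.isOpenEmbedding

theorem exists_isOpenEmbedding [IsOpenImmersion g] (hC : IsClosed C) :
    ∃ j : PrimeSpectrum (R ⧸ chartIdeal g C) → C, Topology.IsOpenEmbedding j ∧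
      ∀ z : C, z.1 ∈ Set.range g → z ∈ Set.range j := by
  let q : PrimeSpectrum (R ⧸ chartIdeal g C) → Spec R :=
    PrimeSpectrum.comap (Ideal.Quotient.mk (chartIdeal g C))
  have hq : Topology.IsClosedEmbedding q :=
    isClosedEmbedding_comap_of_surjective _ _ Ideal.Quotient.mk_surjective
  have hrange : Set.range q = g ⁻¹' C := by
    refine (range_comap_of_surjective _ _ Ideal.Quotient.mk_surjective).trans ?_
    rw [Ideal.mk_ker, zeroLocus_chartIdeal hC]
  have hmem (x : PrimeSpectrum (R ⧸ chartIdeal g C)) : g (q x) ∈ C := by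
    have : q x ∈ g ⁻¹' C := hrange ▸ Set.mem_range_self x
    exact this
  have hsurj (z : C) (hz : z.1 ∈ Set.range g) : z ∈ Set.range fun x => (⟨g (q x), hmem x⟩ : C) := by
    obtain ⟨p, hp⟩ := hz
    obtain ⟨x, rfl⟩ : p ∈ Set.range q := by
      rw [hrange, Set.mem_preimage, hp]
      exact z.2
    exact ⟨x, Subtype.ext hp⟩
  refine ⟨fun x => ⟨g (q x), hmem x⟩, ⟨?_, ?_⟩, hsurj⟩
  · exact (g.isOpenEmbedding.isEmbedding.comp hq.isEmbedding).codRestrict C hmem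
  · have : (Set.range fun x => (⟨g (q x), hmem x⟩ : C)) = Subtype.val ⁻¹' Set.range g := by
      refine Set.Subset.antisymm ?_ hsurj
      rintro _ ⟨x, rfl⟩
      exact ⟨q x, rfl⟩
    rw [this]
    exact g.isOpenEmbedding.isOpen_range.preimage continuous_subtype_val

theorem ringKrullDim_quotient_chartIdeal_le [IsOpenImmersion g] (hC : IsClosed C) :
    ringKrullDim (R ⧸ chartIdeal g C) ≤ topologicalKrullDim C := by
  obtain ⟨j, hj, -⟩ := exists_isOpenEmbedding (g := g) hC
  rw [← topologicalKrullDim_eq_ringKrullDim]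
  exact hj.isInducing.topologicalKrullDim_le

theorem idealAt_eq_map [IsOpenImmersion g] (hC : IsClosed C) (hirr : IsIrreducible C) {e : E}
    (he : e ∈ C) {γ : R ⟶ E.presheaf.stalk e} (hγ : IsGerm g γ) :
    idealAt C e = (chartIdeal g C).map γ.hom := by
  let _ := γ.hom.toAlgebra
  have hloc := hγ.isLocalization
  obtain ⟨p, hp, hp'⟩ := hγ.exists_point
  have hprime : (chartIdeal g C).IsPrime := isPrime_chartIdeal hirr (hp ▸ he)
  have hle : chartIdeal g C ≤ (maximalIdeal (E.presheaf.stalk e)).comap γ.hom := by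
    rw [← hp', ← mem_iff_chartIdeal_le hC, hp]
    exact he
  have hmap : ((chartIdeal g C).map γ.hom).IsPrime :=
    IsLocalization.isPrime_of_isPrime_disjoint
      ((maximalIdeal (E.presheaf.stalk e)).comap γ.hom).primeCompl _ _ hprime
      (Set.disjoint_left.2 fun a ha ha' => ha (hle ha'))
  have h1 : E.fromSpecStalk e ⁻¹' C = zeroLocus ((chartIdeal g C).map γ.hom : Set _) := by
    rw [← hγ]
    change PrimeSpectrum.comap γ.hom ⁻¹' (g ⁻¹' C) = _
    refine Eq.trans (congrArg (PrimeSpectrum.comap γ.hom ⁻¹' ·) (zeroLocus_chartIdeal hC).symm) ?_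
    exact (preimage_comap_zeroLocus _ _).trans (zeroLocus_span _).symm
  exact (congrArg vanishingIdeal h1).trans
    ((vanishingIdeal_zeroLocus_eq_radical _).trans hmap.radical)

/-- At closed points, the dimension of the local ring of `C` is the dimension of `C` in an
affine chart of finite type. -/
theorem ringKrullDim_quotient_idealAt (k : Type*) [Field k] [Algebra k R] [Algebra.FiniteType k R]
    [IsOpenImmersion g] (hC : IsClosed C) (hirr : IsIrreducible C) {e : E} (he : e ∈ C)
    {γ : R ⟶ E.presheaf.stalk e} (hγ : IsGerm g γ)
    (hmax : ((maximalIdeal (E.presheaf.stalk e)).comap γ.hom).IsMaximal) :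
    ringKrullDim (E.presheaf.stalk e ⧸ idealAt C e) = ringKrullDim (R ⧸ chartIdeal g C) := by
  rw [idealAt_eq_map hC hirr he hγ]
  let _ := γ.hom.toAlgebra
  have hloc := hγ.isLocalization
  obtain ⟨p, hp, hp'⟩ := hγ.exists_point
  have hprime : (chartIdeal g C).IsPrime := isPrime_chartIdeal hirr (hp ▸ he)
  have hle : chartIdeal g C ≤ (maximalIdeal (E.presheaf.stalk e)).comap γ.hom := by
    rw [← hp', ← mem_iff_chartIdeal_le hC, hp]
    exact he
  set m := (maximalIdeal (E.presheaf.stalk e)).comap γ.hom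
  let M := m.map (Ideal.Quotient.mk (chartIdeal g C))
  have hcomap : M.comap (Ideal.Quotient.mk (chartIdeal g C)) = m := by
    rw [Ideal.comap_map_of_surjective _ Ideal.Quotient.mk_surjective, ← RingHom.ker_eq_comap_bot,
      Ideal.mk_ker, sup_eq_left.2 hle]
  have hM : M.IsMaximal :=
    hmax.map_of_surjective_of_ker_le Ideal.Quotient.mk_surjective (by rwa [Ideal.mk_ker])
  have hcompl : Algebra.algebraMapSubmonoid (R ⧸ chartIdeal g C) m.primeCompl = M.primeCompl := by
    ext x
    constructor
    · rintro ⟨a, ha, rfl⟩ h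
      exact ha (hcomap ▸ h)
    · intro h
      obtain ⟨a, rfl⟩ := Ideal.Quotient.mk_surjective x
      exact ⟨a, fun ha => h (Ideal.mem_map_of_mem _ ha), rfl⟩
  have hloc' : IsLocalization.AtPrime
      (E.presheaf.stalk e ⧸ (chartIdeal g C).map (algebraMap R (E.presheaf.stalk e))) M := by
    rw [IsLocalization.AtPrime, ← hcompl]
    infer_instance
  change ringKrullDim (E.presheaf.stalk e ⧸
    (chartIdeal g C).map (algebraMap R (E.presheaf.stalk e))) = _
  rw [← FiniteTypeDimension.height_eq_ringKrullDim k M]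
  exact IsLocalization.AtPrime.ringKrullDim_eq_height M _

end Chart

end SmoothScheme

/-! ### Coordinates at every point, and the dimension of the tangent space -/

namespace SmoothScheme

open PointDerivation IsLocalRing Module

variable {k : Type u} [Field k] {X : Scheme.{u}} [X.Over (Spec (.of k))] {n : ℕ}

theorem isStandardSmooth_sections {U : (Spec (.of k)).Opens} {V : X.Opens} {x : X} (hx : x ∈ V)
    (e : V ≤ (X ↘ Spec (.of k)) ⁻¹ᵁ U)
    (h : ((X ↘ Spec (.of k)).appLE U V e).hom.IsStandardSmoothOfRelativeDimension n) :
    Algebra.IsStandardSmoothOfRelativeDimension n k Γ(X, V) := by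
  -- the spectrum of a field has a single point
  obtain rfl : U = ⊤ := by
    refine top_unique fun z _ => ?_
    have hz : z = (X ↘ Spec (.of k)) x := Subsingleton.elim (α := PrimeSpectrum k) _ _
    exact hz ▸ e hx
  have h2 := RingHom.IsStandardSmoothOfRelativeDimension.equiv
    (Scheme.ΓSpecIso (.of k)).symm.commRingCatIsoToRingEquiv
  exact h.comp h2

theorem exists_etaleCoordinates [SmoothOfRelativeDimension n (X ↘ Spec (.of k))] (x : X) :
    ∃ U : X.AffineZariskiSite, x ∈ U.1 ∧ Nonempty (EtaleCoordinates k Γ(X, U.1) n) := by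
  obtain ⟨U, -, V, hV, hx, e, h⟩ :=
    SmoothOfRelativeDimension.exists_isStandardSmoothOfRelativeDimension (n := n)
      (f := X ↘ Spec (.of k)) x
  have := isStandardSmooth_sections hx e h
  exact ⟨⟨V, hV⟩, hx, EtaleCoordinates.exists_of_isStandardSmooth⟩

attribute [local instance] algebraFunctionRing

theorem restrictFunction_comp_algebraMap {U V : X.AffineZariskiSite} (i : V ⟶ U) :
    (restrictFunction k i).comp (algebraMap k (FunctionRing k X U.1)) =
      algebraMap k (FunctionRing k X V.1) := by
  ext a
  exact (restrictFunction_algebraMap k i _).trans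
    (congrArg (algebraMap _ (FunctionRing k X V.1)) (map_algebraSections k _ a))

variable [Smooth (X ↘ Spec (.of k))]

theorem mem_range_chart_iff {U : X.AffineZariskiSite} {e : cotangentBundle k X} :
    e ∈ Set.range (chart k U) ↔ proj k X e ∈ U.1 := by
  rw [← mem_image_chart_iff k, Scheme.Hom.image_top_eq_opensRange]
  exact Iff.rfl

theorem comap_germAt {U V : X.AffineZariskiSite} (i : V ⟶ U) {e : cotangentBundle k X}
    (he : e ∈ (chart k U) ''ᵁ ⊤) (he' : e ∈ (chart k V) ''ᵁ ⊤) :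
    (maximalIdeal ((cotangentBundle k X).presheaf.stalk e)).comap (germAt k U he) =
      ((maximalIdeal ((cotangentBundle k X).presheaf.stalk e)).comap (germAt k V he')).comap
        (restrictFunction k i) := by
  rw [Ideal.comap_comap]
  congr 1
  ext a
  exact (germAt_restrictFunction k i he he' a).symm

variable {C : Set (cotangentBundle k X)}

/-- The dimension of `C` in the chart `T^* U`. -/
noncomputable def chartDim (C : Set (cotangentBundle k X)) (U : X.AffineZariskiSite) :
    WithBot ℕ∞ :=
  ringKrullDim (FunctionRing k X U.1 ⧸ chartIdeal (chart k U) C)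

theorem ringKrullDim_quotient_idealAt_eq_chartDim (hC : IsClosed C) (hirr : IsIrreducible C)
    {U : X.AffineZariskiSite} (c : EtaleCoordinates k Γ(X, U.1) n) {e : cotangentBundle k X}
    (heC : e ∈ C) (he : e ∈ (chart k U) ''ᵁ ⊤)
    (hmax : ((maximalIdeal ((cotangentBundle k X).presheaf.stalk e)).comap
      (germAt k U he)).IsMaximal) :
    ringKrullDim ((cotangentBundle k X).presheaf.stalk e ⧸ idealAt C e) = chartDim C U := by
  have := finiteType_functionRing U.2 c
  exact ringKrullDim_quotient_idealAt (R := .of (FunctionRing k X U.1)) k hC hirr heC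
    (isGerm_germAt k U he) hmax

/-- A maximal ideal of functions on the smaller chart that contains the ideal of `C` gives a point
at which both dimensions are that of the local ring of `C`. -/
theorem chartDim_eq_of_hom (hC : IsClosed C) (hirr : IsIrreducible C)
    {U V : X.AffineZariskiSite} (c : EtaleCoordinates k Γ(X, U.1) n) (i : V ⟶ U)
    {z : cotangentBundle k X} (hz : z ∈ C) (hzV : proj k X z ∈ V.1) :
    chartDim C V = chartDim C U := by
  obtain ⟨p, rfl⟩ := mem_range_chart_iff.2 hzV
  obtain ⟨m, hm, hle⟩ := Ideal.exists_le_maximal (chartIdeal (chart k V) C)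
    (isPrime_chartIdeal hirr hz).ne_top
  let q : Spec (.of (FunctionRing k X V.1)) := ⟨m, hm.isPrime⟩
  have hqC : chart k V q ∈ C := (mem_iff_chartIdeal_le hC q).2 hle
  have hqV : chart k V q ∈ (chart k V) ''ᵁ ⊤ :=
    (mem_image_chart_iff k).2 (mem_range_chart_iff.1 ⟨q, rfl⟩)
  have hqU : chart k V q ∈ (chart k U) ''ᵁ ⊤ :=
    (mem_image_chart_iff k).2
      (Scheme.AffineZariskiSite.toOpens_mono i.le ((mem_image_chart_iff k).1 hqV))
  have hmV : ((maximalIdeal ((cotangentBundle k X).presheaf.stalk (chart k V q))).comap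
      (germAt k V hqV)).IsMaximal := by
    obtain ⟨q', hq', h⟩ := (isGerm_germAt k V hqV).exists_point
    obtain rfl : q' = q := (chart k V).injective hq'
    exact h ▸ hm
  have := finiteType_functionRing V.2 (restrictCoordinates i c)
  have hmU : ((maximalIdeal ((cotangentBundle k X).presheaf.stalk (chart k V q))).comap
      (germAt k U hqU)).IsMaximal := by
    rw [comap_germAt i hqU hqV]
    exact FiniteTypeDimension.isMaximal_comap (k := k) _ (restrictFunction_comp_algebraMap i) _
  rw [← ringKrullDim_quotient_idealAt_eq_chartDim hC hirr (restrictCoordinates i c) hqC hqV hmV,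
    ringKrullDim_quotient_idealAt_eq_chartDim hC hirr c hqC hqU hmU]

theorem chartDim_eq (hC : IsClosed C) (hirr : IsIrreducible C)
    {U V : X.AffineZariskiSite} (c : EtaleCoordinates k Γ(X, U.1) n)
    (d : EtaleCoordinates k Γ(X, V.1) n) {y z : cotangentBundle k X} (hy : y ∈ C)
    (hyU : proj k X y ∈ U.1) (hz : z ∈ C) (hzV : proj k X z ∈ V.1) :
    chartDim C U = chartDim C V := by
  obtain ⟨w, hwC, hwU, hwV⟩ := hirr.isPreirreducible _ _ (proj k X ⁻¹ᵁ U.1).isOpen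
    (proj k X ⁻¹ᵁ V.1).isOpen ⟨y, hy, hyU⟩ ⟨z, hz, hzV⟩
  obtain ⟨W, i, j, hW⟩ := exists_hom_hom U V hwU hwV
  rw [← chartDim_eq_of_hom hC hirr c i hwC hW, chartDim_eq_of_hom hC hirr d j hwC hW]

/-- At a closed point of an irreducible closed subset of dimension `n`, the local dimension
is `n`. -/
theorem ringKrullDim_quotient_idealAt_eq [SmoothOfRelativeDimension n (X ↘ Spec (.of k))]
    (hC : IsClosed C) (hirr : IsIrreducible C) {m : ℕ} (hdim : topologicalKrullDim C = m)
    {e : cotangentBundle k X} (heC : e ∈ C) (hclosed : IsClosed {e}) :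
    ringKrullDim ((cotangentBundle k X).presheaf.stalk e ⧸ idealAt C e) = m := by
  obtain ⟨z, hz⟩ := exists_forall_le_topologicalKrullDim hdim
  obtain ⟨U, heU, ⟨c⟩⟩ := exists_etaleCoordinates (k := k) (n := n) (proj k X e)
  obtain ⟨V, hzV, ⟨d⟩⟩ := exists_etaleCoordinates (k := k) (n := n) (proj k X z.1)
  have he : e ∈ (chart k U) ''ᵁ ⊤ := (mem_image_chart_iff k).2 heU
  have hmax : ((maximalIdeal ((cotangentBundle k X).presheaf.stalk e)).comap
      (germAt k U he)).IsMaximal := by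
    obtain ⟨p, hp, h⟩ := (isGerm_germAt k U he).exists_point
    exact h ▸ isMaximal_of_isClosed hclosed hp
  rw [ringKrullDim_quotient_idealAt_eq_chartDim hC hirr c heC he hmax]
  refine le_antisymm (hdim ▸ ringKrullDim_quotient_chartIdeal_le hC) ?_
  rw [chartDim_eq hC hirr c d heC heU z.2 hzV]
  obtain ⟨j, hj, hmem⟩ := exists_isOpenEmbedding (g := chart k V) hC
  have := hz j hj (hmem z (mem_range_chart_iff.2 hzV))
  rwa [PrimeSpectrum.topologicalKrullDim_eq_ringKrullDim] at this

theorem ev_eq_zero_of_mem_idealAt {e : cotangentBundle k X} (heC : e ∈ C)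
    (ev : (cotangentBundle k X).presheaf.stalk e →ₐ[k] k)
    (a) (ha : a ∈ idealAt C e) : ev a = 0 := by
  rw [← mem_maximalIdeal_iff ev]
  have h : closedPoint ((cotangentBundle k X).presheaf.stalk e) ∈
      (cotangentBundle k X).fromSpecStalk e ⁻¹' C := by
    change (cotangentBundle k X).fromSpecStalk e (closedPoint _) ∈ C
    rwa [Scheme.fromSpecStalk_closedPoint]
  exact (PrimeSpectrum.mem_vanishingIdeal _ _).1 ha _ h

/-- The tangent space of `C` at a regular closed point has the dimension of `C`. -/
theorem finrank_tangentCoords_eq [SmoothOfRelativeDimension n (X ↘ Spec (.of k))]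
    (hC : IsClosed C) (hirr : IsIrreducible C) {m : ℕ} (hdim : topologicalKrullDim C = m)
    {e : cotangentBundle k X} (heC : e ∈ C) (hclosed : IsClosed {e}) (hreg : IsRegularAt C e)
    {U : X.AffineZariskiSite} (c : EtaleCoordinates k Γ(X, U.1) n) (he : e ∈ (chart k U) ''ᵁ ⊤)
    (ev : (cotangentBundle k X).presheaf.stalk e →ₐ[k] k) :
    finrank k (tangentCoords c he ev C) = m := by
  have : IsRegularLocalRing ((cotangentBundle k X).presheaf.stalk e ⧸ idealAt C e) := hreg
  have h1 := ringKrullDim_quotient_idealAt_eq (n := n) hC hirr hdim heC hclosed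
  have h2 := (IsRegularLocalRing.iff_finrank_cotangentSpace _).1 this
  rw [finrank_tangentCoords, finrank_killing ev (ev_eq_zero_of_mem_idealAt heC ev)]
  exact_mod_cast h2.trans h1

end SmoothScheme

/-! ### Intersection indices and the exceptional condition -/

namespace SmoothScheme

open PointDerivation LagrangianLinearAlgebra IsLocalRing Module

variable {k : Type u} [Field k] {X : Scheme.{u}} [X.Over (Spec (.of k))]
  [Smooth (X ↘ Spec (.of k))] {n : ℕ} {C : Set (cotangentBundle k X)} {e : cotangentBundle k X}

theorem ringChar_eq_two_iff : ringChar k = 2 ↔ (2 : k) = 0 := by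
  constructor
  · intro h
    have := ringChar.spec k 2
    rw [h] at this
    exact_mod_cast this.2 dvd_rfl
  · intro h
    have h1 : ringChar k ∣ 2 := (ringChar.spec k 2).1 (by exact_mod_cast h)
    refine ((Nat.dvd_prime Nat.prime_two).1 h1).resolve_left fun h' => ?_
    exact CharP.ringChar_ne_one h'

section

variable {U : X.AffineZariskiSite} (c : EtaleCoordinates k Γ(X, U.1) n)
  (he : e ∈ (chart k U) ''ᵁ ⊤) (ev : (cotangentBundle k X).presheaf.stalk e →ₐ[k] k)

/-- The exceptional condition in étale coordinates. -/
theorem isExceptional_iff : IsExceptional k C e ↔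
    (2 : k) = 0 ∧ (∀ v ∈ tangentCoords c he ev C, v.2 v.1 = 0) ∧
      Odd (finrank k ((tangentCoords c he ev C).map (LinearMap.fst k (Fin n → k) _))) := by
  rw [IsExceptional, ringChar_eq_two_iff, projRank_eq c he ev]
  exact and_congr_right fun h2 => by rw [isKappaIsotropic_iff c he ev h2]

/-- A section `df` through `e` has intersection index one with `C` if and only if its tangent
space, the graph of the Hessian form, is transversal to the tangent space of `C`. -/
theorem intersectionIndex_eq_one_iff (heC : e ∈ C) {f : Γ(X, U.1)} {y : Spec Γ(X, U.1)}
    (h : differential k U f y = e) : intersectionIndex C (differential k U f) y = 1 ↔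
      graphInter (tangentCoords c he ev C) (hessian c (ev.comp (baseGerm he)) f) = ⊥ := by
  obtain ⟨A, _, _, _, _, β, s, hs, hA⟩ := exists_isSectionAt c he ev h
  obtain ⟨ρ, hρ, hC⟩ := hA f h
  have hβ : (ev.comp s).comp β = ev.comp (baseGerm he) := AlgHom.ext fun a => congrArg ev (hs a)
  rw [hC, ← hβ]
  exact hρ.length_eq_one_iff (isTangentChart c he ev) (ev_eq_zero_of_mem_idealAt heC ev)
    fun a => congrArg (fun φ => φ a) (algHom_eq ((ev.comp s).comp ρ) ev)

/-- A Hessian form with a one-dimensional intersection is completed by a cubic term to a function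
of index two. -/
theorem hasFunctionOfIndex_two (heC : e ∈ C) (h2 : (2 : k) = 0)
    (hiso : ∀ v ∈ tangentCoords c he ev C, v.2 v.1 = 0)
    {q : (Fin n → k) →ₗ[k] Dual k (Fin n → k)}
    (hq : finrank k (graphInter (tangentCoords c he ev C) (symm q)) = 1) :
    HasFunctionOfIndex k C e 2 := by
  obtain ⟨y, hy⟩ := exists_point_differential c he ev
  let F (l : Dual k (Fin n → k)) (γ : k) : Γ(X, U.1) := testFunction c (ev.comp (baseGerm he))
    (fun i => ev (fieldGerm he (c.partialDeriv i))) q l γ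
  have hF (l γ) : differential k U (F l γ) y = e := hy _ fun i =>
    ev_partialDeriv_testFunction c (ev.comp (baseGerm he)) _ q l γ i
  obtain ⟨A, _, _, _, _, β, s, hs, hA⟩ := exists_isSectionAt c he ev (hF 0 0)
  choose ρ hρ hC using fun l γ => hA _ (hF l γ)
  have hβ : ev.comp (baseGerm he) = (ev.comp s).comp β :=
    AlgHom.ext fun a => (congrArg ev (hs a)).symm
  obtain ⟨l, γ, hlength⟩ := exists_length_eq_two h2 (isTangentChart c he ev)
    (ev_eq_zero_of_mem_idealAt heC ev) hiso hq ρ fun l γ => by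
      rw [← hβ]
      exact hρ l γ
  exact ⟨U, F l γ, y, hF l γ, (hC l γ C).trans hlength⟩

/-- A symmetrized form that is transversal to the tangent space of `C` is the Hessian of a quadratic
function of index one. -/
theorem hasFunctionOfIndex_one (heC : e ∈ C) {q : (Fin n → k) →ₗ[k] Dual k (Fin n → k)}
    (hq : graphInter (tangentCoords c he ev C) (symm q) = ⊥) : HasFunctionOfIndex k C e 1 := by
  obtain ⟨y, hy⟩ := exists_point_differential c he ev
  let f : Γ(X, U.1) := testFunction c (ev.comp (baseGerm he))
    (fun i => ev (fieldGerm he (c.partialDeriv i))) q 0 0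
  have hf : differential k U f y = e := hy _ fun i =>
    ev_partialDeriv_testFunction c (ev.comp (baseGerm he)) _ q 0 0 i
  refine ⟨U, f, y, hf, (intersectionIndex_eq_one_iff c he ev heC hf).2 ?_⟩
  rw [hessian_testFunction, hq]

/-- In a common smaller chart, the Hessian of a function of index one is a form whose graph is
transversal to the tangent space of `C`. In characteristic two it is alternating. -/
theorem exists_graphInter_eq_bot_of_hasFunctionOfIndex_one (heC : e ∈ C)
    (h : HasFunctionOfIndex k C e 1) :
    ∃ q : (Fin n → k) →ₗ[k] Dual k (Fin n → k), ((2 : k) = 0 → ∀ u, q u u = 0) ∧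
      graphInter (tangentCoords c he ev C) q = ⊥ := by
  obtain ⟨V, f, y, hf, hindex⟩ := h
  have heV : proj k X e ∈ V.1 := by
    rw [← hf, ← Scheme.Hom.comp_apply, differential_proj, ← SetLike.mem_coe, ← V.2.range_fromSpec]
    exact ⟨y, rfl⟩
  obtain ⟨W, i, j, hW⟩ := exists_hom_hom U V ((mem_image_chart_iff k).1 he) heV
  have heW : e ∈ (chart k W) ''ᵁ ⊤ := (mem_image_chart_iff k).2 hW
  obtain ⟨y', hy', hC⟩ := exists_restrict_differential j heW hf
  refine ⟨hessian (restrictCoordinates i c) (ev.comp (baseGerm heW)) (res j f),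
    fun h2 => hessian_self _ _ _ h2, ?_⟩
  rw [← tangentCoords_restrictCoordinates i he heW c ev C]
  exact (intersectionIndex_eq_one_iff _ heW ev heC hy').1 ((hC C).trans hindex)

end

end SmoothScheme

open SmoothScheme LagrangianLinearAlgebra Module

theorem proposition4p12 {k : Type u} [Field k] [IsAlgClosed k] {n : ℕ}
    {X : Scheme.{u}} [X.Over (Spec (.of k))] [Smooth (X ↘ Spec (.of k))]
    [SmoothOfRelativeDimension n (X ↘ Spec (.of k))] [QuasiCompact (X ↘ Spec (.of k))]
    (C : Set (SmoothScheme.cotangentBundle k X)) (hclosed : IsClosed C) (hirr : IsIrreducible C)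
    (hconical : SmoothScheme.IsConical k C) (hdim : topologicalKrullDim C = n)
    (e : SmoothScheme.cotangentBundle k X) (he : IsClosed {e}) (heC : e ∈ C)
    (hreg : SmoothScheme.IsRegularAt C e) :
    (SmoothScheme.HasFunctionOfIndex k C e 1 ↔ ¬ SmoothScheme.IsExceptional k C e) ∧
      (SmoothScheme.IsExceptional k C e → SmoothScheme.HasFunctionOfIndex k C e 2) := by
  obtain ⟨U, heU, ⟨c⟩⟩ := exists_etaleCoordinates (k := k) (n := n) (proj k X e)
  have heU' : e ∈ (chart k U) ''ᵁ ⊤ := (mem_image_chart_iff k).2 heU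
  obtain ⟨ev⟩ := exists_evaluation c heU' he
  have hV : finrank k (tangentCoords c heU' ev C) = finrank k (Fin n → k) := by
    rw [finrank_tangentCoords_eq hclosed hirr hdim heC he hreg, finrank_fin_fun]
  obtain ⟨q, hq⟩ := exists_graphInter_eq_bot_or (tangentCoords c heU' ev C) hV
  have hsymm (h2 : (2 : k) = 0) (u) : symm q u u = 0 := by
    rw [LinearMap.add_apply, LinearMap.add_apply, LinearMap.flip_apply, ← two_mul, h2, zero_mul]
  rw [isExceptional_iff c heU' ev]
  refine ⟨⟨fun h => ?_, fun h => ?_⟩, fun h => ?_⟩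
  · rintro ⟨h2, hiso, hodd⟩
    obtain ⟨b, hb, hbot⟩ := exists_graphInter_eq_bot_of_hasFunctionOfIndex_one c heU' ev heC h
    have := even_finrank_graphInter_add _ hV hiso b (hb h2)
    rw [hbot, finrank_bot, zero_add] at this
    exact Nat.not_even_iff_odd.2 hodd this
  · obtain hq | ⟨h2, hiso, hq⟩ := hq
    · exact hasFunctionOfIndex_one c heU' ev heC hq
    · have := even_finrank_graphInter_add _ hV hiso (symm q) (hsymm h2)
      rw [hq, add_comm, Nat.even_add_one, Nat.not_even_iff_odd] at this
      exact (h ⟨h2, hiso, this⟩).elim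
  · obtain ⟨h2, hiso, hodd⟩ := h
    obtain hq | ⟨-, -, hq⟩ := hq
    · have := even_finrank_graphInter_add _ hV hiso (symm q) (hsymm h2)
      rw [hq, finrank_bot, zero_add] at this
      exact (Nat.not_even_iff_odd.2 hodd this).elim
    · exact hasFunctionOfIndex_two c heU' ev heC h2 hiso hq
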